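/- Let $\Omega_+=\{(x,y)\in\mathbb R^2: y>1\}$ and $\mathbf e_1=(1,0)$. For a real vector field $\mathbf f=(F_1,F_2)\in C_c^\infty(\Omega_+)$, Problem 2 is $$-(\mathbf u\cdot\nabla)\mathbf u-\partial_x\mathbf u+\Delta\mathbf u-\nabla p=\mathbf f,\qquad \nabla\cdot\mathbf u=0\quad\text{in }\Omega_+,\qquad \mathbf u|_{\partial\Omega_+}=0,\qquad \lim_{|\mathbf x|\to\infty}\mathbf u=0 .$$ *Weak solutions.* Let $\mathcal D$ be the space of smooth divergence-free vector fields with compact support in $\Omega_+$, and let $D$ be its completion for the scalar product $\int_{\Omega_+}\nabla\mathbf w_1:\nabla\mathbf w_2\,d\mathbf x$, realised as a space of vector fields on $\Omega_+$ (limits in $L^2_{loc}(\Omega_+)$ of sequences of $\mathcal D$ whose gradients converge in $L^2(\Omega_+)$), identified when equal almost everywhere. A weak solution of Problem 2 with source $\mathbf f$ is a $\tilde{\mathbf u}\in D$ such that $$\int_{\Omega_+}\nabla\tilde{\mathbf u}:\nabla\mathbf w\,d\mathbf x+\int_{\Omega_+}\big[(\tilde{\mathbf u}+\mathbf e_1)\cdot\nabla\tilde{\mathbf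 u}\big]\cdot\mathbf w\,d\mathbf x=-\int_{\Omega_+}\mathbf f\cdot\mathbf w\,d\mathbf x\quad\text{for all }\mathbf w\in\mathcal D,$$ $$\int_{\Omega_+}|\nabla\tilde{\mathbf u}|^2\,d\mathbf x\le-\int_{\Omega_+}\mathbf f\cdot\tilde{\mathbf u}\,d\mathbf x .$$ *$\alpha$-solutions.* Put $\mu_{\alpha,r}(k,t)=\big(1+(|k|t^r)^\alpha\big)^{-1}$. For $p,q\ge0$ let $\mathcal B_{\alpha,p,q}$ be the space of continuous $\hat g:(\mathbb R\setminus\{0\})\times[1,\infty)\to\mathbb C$ for which $$\|\hat g;\mathcal B_{\alpha,p,q}\|=\sup_{t\ge1}\sup_{k\ne0}\frac{|\hat g(k,t)|}{t^{-p}\mu_{\alpha,1}(k,t)+t^{-q}\mu_{\alpha,2}(k,t)}$$ is finite, and let $\mathcal U_\alpha=\mathcal B_{\alpha,5/2,1}\times\mathcal B_{\alpha,1/2,0}\times\mathcal B_{\alpha,1/2,1}$ with the sum of the three norms. Write $\hat g(k,y)=\int_{\mathbb R}e^{ikx}g(x,y)\,dx$, so that the inverse transform is $g(x,y)=\frac1{2\pi}\int_{\mathbb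 R}e^{-ikx}\hat g(k,y)\,dk$. A real vector field $\bar{\mathbf u}$ on $\Omega_+$ is an $\alpha$-solution of Problem 2 with source $\mathbf f$ if its two components are the inverse transforms of functions $\hat u,\hat v$ for which there is $\hat\omega$ with $\hat{\mathbf u}:=(\hat\omega,\hat u,\hat v)\in\mathcal U_\alpha$, $\hat u(k,1)=\hat v(k,1)=0$ for $k\neq0$, and, for all $k\ne0$ and $y>1$, $\hat u=-\hat\eta+\hat\phi$ and $\hat v=\hat\omega+\hat\psi$ for some functions $\hat\eta,\hat\phi,\hat\psi$ such that $$\partial_y\hat\omega=-ik\hat\eta+\hat Q_1,\quad \partial_y\hat\eta=(ik+1)\hat\omega+\hat Q_0,\quad \partial_y\hat\psi=ik\hat\phi-\hat Q_1,\quad \partial_y\hat\phi=-ik\hat\psi+\hat Q_0,$$ where $\hat Q_0=\frac1{2\pi}(\hat u*\hat\omega)+\hat F_2$ and $\hat Q_1=\frac1{2\pi}(\hat v*\hat\omega)-\hat F_1$, with convolution in $k$. **Theorem.** For every $\alpha>3$ there is $\eta_\alpha>0$, depending only on $\alpha$, such that, for every real vector field $\mathbf f\in C_c^\infty(\Omega_+)$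 and every $\alpha$-solution $\bar{\mathbf u}$ of Problem 2 with source $\mathbf f$ satisfying $\|\hat{\mathbf u};\mathcal U_\alpha\|<\eta_\alpha$, any weak solution $\tilde{\mathbf u}\in D$ of Problem 2 with source $\mathbf f$ coincides with $\bar{\mathbf u}$ (almost everywhere in $\Omega_+$). -/

import Mathlib

open scoped ENNReal Topology

noncomputable section

namespace HalfPlaneNS

open MeasureTheory Filter

/-! ### The half-plane and the energy space -/

/-- The open half-plane `Ω₊ = {(x, y) : y > 1}`. -/
def Omega : Set (ℝ × ℝ) := {p | 1 < p.2}

/-- A planar vector field; component `0` is along `x`, component `1` along `y`.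
Only its values on `Omega` (up to null sets for the weak notions) matter. -/
abbrev VField := ℝ × ℝ → Fin 2 → ℝ

/-- A planar matrix field; `G p i j` stands for the derivative in direction `i`
of component `j` when `G` is a gradient. -/
abbrev MField := ℝ × ℝ → Fin 2 → Fin 2 → ℝ

/-- The coordinate directions of the plane. -/
def dir (i : Fin 2) : ℝ × ℝ := if i = 0 then (1, 0) else (0, 1)

/-- The classical gradient, `grad w p i j = ∂_i w_j (p)`. -/
def grad (w : VField) : MField := fun p i j => fderiv ℝ w p (dir i) j

/-- Smooth vector fields with compact support contained in `Omega`. -/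
structure IsSmoothCompact (f : VField) : Prop where
  smooth : ContDiff ℝ ((⊤ : ℕ∞) : WithTop ℕ∞) f
  compact : HasCompactSupport f
  support : tsupport f ⊆ Omega

/-- The space `𝒟` of smooth divergence-free vector fields with compact support in `Omega`. -/
structure IsTest (w : VField) : Prop where
  smoothCompact : IsSmoothCompact w
  divFree : ∀ p, grad w p 0 0 + grad w p 1 1 = 0

/-- `u` belongs to the completion `D` of `𝒟` for the scalar product `∫ ∇w₁ : ∇w₂`, and `G` is
its gradient: there are `w n ∈ 𝒟` whose gradients converge to `G` in `L²(Omega)` and which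
converge to `u` in `L²` on every compact subset of `Omega`. -/
structure MemDWith (u : VField) (G : MField) : Prop where
  meas : ∀ j, AEStronglyMeasurable (fun p => u p j) (volume.restrict Omega)
  measGrad : ∀ i j, AEStronglyMeasurable (fun p => G p i j) (volume.restrict Omega)
  approx : ∃ w : ℕ → VField, (∀ n, IsTest (w n)) ∧
    (∀ i j, Tendsto (fun n => eLpNorm (fun p => grad (w n) p i j - G p i j) 2
      (volume.restrict Omega)) atTop (𝓝 0)) ∧
    (∀ K : Set (ℝ × ℝ), IsCompact K → K ⊆ Omega → ∀ j,
      Tendsto (fun n => eLpNorm (fun p => w n p j - u p j) 2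
        (volume.restrict K)) atTop (𝓝 0))

/-! ### Weak solutions -/

/-- The dot product of two vector fields. -/
def dot (v w : VField) : ℝ × ℝ → ℝ := fun p => ∑ j, v p j * w p j

/-- The contraction `G : H` of two matrix fields. -/
def contract (G H : MField) : ℝ × ℝ → ℝ := fun p => ∑ i, ∑ j, G p i j * H p i j

/-- The unit vector in the direction of `x`. -/
def e1 : Fin 2 → ℝ := fun i => if i = 0 then 1 else 0

/-- The field `(u + e₁) · ∇u`, where `G` is the gradient of `u`. -/
def advection (u : VField) (G : MField) : VField :=
  fun p j => ∑ i, (u p i + e1 i) * G p i j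

/-- Weak solutions `u ∈ D` of `-(u·∇)u - ∂ₓu + Δu - ∇p = f`, `∇·u = 0` in `Omega`, with `u = 0`
on the boundary and at infinity, satisfying the energy inequality. -/
def IsWeakSolution (f u : VField) : Prop :=
  ∃ G : MField, MemDWith u G ∧
    (∀ w : VField, IsTest w →
      (∫ p in Omega, contract G (grad w) p) + (∫ p in Omega, dot (advection u G) w p)
        = -∫ p in Omega, dot f w p) ∧
    (∫ p in Omega, contract G G p) ≤ -∫ p in Omega, dot f u p

/-! ### The spaces `𝓑` and `𝓤` -/

/-- The weight `μ_{α,r}(k,t) = 1 / (1 + (|k| t^r)^α)`. -/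
def mu (α r k t : ℝ) : ℝ := 1 / (1 + (|k| * t ^ r) ^ α)

/-- The norm of `𝓑_{α,p,q}`, with value `∞` allowed. -/
def bNorm (α p q : ℝ) (g : ℝ → ℝ → ℂ) : ℝ≥0∞ :=
  ⨆ (t : ℝ) (_ : 1 ≤ t) (k : ℝ) (_ : k ≠ 0),
    ENNReal.ofReal (‖g k t‖ / (1 / t ^ p * mu α 1 k t + 1 / t ^ q * mu α 2 k t))

/-- Membership in `𝓑_{α,p,q}`: continuity on `(ℝ ∖ {0}) × [1,∞)` and finite norm.
Values at `k = 0` are irrelevant. -/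
def MemB (α p q : ℝ) (g : ℝ → ℝ → ℂ) : Prop :=
  ContinuousOn (fun z : ℝ × ℝ => g z.1 z.2) {z | z.1 ≠ 0 ∧ 1 ≤ z.2} ∧ bNorm α p q g < ∞

/-- Membership of `(ω, u, v)` in `𝓤_α = 𝓑_{α,5/2,1} × 𝓑_{α,1/2,0} × 𝓑_{α,1/2,1}`. -/
def MemU (α : ℝ) (ω u v : ℝ → ℝ → ℂ) : Prop :=
  MemB α (5 / 2) 1 ω ∧ MemB α (1 / 2) 0 u ∧ MemB α (1 / 2) 1 v

/-- The norm of `(ω, u, v)` in the product space `𝓤_α`. -/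
def uNorm (α : ℝ) (ω u v : ℝ → ℝ → ℂ) : ℝ≥0∞ :=
  bNorm α (5 / 2) 1 ω + bNorm α (1 / 2) 0 u + bNorm α (1 / 2) 1 v

/-! ### `α`-solutions -/

/-- Fourier transform in `x`: `ĝ(k,y) = ∫ e^{ikx} g(x,y) dx`. -/
def fourierX (g : ℝ × ℝ → ℝ) (k y : ℝ) : ℂ :=
  ∫ x : ℝ, Complex.exp (Complex.I * k * x) * (g (x, y) : ℂ)

/-- The inverse transform: `g(x,y) = (2π)⁻¹ ∫ e^{-ikx} ĝ(k,y) dk`. -/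
def invFourierX (g : ℝ → ℝ → ℂ) (x y : ℝ) : ℂ :=
  (1 / (2 * Real.pi) : ℂ) * ∫ k : ℝ, Complex.exp (-(Complex.I * k * x)) * g k y

/-- Convolution in `k` at fixed `y`. -/
def convK (g h : ℝ → ℝ → ℂ) (k y : ℝ) : ℂ := ∫ l : ℝ, g (k - l) y * h l y

/-- `Q̂₀ = (2π)⁻¹ û * ω̂ + F̂₂`. -/
def Q0 (f : VField) (ω u : ℝ → ℝ → ℂ) (k y : ℝ) : ℂ :=
  (1 / (2 * Real.pi) : ℂ) * convK u ω k y + fourierX (fun p => f p 1) k y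

/-- `Q̂₁ = (2π)⁻¹ v̂ * ω̂ - F̂₁`. -/
def Q1 (f : VField) (ω v : ℝ → ℝ → ℂ) (k y : ℝ) : ℂ :=
  (1 / (2 * Real.pi) : ℂ) * convK v ω k y - fourierX (fun p => f p 0) k y

/-- The velocity field `ubar` is an `α`-solution with source `f`, with Fourier data
`(ω, u, v) ∈ 𝓤_α` (the transforms in `x` of vorticity and velocity): `u = -η + φ` and
`v = ω + ψ` for a solution `(ω, η, φ, ψ)` of the first-order system in `y` which the
Navier-Stokes equations become under the Fourier transform in `x`, the velocity vanishes on the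
wall `y = 1`, and `ubar` is the (real-valued) inverse transform of `(u, v)`. -/
structure IsAlphaSolution (α : ℝ) (f : VField) (ω u v : ℝ → ℝ → ℂ) (ubar : VField) : Prop where
  memU : MemU α ω u v
  system : ∃ η φ ψ : ℝ → ℝ → ℂ, ∀ k : ℝ, k ≠ 0 → ∀ y : ℝ, 1 < y →
    u k y = -η k y + φ k y ∧
    v k y = ω k y + ψ k y ∧
    HasDerivAt (fun t => ω k t) (-(Complex.I * k) * η k y + Q1 f ω v k y) y ∧
    HasDerivAt (fun t => η k t) ((Complex.I * k + 1) * ω k y + Q0 f ω u k y) y ∧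
    HasDerivAt (fun t => ψ k t) (Complex.I * k * φ k y - Q1 f ω v k y) y ∧
    HasDerivAt (fun t => φ k t) (-(Complex.I * k) * ψ k y + Q0 f ω u k y) y
  wall : ∀ k : ℝ, k ≠ 0 → u k 1 = 0 ∧ v k 1 = 0
  inverse : ∀ x y : ℝ, 1 < y →
    ((ubar (x, y) 0 : ℝ) : ℂ) = invFourierX u x y ∧
    ((ubar (x, y) 1 : ℝ) : ℂ) = invFourierX v x y

end HalfPlaneNS

end

noncomputable section

namespace HalfPlaneNS

open MeasureTheory Filter Real
open scoped FourierTransform ContDiff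

/-! ### The Fourier transform on a horizontal line -/

/-! The theorem is a weak–strong uniqueness statement. Let `Z` be the weak solution with gradient
`H`, and `U` the small `α`-solution with gradient `G`. The energy inequality for `Z`, the equation
of `Z` tested with `U` (`SmallFlow.weak_tested`), and the equation of `U` tested with `Z` and with
`U` itself (`SmallFlow.momentum_energy`) are added up. The forcing cancels; since `∇|U|²/2` is
orthogonal to solenoidal fields and `∫ U·∂ₓU = 0`, what is left is `∫ |∇(Z-U)|² ≤ ∫
((Z-U)·∇(Z-U))·U`. If `y|U| ≤ M`, Hardy's inequality `‖g/y‖ ≤ 2‖∂_y g‖` bounds the right side by `3M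
∫ |∇(Z-U)|²`, so `3M < 1` forces `Z = U` (`SmallFlow.weak_unique`). `Z` is never used as a test
field in its own equation; the energy inequality replaces that step.

The rest makes `U` admissible. On the Fourier side, `mu_mul_le` exchanges a singularity `|k|^{-θ}`
for a power of decay in `t`. The choice `θ = 3/8` gives majorants integrable and square integrable
in `k`, hence `L²` bounds by Plancherel; the choice `θ = 3/4`, integrable only, gives the pointwise
bound `y|U| ≤ M` with `M` proportional to the norm in `𝓤_α`. The first-order system recombines into
incompressibility and the definition of vorticity. Integrating these from the wall, where the
velocity vanishes, yields the vanishing rates of the velocity and of the stream function `Ψ`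
(`FourierData.smallFlow`).

The momentum equation for `U` comes from testing the equations for `ω` and `η` at each frequency
with the transform of a solenoidal field, then applying Parseval (`FourierData.vorticity_weak`). The
result is a vorticity form, which differs from the velocity form by gradients of Bernoulli type and
by terms that vanish after integration by parts (`SmallFlow.momentumWeak`).

Finally `U` must be a limit of test fields. Cutting off `U` itself would destroy the divergence
condition, so `Ψ` is cut off and mollified instead. Cutoffs with `|∂χ| ≤ C/(y-1)` and `|∂²χ| ≤
C/(y-1)²` suffice, because `Ψ/(y-1)²`, `Ψ/(y-1)` and `U/(y-1)` are square integrable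
(`SmallFlow.exists_approx`). -/

theorem continuous_fourier_of_integrable {g : ℝ → ℂ} (hg : Integrable g) : Continuous (𝓕 g) :=
  VectorFourier.fourierIntegral_continuous (e := Real.fourierChar) (L := innerₗ ℝ)
    Real.continuous_fourierChar (by exact continuous_inner) hg

/-- Plancherel's theorem for functions which are both integrable and square integrable. -/
theorem eLpNorm_fourier_eq {g : ℝ → ℂ} (hg : Integrable g) (hg2 : MemLp g 2) :
    eLpNorm (𝓕 g) 2 volume = eLpNorm g 2 volume := by
  obtain ⟨h, hh⟩ : ∃ h : Lp ℂ 2 (volume : Measure ℝ), h = 𝓕 (hg2.toLp g) := ⟨_, rfl⟩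
  have hcont : Continuous (𝓕 g) := continuous_fourier_of_integrable hg
  -- The isometry is known for the `L²` Fourier transform `h`. It agrees with the integral transform
  -- because both have the same pairing with every smooth compactly supported function, by moving
  -- the transform onto the test function.
  have key : ∀ᵐ x, h x = 𝓕 g x := by
    refine ae_eq_of_integral_contDiff_smul_eq ?_ hcont.locallyIntegrable ?_
    · have hm : MemLp (h : ℝ → ℂ) 2 volume := Lp.memLp h
      exact hm.locallyIntegrable one_le_two
    intro φ hφ hφc
    have hφ' : ContDiff ℝ ∞ (fun x => (φ x : ℂ)) :=
      Complex.ofRealCLM.contDiff.comp hφ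
    have hφc' : HasCompactSupport (fun x => (φ x : ℂ)) :=
      hφc.comp_left (g := fun r : ℝ => (r : ℂ)) Complex.ofReal_zero
    obtain ⟨Φ, hΦ⟩ : ∃ Φ : SchwartzMap ℝ ℂ, ∀ x, Φ x = (φ x : ℂ) :=
      ⟨hφc'.toSchwartzMap hφ', fun x => rfl⟩
    have h1 : Lp.toTemperedDistribution h Φ = ∫ x, φ x • h x := by
      simp [Lp.toTemperedDistribution_apply, hΦ]
    have h2 : Lp.toTemperedDistribution h Φ
        = Lp.toTemperedDistribution (hg2.toLp g) (𝓕 Φ) := by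
      rw [hh, ← Lp.fourier_toTemperedDistribution_eq, TemperedDistribution.fourier_apply]
    have h3 : Lp.toTemperedDistribution (hg2.toLp g) (𝓕 Φ) = ∫ x, (𝓕 Φ) x • g x := by
      rw [Lp.toTemperedDistribution_apply]
      refine integral_congr_ae ?_
      filter_upwards [hg2.coeFn_toLp] with x hx
      rw [hx]
    have h4 : ∫ x, (𝓕 (Φ : ℝ → ℂ)) x • g x = ∫ x, Φ x • 𝓕 g x := by
      have := VectorFourier.integral_fourierIntegral_smul_eq_flip (μ := (volume : Measure ℝ))
        (ν := (volume : Measure ℝ)) (L := innerₗ ℝ) (f := (Φ : ℝ → ℂ)) (g := g)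
        Real.continuous_fourierChar (by exact continuous_inner) Φ.integrable hg
      rw [flip_innerₗ] at this
      exact this
    rw [← h1, h2, h3, SchwartzMap.fourier_coe, h4]
    simp [hΦ]
  rw [← eLpNorm_congr_ae key, ← Lp.enorm_def, hh]
  have : ‖𝓕 (hg2.toLp g)‖ₑ = ‖hg2.toLp g‖ₑ := by
    rw [← ofReal_norm, Lp.norm_fourier_eq, ofReal_norm]
  rw [this, Lp.enorm_def, eLpNorm_congr_ae hg2.coeFn_toLp]

theorem invFourierX_eq_fourier (g : ℝ → ℝ → ℂ) (x y : ℝ) :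
    invFourierX g x y = (1 / (2 * π) : ℂ) * 𝓕 (fun k => g k y) (x / (2 * π)) := by
  rw [invFourierX, Real.fourier_real_eq_integral_exp_smul]
  congr 1
  refine integral_congr_ae (Eventually.of_forall fun k => ?_)
  simp only [smul_eq_mul]
  congr 2
  push_cast
  have : (π : ℂ) ≠ 0 := by exact_mod_cast pi_ne_zero
  field_simp

/-- Plancherel's identity for the inverse transform on a line. -/
theorem lintegral_invFourierX_sq {g : ℝ → ℝ → ℂ} {y : ℝ} (hg : Integrable fun k => g k y)
    (hg2 : MemLp (fun k => g k y) 2) :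
    ∫⁻ x, ‖invFourierX g x y‖ₑ ^ 2 = ENNReal.ofReal (1 / (2 * π)) * ∫⁻ k, ‖g k y‖ₑ ^ 2 := by
  have h1 : ∀ x, ‖invFourierX g x y‖ₑ ^ 2 = ENNReal.ofReal (1 / (2 * π)) ^ 2 *
      ‖𝓕 (fun k => g k y) ((2 * π)⁻¹ * x)‖ₑ ^ 2 := by
    intro x
    rw [invFourierX_eq_fourier, enorm_mul, mul_pow]
    congr 2
    · rw [← ofReal_norm]
      congr 1
      simp [abs_of_pos pi_pos]
    · rw [div_eq_inv_mul]
  simp_rw [h1]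
  rw [lintegral_const_mul' _ _ (by finiteness)]
  have hcont : Continuous (𝓕 (fun k => g k y)) := continuous_fourier_of_integrable hg
  have h3 : ∫⁻ x, ‖𝓕 (fun k => g k y) ((2 * π)⁻¹ * x)‖ₑ ^ 2
      = ENNReal.ofReal (2 * π) * ∫⁻ x, ‖𝓕 (fun k => g k y) x‖ₑ ^ 2 := by
    have hm : Measurable fun x => ‖𝓕 (fun k => g k y) x‖ₑ ^ 2 :=
      (hcont.enorm.measurable).pow_const 2
    have := lintegral_map (μ := volume) hm (measurable_const_mul (2 * π)⁻¹)
    rw [← this, Real.map_volume_mul_left (by positivity), lintegral_smul_measure, inv_inv,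
      abs_of_pos (by positivity), smul_eq_mul]
  have h4 := eLpNorm_fourier_eq hg hg2
  rw [h3]
  rw [eLpNorm_eq_lintegral_rpow_enorm_toReal (by norm_num) (by norm_num),
    eLpNorm_eq_lintegral_rpow_enorm_toReal (by norm_num) (by norm_num)] at h4
  have h5 : ∫⁻ x, ‖𝓕 (fun k => g k y) x‖ₑ ^ 2 = ∫⁻ k, ‖g k y‖ₑ ^ 2 := by
    have := congrArg (fun z : ℝ≥0∞ => z ^ (2 : ℝ)) h4
    simp only [ENNReal.toReal_ofNat, ← ENNReal.rpow_mul] at this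
    norm_num at this
    exact this
  -- One of the two factors `1/(2π)` is absorbed by the Jacobian `2π` of the rescaling of `x`.
  rw [h5, ← mul_assoc, pow_two, mul_assoc (ENNReal.ofReal _), ← ENNReal.ofReal_mul (by positivity)]
  congr 2
  rw [one_div_mul_cancel (by positivity)]
  simp

/-- Parseval's identity between an inverse transform and an integrable function. -/
theorem integral_invFourierX_mul {g : ℝ → ℝ → ℂ} {h : ℝ × ℝ → ℝ} {y : ℝ}
    (hg : Integrable fun k => g k y) (hh : Integrable fun x => h (x, y)) :
    ∫ x : ℝ, invFourierX g x y * (h (x, y) : ℂ)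
      = (1 / (2 * π) : ℂ) * ∫ k, g k y * fourierX h (-k) y := by
  have hint : Integrable (Function.uncurry fun x k : ℝ =>
      Complex.exp (-(Complex.I * k * x)) * g k y * (h (x, y) : ℂ)) (volume.prod volume) := by
    have h1 : Integrable (fun z : ℝ × ℝ => (h (z.1, y) : ℂ) * g z.2 y) (volume.prod volume) :=
      (hh.ofReal (𝕜 := ℂ)).mul_prod hg
    have h2 := h1.bdd_mul (c := 1) (f := fun z : ℝ × ℝ => Complex.exp (-(Complex.I * z.2 * z.1)))
      (by fun_prop) (by
        filter_upwards with z
        rw [Complex.norm_exp]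
        simp)
    refine h2.congr (Eventually.of_forall fun z => ?_)
    simp only [Function.uncurry]
    ring
  simp only [invFourierX, fourierX]
  calc ∫ x : ℝ, (1 / (2 * π) : ℂ) * (∫ k : ℝ, Complex.exp (-(Complex.I * k * x)) * g k y) * (h (x, y) : ℂ)
      = (1 / (2 * π) : ℂ) * ∫ x : ℝ, ∫ k : ℝ, Complex.exp (-(Complex.I * k * x)) * g k y *
          (h (x, y) : ℂ) := by
        rw [← integral_const_mul]
        congr 1
        ext x
        rw [integral_mul_const, mul_assoc]
    _ = (1 / (2 * π) : ℂ) * ∫ k : ℝ, ∫ x : ℝ, Complex.exp (-(Complex.I * k * x)) * g k y *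
          (h (x, y) : ℂ) := by
        rw [integral_integral_swap hint]
    _ = _ := by
        congr 2
        ext k
        rw [← integral_const_mul]
        congr 1
        ext x
        -- The kernel `e^{-ikx}` of the inverse transform is the kernel of the direct one at `-k`;
        -- this is why test functions appear at frequency `-k` from here on.
        rw [show Complex.I * ((-k : ℝ) : ℂ) * x = -(Complex.I * k * x) by push_cast; ring]
        ring

/-- The inverse transform turns convolutions into products. -/
theorem invFourierX_convK {g h : ℝ → ℝ → ℂ} {y : ℝ} (hg : Integrable fun k => g k y)
    (hh : Integrable fun k => h k y) (x : ℝ) :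
    invFourierX (fun k y => (1 / (2 * π) : ℂ) * convK g h k y) x y
      = invFourierX g x y * invFourierX h x y := by
  have h1 := Real.fourier_mul_convolution_eq hh hg (x / (2 * π))
  have h2 : (convolution (fun k => h k y) (fun k => g k y) (ContinuousLinearMap.mul ℂ ℂ) volume)
      = fun k => convK g h k y := by
    ext k
    simp only [convolution, convK, ContinuousLinearMap.mul_apply']
    exact integral_congr_ae (Eventually.of_forall fun l => mul_comm _ _)
  rw [h2] at h1
  have h3 : invFourierX (fun k y => (1 / (2 * π) : ℂ) * convK g h k y) x y
      = (1 / (2 * π) : ℂ) * invFourierX (convK g h) x y := by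
    simp only [invFourierX]
    congr 1
    refine Eq.trans (integral_congr_ae (Eventually.of_forall fun k => ?_))
      (integral_const_mul (1 / (2 * π) : ℂ) _)
    simp only
    ring
  rw [h3, invFourierX_eq_fourier, invFourierX_eq_fourier, invFourierX_eq_fourier, h1]
  ring

theorem integrable_convK {g h : ℝ → ℝ → ℂ} {y : ℝ} (hg : Integrable fun k => g k y)
    (hh : Integrable fun k => h k y) : Integrable fun k => convK g h k y := by
  have := hh.integrable_convolution (ContinuousLinearMap.mul ℂ ℂ) hg
  refine this.congr (Eventually.of_forall fun k => ?_)
  simp only [convolution, convK, ContinuousLinearMap.mul_apply']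
  exact integral_congr_ae (Eventually.of_forall fun l => mul_comm _ _)

/-! ### Transforms of smooth compactly supported functions -/

/-- Partial derivatives of scalar functions of the plane. -/
def pd (i : Fin 2) (h : ℝ × ℝ → ℝ) : ℝ × ℝ → ℝ := fun p => fderiv ℝ h p (dir i)

theorem contDiff_pd {h : ℝ × ℝ → ℝ} (hh : ContDiff ℝ ∞ h) (i : Fin 2) : ContDiff ℝ ∞ (pd i h) :=
  ContDiff.clm_apply (f := fderiv ℝ h) (g := fun _ => dir i) (hh.fderiv_right (m := ∞) (by simp))
    contDiff_const

theorem tsupport_pd_subset (h : ℝ × ℝ → ℝ) (i : Fin 2) : tsupport (pd i h) ⊆ tsupport h :=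
  closure_minimal (fun p hp => by
    refine tsupport_fderiv_subset ℝ (f := h) (subset_tsupport _ fun h0 => hp ?_)
    simp [pd, h0]) (isClosed_tsupport h)

theorem hasCompactSupport_pd {h : ℝ × ℝ → ℝ} (hh : HasCompactSupport h) (i : Fin 2) :
    HasCompactSupport (pd i h) :=
  hh.of_isClosed_subset (isClosed_tsupport _) (tsupport_pd_subset h i)

theorem hasDerivAt_fst {h : ℝ × ℝ → ℝ} {x y : ℝ} (hh : DifferentiableAt ℝ h (x, y)) :
    HasDerivAt (fun x => h (x, y)) (pd 0 h (x, y)) x := by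
  have h1 : HasDerivAt (fun x : ℝ => (x, y)) ((1 : ℝ), (0 : ℝ)) x :=
    (hasDerivAt_id x).prodMk (hasDerivAt_const x y)
  exact hh.hasFDerivAt.comp_hasDerivAt x h1

theorem hasDerivAt_snd {h : ℝ × ℝ → ℝ} {x y : ℝ} (hh : DifferentiableAt ℝ h (x, y)) :
    HasDerivAt (fun y => h (x, y)) (pd 1 h (x, y)) y := by
  have h1 : HasDerivAt (fun y : ℝ => (x, y)) ((0 : ℝ), (1 : ℝ)) y :=
    (hasDerivAt_const y x).prodMk (hasDerivAt_id y)
  exact hh.hasFDerivAt.comp_hasDerivAt y h1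

theorem hasCompactSupport_slice {h : ℝ × ℝ → ℝ} (hh : HasCompactSupport h) (y : ℝ) :
    HasCompactSupport fun x => h (x, y) := by
  refine HasCompactSupport.intro (hh.isCompact.image continuous_fst) fun x hx => ?_
  by_contra hne
  exact hx ⟨(x, y), subset_tsupport _ hne, rfl⟩

theorem integrable_slice {h : ℝ × ℝ → ℝ} (hc : Continuous h) (hh : HasCompactSupport h) (y : ℝ) :
    Integrable fun x => h (x, y) :=
  (hc.comp (by fun_prop)).integrable_of_hasCompactSupport (hasCompactSupport_slice hh y)

/-- A continuous compactly supported function is dominated on all horizontal lines by a fixed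
integrable function. -/
theorem exists_slice_bound {h : ℝ × ℝ → ℝ} (hc : Continuous h) (hh : HasCompactSupport h) :
    ∃ B : ℝ → ℝ, Integrable B ∧ ∀ x y, |h (x, y)| ≤ B x := by
  obtain ⟨C, hC⟩ := hc.bounded_above_of_compact_support hh
  have hK : IsCompact (Prod.fst '' tsupport h) := hh.isCompact.image continuous_fst
  refine ⟨(Prod.fst '' tsupport h).indicator fun _ => C,
    (integrable_indicator_iff hK.measurableSet).2 (integrableOn_const hK.measure_lt_top.ne),
    fun x y => ?_⟩
  by_cases hx : x ∈ Prod.fst '' tsupport h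
  · rw [Set.indicator_of_mem hx]
    exact hC _
  · rw [Set.indicator_of_notMem hx]
    have : h (x, y) = 0 := by
      by_contra hne
      exact hx ⟨(x, y), subset_tsupport _ hne, rfl⟩
    simp [this]

theorem norm_exp_I_mul_mul (k x : ℝ) : ‖Complex.exp (Complex.I * k * x)‖ = 1 := by
  rw [Complex.norm_exp]
  simp

theorem exists_fourierX_le {h : ℝ × ℝ → ℝ} (hc : Continuous h) (hh : HasCompactSupport h) :
    ∃ C, ∀ k y, ‖fourierX h k y‖ ≤ C := by
  obtain ⟨B, hB, hle⟩ := exists_slice_bound hc hh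
  refine ⟨∫ x, B x, fun k y => norm_integral_le_of_norm_le hB (Eventually.of_forall fun x => ?_)⟩
  rw [norm_mul, norm_exp_I_mul_mul, one_mul, Complex.norm_real]
  exact hle x y

theorem continuous_fourierX {h : ℝ × ℝ → ℝ} (hc : Continuous h) (hh : HasCompactSupport h) :
    Continuous fun z : ℝ × ℝ => fourierX h z.1 z.2 := by
  obtain ⟨B, hB, hle⟩ := exists_slice_bound hc hh
  refine continuous_of_dominated (bound := B) (fun z => ?_) (fun z => ?_) hB ?_
  · exact Continuous.aestronglyMeasurable (by fun_prop)
  · refine Eventually.of_forall fun x => ?_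
    rw [norm_mul, norm_exp_I_mul_mul, one_mul, Complex.norm_real]
    exact hle x z.2
  · exact Eventually.of_forall fun x => by fun_prop

theorem fourierX_pd_zero {h : ℝ × ℝ → ℝ} (hs : ContDiff ℝ ∞ h) (hh : HasCompactSupport h)
    (k y : ℝ) : fourierX (pd 0 h) k y = -(Complex.I * k) * fourierX h k y := by
  have hd : ∀ x, HasDerivAt (fun x => (h (x, y) : ℂ)) (pd 0 h (x, y) : ℂ) x := fun x =>
    (hasDerivAt_fst (hs.differentiable (by simp) _)).ofReal_comp
  have he : ∀ x : ℝ, HasDerivAt (fun x : ℝ => Complex.exp (Complex.I * k * x))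
      (Complex.exp (Complex.I * k * x) * (Complex.I * k)) x := fun x => by
    have : HasDerivAt (fun x : ℝ => Complex.I * k * (x : ℂ)) (Complex.I * k * 1) x :=
      (Complex.ofRealCLM.hasDerivAt).const_mul _
    simpa using this.cexp
  have i0 : Integrable fun x => (h (x, y) : ℂ) := (integrable_slice hs.continuous hh y).ofReal
  have i1 : Integrable fun x => (pd 0 h (x, y) : ℂ) :=
    (integrable_slice (contDiff_pd hs 0).continuous (hasCompactSupport_pd hh 0) y).ofReal
  have hb : ∀ {g : ℝ → ℂ}, Integrable g →
      Integrable fun x : ℝ => Complex.exp (Complex.I * k * x) * g x := fun hg =>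
    hg.bdd_mul (c := 1) (by fun_prop) (Eventually.of_forall fun x => (norm_exp_I_mul_mul k x).le)
  have i2 : Integrable ((fun x : ℝ => Complex.exp (Complex.I * k * x) * (Complex.I * k)) *
      fun x => (h (x, y) : ℂ)) := by
    refine ((hb i0).const_mul (Complex.I * k)).congr (Eventually.of_forall fun x => ?_)
    simp only [Pi.mul_apply]
    ring
  have := integral_mul_deriv_eq_deriv_mul_of_integrable (fun x _ => he x) (fun x _ => hd x)
    (hb i1) i2 (hb i0)
  rw [fourierX, this, fourierX, ← integral_neg, ← integral_const_mul]
  congr 1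
  ext x
  ring

/-- Two derivatives in `x` produce a factor `-k²`, and a single integrable bound dominates all
horizontal slices, so the decay is uniform in `y`. -/
theorem exists_fourierX_decay {h : ℝ × ℝ → ℝ} (hs : ContDiff ℝ ∞ h) (hh : HasCompactSupport h) :
    ∃ C, ∀ k y, ‖fourierX h k y‖ ≤ C * (1 + k ^ 2)⁻¹ := by
  obtain ⟨C₀, h₀⟩ := exists_fourierX_le hs.continuous hh
  obtain ⟨C₂, h₂⟩ := exists_fourierX_le (contDiff_pd (contDiff_pd hs 0) 0).continuous (hasCompactSupport_pd (hasCompactSupport_pd hh 0) 0)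
  refine ⟨C₀ + C₂, fun k y => ?_⟩
  have h1 : fourierX (pd 0 (pd 0 h)) k y = -(k : ℂ) ^ 2 * fourierX h k y := by
    rw [fourierX_pd_zero (contDiff_pd hs 0) (hasCompactSupport_pd hh 0), fourierX_pd_zero hs hh]
    linear_combination (k : ℂ) ^ 2 * fourierX h k y * Complex.I_sq
  have h3 := h₂ k y
  rw [h1, norm_mul, norm_neg, norm_pow, Complex.norm_real, Real.norm_eq_abs, sq_abs] at h3
  rw [← div_eq_mul_inv, le_div_iff₀ (by positivity)]
  nlinarith [h₀ k y]

/-- Fourier inversion for smooth compactly supported functions. -/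
theorem invFourierX_fourierX {h : ℝ × ℝ → ℝ} (hs : ContDiff ℝ ∞ h) (hh : HasCompactSupport h)
    (x y : ℝ) : invFourierX (fourierX h) x y = h (x, y) := by
  set f : ℝ → ℂ := fun x => (h (x, y) : ℂ) with hf
  have hfc : Continuous f := Complex.continuous_ofReal.comp (hs.continuous.comp (by fun_prop))
  have hfi : Integrable f := (integrable_slice hs.continuous hh y).ofReal
  -- The library kernel is `e^{-2πikx}`, the one used here is `e^{ikx}`; both the sign and the
  -- factor `2π` go into the frequency.
  have hF : 𝓕 f = fun k => fourierX h (-(2 * π) * k) y := by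
    ext k
    rw [Real.fourier_real_eq_integral_exp_smul, fourierX]
    congr 1
    ext x
    simp only [smul_eq_mul, hf]
    congr 2
    push_cast
    ring
  have hFi : Integrable (𝓕 f) := by
    obtain ⟨C, hC⟩ := exists_fourierX_decay hs hh
    rw [hF]
    have h1 : Integrable fun k => fourierX h k y := by
      refine (integrable_inv_one_add_sq.const_mul C).mono' ?_ (Eventually.of_forall fun k => hC k y)
      exact ((continuous_fourierX hs.continuous hh).comp (by fun_prop : Continuous fun k : ℝ => (k, y))).aestronglyMeasurable
    exact h1.comp_mul_left' (by simp [pi_ne_zero])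
  have hinv : 𝓕⁻ f = fun k => fourierX h (2 * π * k) y := by
    ext k
    rw [Real.fourierInv_eq_fourier_neg, hF]
    simp
  have h2 := congrFun (hfc.fourier_fourierInv_eq hfi hFi) x
  rw [hinv, Real.fourier_real_eq_integral_exp_smul] at h2
  have h3 := Measure.integral_comp_mul_left
    (fun k : ℝ => Complex.exp (-(Complex.I * k * x)) * fourierX h k y) (2 * π)
  rw [invFourierX]
  rw [← h2.trans (by rfl : f x = (h (x, y) : ℂ))]
  have h4 : ∫ v : ℝ, Complex.exp (((-2 * π * v * x : ℝ) : ℂ) * Complex.I) • fourierX h (2 * π * v) y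
      = ∫ v : ℝ, Complex.exp (-(Complex.I * ((2 * π * v : ℝ) : ℂ) * x)) * fourierX h (2 * π * v) y := by
    congr 1
    ext v
    rw [smul_eq_mul]
    congr 2
    push_cast
    ring
  rw [h4, h3, abs_of_pos (by positivity), Complex.real_smul]
  push_cast
  rw [one_div]

end HalfPlaneNS

end

noncomputable section

namespace HalfPlaneNS

open MeasureTheory Filter Real
open scoped FourierTransform ContDiff

/-! ### The weights -/

/-- The majorant `|k|^{-θ} (1 + k²)^{-1/2}`. -/
def maj (θ k : ℝ) : ℝ := |k| ^ (-θ) / √(1 + k ^ 2)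

theorem maj_nonneg (θ k : ℝ) : 0 ≤ maj θ k := by
  unfold maj
  positivity

theorem measurable_maj (θ : ℝ) : Measurable (maj θ) := by
  unfold maj
  exact ((measurable_abs : Measurable fun k : ℝ => |k|).pow_const _).div (by fun_prop)

theorem integrable_of_abs_le {g : ℝ → ℝ} (hg : Measurable g) (heven : ∀ k, g (-k) = g k)
    {a c : ℝ} (ha : a < 1) (hc : 1 < c) (h1 : ∀ k, 0 < k → k ≤ 1 → |g k| ≤ k ^ (-a))
    (h2 : ∀ k, 1 ≤ k → |g k| ≤ k ^ (-c)) : Integrable g := by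
  have hpos : IntegrableOn g (Set.Ioi 0) := by
    rw [← Set.Ioc_union_Ioi_eq_Ioi zero_le_one]
    refine IntegrableOn.union ?_ ?_
    · have hi : IntegrableOn (fun k : ℝ => k ^ (-a)) (Set.Ioc 0 1) := by
        rw [integrableOn_Ioc_iff_integrableOn_Ioo]
        exact (intervalIntegral.integrableOn_Ioo_rpow_iff zero_lt_one).2 (by linarith)
      refine Integrable.mono' hi hg.aestronglyMeasurable ?_
      filter_upwards [ae_restrict_mem measurableSet_Ioc] with k hk using h1 k hk.1 hk.2
    · have hi : IntegrableOn (fun k : ℝ => k ^ (-c)) (Set.Ioi 1) :=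
        integrableOn_Ioi_rpow_of_lt (by linarith) zero_lt_one
      refine Integrable.mono' hi hg.aestronglyMeasurable ?_
      filter_upwards [ae_restrict_mem measurableSet_Ioi] with k hk using h2 k (le_of_lt hk)
  have hneg : IntegrableOn g (Set.Iic 0) := by
    have h3 := (Measure.measurePreserving_neg (volume : Measure ℝ)).integrableOn_comp_preimage
      (MeasurableEquiv.neg ℝ).measurableEmbedding (f := g) (s := Set.Ioi 0)
    rw [integrableOn_Iic_iff_integrableOn_Iio]
    have h4 := h3.2 hpos
    simpa [Function.comp_def, heven] using h4
  rw [← integrableOn_univ, ← Set.Iic_union_Ioi (a := (0 : ℝ))]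
  exact hneg.union hpos

theorem maj_neg (θ k : ℝ) : maj θ (-k) = maj θ k := by simp [maj]

theorem maj_le_of_le_one {θ k : ℝ} (hk : 0 < k) : maj θ k ≤ k ^ (-θ) := by
  rw [maj, abs_of_pos hk]
  refine div_le_self (by positivity) ?_
  rw [Real.one_le_sqrt]
  nlinarith [sq_nonneg k]

theorem maj_le_rpow {θ k : ℝ} (hk : 0 < k) : maj θ k ≤ k ^ (-(1 + θ)) := by
  rw [maj, abs_of_pos hk, show -(1 + θ) = -θ - 1 by ring, rpow_sub hk, rpow_one]
  refine div_le_div_of_nonneg_left (by positivity) hk ?_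
  exact Real.le_sqrt_of_sq_le (by linarith)

theorem integrable_maj {θ : ℝ} (h0 : 0 < θ) (h1 : θ < 1) : Integrable (maj θ) := by
  refine integrable_of_abs_le (measurable_maj θ) (maj_neg θ) h1 (c := 1 + θ) (by linarith) ?_ ?_
  · intro k hk _
    rw [abs_of_nonneg (maj_nonneg _ _)]
    exact maj_le_of_le_one hk
  · intro k hk
    rw [abs_of_nonneg (maj_nonneg _ _)]
    exact maj_le_rpow (by linarith)

/-- Near `k = 0` the square behaves like `|k|^{-2θ}`, hence the restriction `θ < 1/2`; plain
integrability allows all `θ < 1`. -/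
theorem integrable_maj_sq {θ : ℝ} (h0 : 0 < θ) (h1 : θ < 1 / 2) :
    Integrable fun k => maj θ k ^ 2 := by
  refine integrable_of_abs_le ((measurable_maj θ).pow_const 2) (fun k => by rw [maj_neg])
    (a := 2 * θ) (by linarith) (c := 2 + 2 * θ) (by linarith) ?_ ?_
  · intro k hk _
    rw [abs_of_nonneg (by positivity), show -(2 * θ) = (-θ) * (2 : ℕ) by push_cast; ring,
      rpow_mul hk.le, rpow_natCast]
    exact pow_le_pow_left₀ (maj_nonneg _ _) (maj_le_of_le_one hk) 2
  · intro k hk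
    rw [abs_of_nonneg (by positivity), show -(2 + 2 * θ) = (-(1 + θ)) * (2 : ℕ) by push_cast; ring,
      rpow_mul (by linarith), rpow_natCast]
    exact pow_le_pow_left₀ (maj_nonneg _ _) (maj_le_rpow (by linarith)) 2

theorem memLp_maj {θ : ℝ} (h0 : 0 < θ) (h1 : θ < 1 / 2) : MemLp (maj θ) 2 :=
  (memLp_two_iff_integrable_sq (measurable_maj θ).aestronglyMeasurable).2 (integrable_maj_sq h0 h1)

/-- This is where `α > 3` enters: for `x ≥ 1` the cube is dominated by `x ^ α`, so after one power
is spent on the factor `1 + x` there is still quadratic decay. -/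
theorem one_add_mul_le {α x : ℝ} (hα : 3 < α) (hx : 0 < x) :
    (1 + x) * (1 / (1 + x ^ α)) ≤ 4 / (1 + x ^ 2) := by
  have hxα : 0 < x ^ α := by positivity
  rw [mul_one_div, div_le_div_iff₀ (by positivity) (by positivity)]
  rcases le_total x 1 with h | h
  · nlinarith [mul_pos hx hx, mul_le_one₀ h hx.le h]
  · have h3 : x ^ 3 ≤ x ^ α := by
      rw [← rpow_natCast]
      exact rpow_le_rpow_of_exponent_le h (by norm_num; linarith)
    nlinarith [mul_nonneg (mul_nonneg hx.le hx.le) (sub_nonneg.2 h), mul_nonneg hx.le (sub_nonneg.2 h)]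

/-- The denominator `1 + x²` is split into two equal square roots. One pays for `x^θ`, which needs
`θ ≤ 1`, and the other for `√(1 + k²)`. -/
theorem inv_one_add_sq_le {θ k x : ℝ} (h0 : 0 ≤ θ) (h1 : θ ≤ 1) (hx : 0 < x) (hkx : |k| ≤ x) :
    1 / (1 + x ^ 2) ≤ x ^ (-θ) / √(1 + k ^ 2) := by
  have hk : √(1 + k ^ 2) ≤ √(1 + x ^ 2) := by
    refine Real.sqrt_le_sqrt ?_
    have := sq_le_sq' (by linarith [abs_nonneg k]) hkx
    rw [sq_abs] at this
    linarith
  have hxθ : x ^ θ ≤ √(1 + x ^ 2) := by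
    rcases le_total x 1 with h | h
    · refine (rpow_le_one hx.le h h0).trans ?_
      rw [Real.one_le_sqrt]
      nlinarith
    · calc x ^ θ ≤ x ^ (1 : ℝ) := rpow_le_rpow_of_exponent_le h h1
        _ = x := rpow_one x
        _ ≤ _ := Real.le_sqrt_of_sq_le (by linarith)
  have hθ : 0 < x ^ θ := by positivity
  rw [rpow_neg hx.le, inv_eq_one_div, div_div, div_le_div_iff₀ (by positivity) (by positivity),
    one_mul, one_mul]
  calc x ^ θ * √(1 + k ^ 2) ≤ √(1 + x ^ 2) * √(1 + x ^ 2) := by gcongr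
    _ = 1 + x ^ 2 := Real.mul_self_sqrt (by positivity)

/-- The scaling variable is `x = |k| t^r`: its power `x^{-θ}` factors into `|k|^{-θ}` and the decay
`t^{-rθ}`. Keeping `1 + x` on the left serves the weight itself as well as the weight times `|k|`.
-/
theorem mu_mul_le {α r θ k t : ℝ} (hα : 3 < α) (hr : 0 ≤ r) (h0 : 0 ≤ θ) (h1 : θ ≤ 1)
    (hk : k ≠ 0) (ht : 1 ≤ t) :
    (1 + |k| * t ^ r) * mu α r k t ≤ 4 * (t ^ (-(r * θ)) * maj θ k) := by
  have hk' : 0 < |k| := abs_pos.2 hk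
  have htr : 1 ≤ t ^ r := one_le_rpow ht hr
  have hx : 0 < |k| * t ^ r := by positivity
  refine (one_add_mul_le hα hx).trans ?_
  have h2 := inv_one_add_sq_le h0 h1 hx (k := k) (le_mul_of_one_le_right hk'.le htr)
  have h3 : t ^ (-(r * θ)) * maj θ k = (|k| * t ^ r) ^ (-θ) / √(1 + k ^ 2) := by
    rw [maj, mul_rpow hk'.le (by positivity), ← rpow_mul (by linarith)]
    rw [show r * -θ = -(r * θ) by ring]
    ring
  rw [h3, div_eq_mul_one_div]
  gcongr

theorem mu_pos (α r k t : ℝ) (ht : 1 ≤ t) : 0 < mu α r k t := by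
  have : 0 ≤ t ^ r := by positivity
  unfold mu
  positivity

theorem mu_le_one (α r k t : ℝ) (ht : 1 ≤ t) : mu α r k t ≤ 1 := by
  have h0 : 0 ≤ t ^ r := by positivity
  have : 0 ≤ (|k| * t ^ r) ^ α := by positivity
  unfold mu
  rw [div_le_one (by linarith)]
  linarith

/-! ### Power bounds for the weights of the spaces `𝓑` -/

/-- The weight defining the norm of `𝓑_{α,p,q}`. -/
def weight (α p q k t : ℝ) : ℝ := 1 / t ^ p * mu α 1 k t + 1 / t ^ q * mu α 2 k t

theorem weight_pos (α p q k t : ℝ) (ht : 1 ≤ t) : 0 < weight α p q k t := by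
  have := mu_pos α 1 k t ht
  have := mu_pos α 2 k t ht
  unfold weight
  positivity

theorem weight_le_two {α p q k t : ℝ} (hp : 0 ≤ p) (hq : 0 ≤ q) (ht : 1 ≤ t) :
    weight α p q k t ≤ 2 := by
  have h : ∀ r s : ℝ, 0 ≤ s → 1 / t ^ s * mu α r k t ≤ 1 := fun r s hs => by
    refine mul_le_one₀ ?_ (mu_pos α r k t ht).le (mu_le_one α r k t ht)
    rw [div_le_one (by positivity)]
    exact one_le_rpow ht hs
  unfold weight
  linarith [h 1 p hp, h 2 q hq]

theorem rpow_mul_le {t a b s c : ℝ} (ht : 1 ≤ t) (hc : 0 ≤ c) (h : s ≤ a + b) :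
    1 / t ^ a * (t ^ (-b) * c) ≤ t ^ (-s) * c := by
  rw [one_div, ← rpow_neg (by linarith), ← mul_assoc, ← rpow_add (by linarith)]
  exact mul_le_mul_of_nonneg_right (rpow_le_rpow_of_exponent_le ht (by linarith)) hc

theorem weight_le {α p q s θ k t : ℝ} (hα : 3 < α) (h0 : 0 ≤ θ) (h1 : θ ≤ 1) (hk : k ≠ 0)
    (ht : 1 ≤ t) (hp : s ≤ p + θ) (hq : s ≤ q + 2 * θ) :
    weight α p q k t ≤ 8 * (t ^ (-s) * maj θ k) := by
  have hm := maj_nonneg θ k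
  have key : ∀ r a, 0 ≤ r → s ≤ a + r * θ → 1 / t ^ a * mu α r k t ≤ 4 * (t ^ (-s) * maj θ k) := by
    intro r a hr ha
    have h2 := mu_mul_le hα hr h0 h1 hk ht
    have h3 : mu α r k t ≤ 4 * (t ^ (-(r * θ)) * maj θ k) := by
      refine le_trans ?_ h2
      refine le_mul_of_one_le_left (mu_pos α r k t ht).le ?_
      have : 0 ≤ |k| * t ^ r := by positivity
      linarith
    calc 1 / t ^ a * mu α r k t ≤ 1 / t ^ a * (4 * (t ^ (-(r * θ)) * maj θ k)) := by gcongr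
      _ = 4 * (1 / t ^ a * (t ^ (-(r * θ)) * maj θ k)) := by ring
      _ ≤ _ := mul_le_mul_of_nonneg_left (rpow_mul_le ht hm ha) (by norm_num)
  unfold weight
  linarith [key 1 p (by norm_num) (by linarith), key 2 q (by norm_num) hq]

/-- A factor `|k|` is `t^{-r}` times the scaling variable, so a derivative in `x` gains one power of
decay in the first summand and two in the second. -/
theorem abs_mul_weight_le {α p q s θ k t : ℝ} (hα : 3 < α) (h0 : 0 ≤ θ) (h1 : θ ≤ 1) (hk : k ≠ 0)
    (ht : 1 ≤ t) (hp : s ≤ p + 1 + θ) (hq : s ≤ q + 2 + 2 * θ) :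
    |k| * weight α p q k t ≤ 8 * (t ^ (-s) * maj θ k) := by
  have hm := maj_nonneg θ k
  have ht0 : 0 < t := by linarith
  have key : ∀ r a, 0 ≤ r → s ≤ a + r + r * θ →
      |k| * (1 / t ^ a * mu α r k t) ≤ 4 * (t ^ (-s) * maj θ k) := by
    intro r a hr ha
    have h2 := mu_mul_le hα hr h0 h1 hk ht
    have h3 : |k| * t ^ r * mu α r k t ≤ 4 * (t ^ (-(r * θ)) * maj θ k) := by
      refine le_trans ?_ h2
      have := mu_pos α r k t ht
      nlinarith
    calc |k| * (1 / t ^ a * mu α r k t) = 1 / t ^ (a + r) * (|k| * t ^ r * mu α r k t) := by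
          rw [rpow_add ht0]
          field_simp
      _ ≤ 1 / t ^ (a + r) * (4 * (t ^ (-(r * θ)) * maj θ k)) := by gcongr
      _ = 4 * (1 / t ^ (a + r) * (t ^ (-(r * θ)) * maj θ k)) := by ring
      _ ≤ _ := mul_le_mul_of_nonneg_left (rpow_mul_le ht hm (by linarith)) (by norm_num)
  unfold weight
  rw [mul_add]
  linarith [key 1 p (by norm_num) (by linarith), key 2 q (by norm_num) (by linarith)]

theorem norm_le_of_bNorm_lt {α p q η : ℝ} {g : ℝ → ℝ → ℂ} (hη : 0 ≤ η)
    (h : bNorm α p q g ≤ ENNReal.ofReal η) {k t : ℝ} (hk : k ≠ 0) (ht : 1 ≤ t) :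
    ‖g k t‖ ≤ η * weight α p q k t := by
  have h1 : ENNReal.ofReal (‖g k t‖ / weight α p q k t) ≤ ENNReal.ofReal η := by
    refine le_trans ?_ h
    unfold bNorm
    exact le_iSup₂_of_le t ht (le_iSup₂_of_le k hk le_rfl)
  rw [ENNReal.ofReal_le_ofReal_iff hη, div_le_iff₀ (weight_pos α p q k t ht)] at h1
  exact h1

end HalfPlaneNS

end

noncomputable section

namespace HalfPlaneNS

open MeasureTheory Filter Real
open scoped FourierTransform ContDiff

/-! ### Regularity of inverse transforms -/

theorem isOpen_Omega : IsOpen Omega := isOpen_lt continuous_const continuous_snd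

theorem measurableSet_Omega : MeasurableSet Omega := isOpen_Omega.measurableSet

theorem volume_restrict_Omega :
    (volume : Measure (ℝ × ℝ)).restrict Omega
      = (volume : Measure ℝ).prod ((volume : Measure ℝ).restrict (Set.Ioi 1)) := by
  have h : Omega = Set.univ ×ˢ Set.Ioi (1 : ℝ) := by
    ext p
    simp [Omega]
  rw [h, Measure.volume_eq_prod, ← Measure.prod_restrict, Measure.restrict_univ]

/-- Continuity off `k = 0`, and domination by `t ^ s` times a fixed integrable and square
integrable function of `k`. -/
structure Tame (s : ℝ) (g : ℝ → ℝ → ℂ) : Prop where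
  cont : ContinuousOn (fun z : ℝ × ℝ => g z.1 z.2) {z | z.1 ≠ 0 ∧ 1 < z.2}
  bound : ∃ A, 0 ≤ A ∧ ∀ k t, k ≠ 0 → 1 < t → ‖g k t‖ ≤ A * (t ^ s * maj (3 / 8) k)

theorem integrable_maj' : Integrable (maj (3 / 8)) := integrable_maj (by norm_num) (by norm_num)

theorem ae_ne_zero : ∀ᵐ k : ℝ, k ≠ 0 := by
  simp [ae_iff, measure_singleton]

theorem aestronglyMeasurable_slice {g : ℝ → ℝ → ℂ}
    (hg : ContinuousOn (fun z : ℝ × ℝ => g z.1 z.2) {z | z.1 ≠ 0 ∧ 1 < z.2}) {t : ℝ} (ht : 1 < t) :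
    AEStronglyMeasurable (fun k => g k t) volume := by
  have h1 : ContinuousOn (fun k => g k t) ({0}ᶜ : Set ℝ) :=
    hg.comp (f := fun k : ℝ => (k, t)) (by fun_prop) fun k hk => ⟨hk, ht⟩
  have h2 := h1.aestronglyMeasurable (μ := volume) (measurableSet_singleton 0).compl
  rwa [restrict_compl_singleton] at h2

theorem continuousAt_fst_slice {g : ℝ → ℝ → ℂ}
    (hg : ContinuousOn (fun z : ℝ × ℝ => g z.1 z.2) {z | z.1 ≠ 0 ∧ 1 < z.2}) {k t : ℝ}
    (hk : k ≠ 0) (ht : 1 < t) : ContinuousAt (fun z : ℝ × ℝ => g z.1 z.2) (k, t) := by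
  refine hg.continuousAt ?_
  have : {z : ℝ × ℝ | z.1 ≠ 0 ∧ 1 < z.2} ∈ 𝓝 (k, t) :=
    ((isOpen_ne_fun continuous_fst continuous_const).inter
      (isOpen_lt continuous_const continuous_snd)).mem_nhds ⟨hk, ht⟩
  exact this

/-- Absolute values make one bound on a slab serve both growing and decaying powers. -/
theorem rpow_le_rpow_abs {s t Y : ℝ} (ht : 1 ≤ t) (hY : t ≤ Y) : t ^ s ≤ Y ^ |s| :=
  (rpow_le_rpow_of_exponent_le ht (le_abs_self s)).trans
    (rpow_le_rpow (by linarith) hY (abs_nonneg s))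

theorem norm_exp_neg_I_mul_mul (k x : ℝ) : ‖Complex.exp (-(Complex.I * k * x))‖ = 1 := by
  rw [Complex.norm_exp]
  simp

theorem Tame.integrable {s : ℝ} {g : ℝ → ℝ → ℂ} (hg : Tame s g) {t : ℝ} (ht : 1 < t) :
    Integrable fun k => g k t := by
  obtain ⟨A, -, hA⟩ := hg.bound
  refine ((integrable_maj'.const_mul (t ^ s)).const_mul A).mono'
    (aestronglyMeasurable_slice hg.cont ht) ?_
  filter_upwards [ae_ne_zero] with k hk using hA k t hk ht

theorem Tame.memLp {s : ℝ} {g : ℝ → ℝ → ℂ} (hg : Tame s g) {t : ℝ} (ht : 1 < t) :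
    MemLp (fun k => g k t) 2 := by
  obtain ⟨A, -, hA⟩ := hg.bound
  have := ((memLp_maj (θ := 3 / 8) (by norm_num) (by norm_num)).const_mul (t ^ s)).const_mul A
  refine this.mono' (aestronglyMeasurable_slice hg.cont ht) ?_
  filter_upwards [ae_ne_zero] with k hk using hA k t hk ht

/-- A slab `{1 < y < Y}` is a neighbourhood of each of its points. -/
theorem slab_mem_nhds {p : ℝ × ℝ} (hp : p ∈ Omega) :
    {q : ℝ × ℝ | 1 < q.2 ∧ q.2 < p.2 + 1} ∈ 𝓝 p :=
  ((isOpen_lt continuous_const continuous_snd).inter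
    (isOpen_lt continuous_snd continuous_const)).mem_nhds ⟨hp, by simp⟩

/-- Dominated convergence on the slab `y < p.2 + 1`, where the power of `t` is bounded and the
majorant depends on `k` alone. -/
theorem Tame.continuousOn_inv {s : ℝ} {g : ℝ → ℝ → ℂ} (hg : Tame s g) :
    ContinuousOn (fun p : ℝ × ℝ => invFourierX g p.1 p.2) Omega := by
  obtain ⟨A, hA0, hA⟩ := hg.bound
  intro p hp
  refine ContinuousAt.continuousWithinAt ?_
  refine ContinuousAt.mul continuousAt_const ?_
  have hb := (integrable_maj'.const_mul ((p.2 + 1) ^ |s|)).const_mul A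
  refine continuousAt_of_dominated ?_ ?_ hb ?_
  · filter_upwards [slab_mem_nhds hp] with q hq
    exact (Continuous.aestronglyMeasurable (by fun_prop)).mul
      (aestronglyMeasurable_slice hg.cont hq.1)
  · filter_upwards [slab_mem_nhds hp] with q hq
    filter_upwards [ae_ne_zero] with k hk
    rw [norm_mul, norm_exp_neg_I_mul_mul, one_mul]
    refine (hA k q.2 hk hq.1).trans ?_
    have := maj_nonneg (3 / 8) k
    gcongr
    exact rpow_le_rpow_abs hq.1.le hq.2.le
  · filter_upwards [ae_ne_zero] with k hk
    refine ContinuousAt.mul (by fun_prop) ?_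
    exact (continuousAt_fst_slice hg.cont hk hp).comp (f := fun q : ℝ × ℝ => (k, q.2)) (by fun_prop)

/-- The real-linear map with prescribed values on the two coordinate directions. -/
def coordCLM (a b : ℂ) : ℝ × ℝ →L[ℝ] ℂ :=
  (ContinuousLinearMap.fst ℝ ℝ ℝ).smulRight a + (ContinuousLinearMap.snd ℝ ℝ ℝ).smulRight b

/-- Differentiation under the integral sign of the inverse transform. -/
theorem Tame.hasFDerivAt_inv {s s₁ s₂ : ℝ} {g gy : ℝ → ℝ → ℂ} (hg : Tame s g)
    (hgx : Tame s₁ fun k t => -(Complex.I * k) * g k t) (hgy : Tame s₂ gy)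
    (hd : ∀ k, k ≠ 0 → ∀ y, 1 < y → HasDerivAt (fun t => g k t) (gy k y) y)
    {p : ℝ × ℝ} (hp : p ∈ Omega) :
    HasFDerivAt (fun p : ℝ × ℝ => invFourierX g p.1 p.2)
      (coordCLM (invFourierX (fun k t => -(Complex.I * k) * g k t) p.1 p.2)
        (invFourierX gy p.1 p.2)) p := by
  obtain ⟨A₁, hA₁0, hA₁⟩ := hgx.bound
  obtain ⟨A₂, hA₂0, hA₂⟩ := hgy.bound
  set e : ℝ × ℝ → ℝ → ℂ := fun q k => Complex.exp (-(Complex.I * k * q.1)) with he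
  have hem : ∀ q, AEStronglyMeasurable (e q) volume := fun q =>
    Continuous.aestronglyMeasurable (by fun_prop)
  have hen : ∀ q k, ‖e q k‖ = 1 := fun q k => norm_exp_neg_I_mul_mul k q.1
  set F' : ℝ × ℝ → ℝ → ℝ × ℝ →L[ℝ] ℂ := fun q k =>
    coordCLM (e q k * (-(Complex.I * k) * g k q.2)) (e q k * gy k q.2) with hF'
  have i1 : Integrable fun k => e p k * (-(Complex.I * k) * g k p.2) :=
    (hgx.integrable hp).bdd_mul (c := 1) (hem p) (Eventually.of_forall fun k => (hen p k).le)
  have i2 : Integrable fun k => e p k * gy k p.2 :=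
    (hgy.integrable hp).bdd_mul (c := 1) (hem p) (Eventually.of_forall fun k => (hen p k).le)
  set L₁ := ContinuousLinearMap.smulRightL ℝ (ℝ × ℝ) ℂ (ContinuousLinearMap.fst ℝ ℝ ℝ) with hL₁
  set L₂ := ContinuousLinearMap.smulRightL ℝ (ℝ × ℝ) ℂ (ContinuousLinearMap.snd ℝ ℝ ℝ) with hL₂
  have hFL : ∀ q k, F' q k = L₁ (e q k * (-(Complex.I * k) * g k q.2)) + L₂ (e q k * gy k q.2) :=
    fun q k => rfl
  -- Both partial derivatives of the integrand are dominated on the slab, so the total derivative is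
  -- obtained at once, without a separate continuity argument for the partial derivatives.
  have main := hasFDerivAt_integral_of_dominated_of_fderiv_le (𝕜 := ℝ) (μ := volume)
    (F := fun q k => e q k * g k q.2) (F' := F') (x₀ := p)
    (bound := fun k => A₁ * ((p.2 + 1) ^ |s₁| * maj (3 / 8) k)
      + A₂ * ((p.2 + 1) ^ |s₂| * maj (3 / 8) k))
    (slab_mem_nhds hp) ?_ ?_ ?_ ?_ ?_ ?_
  · have h1 : ∫ k, F' p k = coordCLM (∫ k, e p k * (-(Complex.I * k) * g k p.2))
        (∫ k, e p k * gy k p.2) := by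
      simp_rw [hFL]
      rw [integral_add (L₁.integrable_comp i1) (L₂.integrable_comp i2),
        L₁.integral_comp_comm i1, L₂.integral_comp_comm i2]
      rfl
    rw [h1] at main
    have h2 := main.const_mul (1 / (2 * π) : ℂ)
    refine h2.congr_fderiv ?_
    ext <;> simp [coordCLM, invFourierX, he]
  · filter_upwards [slab_mem_nhds hp] with q hq
    exact (hem q).mul (aestronglyMeasurable_slice hg.cont hq.1)
  · exact (hg.integrable hp).bdd_mul (c := 1) (hem p)
      (Eventually.of_forall fun k => (hen p k).le)
  · simp_rw [funext (hFL p)]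
    exact (L₁.continuous.comp_aestronglyMeasurable i1.1).add
      (L₂.continuous.comp_aestronglyMeasurable i2.1)
  · filter_upwards [ae_ne_zero] with k hk q hq
    have hm := maj_nonneg (3 / 8) k
    have n1 : ‖e q k * (-(Complex.I * k) * g k q.2)‖ ≤ A₁ * ((p.2 + 1) ^ |s₁| * maj (3 / 8) k) := by
      rw [norm_mul, hen, one_mul]
      refine (hA₁ k q.2 hk hq.1).trans ?_
      gcongr
      exact rpow_le_rpow_abs hq.1.le hq.2.le
    have n2 : ‖e q k * gy k q.2‖ ≤ A₂ * ((p.2 + 1) ^ |s₂| * maj (3 / 8) k) := by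
      rw [norm_mul, hen, one_mul]
      refine (hA₂ k q.2 hk hq.1).trans ?_
      gcongr
      exact rpow_le_rpow_abs hq.1.le hq.2.le
    refine (norm_add_le _ _).trans (add_le_add ?_ ?_)
    · rw [ContinuousLinearMap.norm_smulRight_apply]
      refine le_trans ?_ n1
      exact mul_le_of_le_one_left (norm_nonneg _) (ContinuousLinearMap.norm_fst_le ℝ ℝ ℝ)
    · rw [ContinuousLinearMap.norm_smulRight_apply]
      refine le_trans ?_ n2
      exact mul_le_of_le_one_left (norm_nonneg _) (ContinuousLinearMap.norm_snd_le ℝ ℝ ℝ)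
  · exact ((integrable_maj'.const_mul _).const_mul _).add ((integrable_maj'.const_mul _).const_mul _)
  · filter_upwards [ae_ne_zero] with k hk q hq
    have d1 : HasFDerivAt (fun q : ℝ × ℝ => e q k)
        ((ContinuousLinearMap.fst ℝ ℝ ℝ).smulRight (e q k * (-(Complex.I * k)))) q := by
      have h0 : HasDerivAt (fun x : ℝ => Complex.exp (-(Complex.I * k * x)))
          (Complex.exp (-(Complex.I * k * q.1)) * (-(Complex.I * k))) q.1 := by
        have : HasDerivAt (fun x : ℝ => -(Complex.I * k * (x : ℂ))) (-(Complex.I * k * 1)) q.1 :=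
          ((Complex.ofRealCLM.hasDerivAt).const_mul _).neg
        simpa using this.cexp
      have := h0.hasFDerivAt.comp q (hasFDerivAt_fst (𝕜 := ℝ) (p := q))
      refine this.congr_fderiv ?_
      ext <;> simp [he]
    have d2 : HasFDerivAt (fun q : ℝ × ℝ => g k q.2)
        ((ContinuousLinearMap.snd ℝ ℝ ℝ).smulRight (gy k q.2)) q := by
      have := (hd k hk q.2 hq.1).hasFDerivAt.comp q (hasFDerivAt_snd (𝕜 := ℝ) (p := q))
      refine this.congr_fderiv ?_
      ext <;> simp
    refine (d1.mul d2).congr_fderiv ?_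
    ext <;> simp [hF', coordCLM]
    ring

/-- Inverse transforms are square integrable as soon as the transform decays in `y`. -/
theorem Tame.memLp_inv {g : ℝ → ℝ → ℂ} (hg : Tame (-3 / 4) g) :
    MemLp (fun p : ℝ × ℝ => invFourierX g p.1 p.2) 2 (volume.restrict Omega) := by
  have hm := hg.continuousOn_inv.aestronglyMeasurable (μ := volume) measurableSet_Omega
  obtain ⟨A, hA0, hA⟩ := hg.bound
  refine ⟨hm, ?_⟩
  rw [eLpNorm_lt_top_iff_lintegral_rpow_enorm_lt_top (by norm_num) (by norm_num)]
  simp only [ENNReal.toReal_ofNat, ENNReal.rpow_ofNat]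
  have hb2 : ∫⁻ k, ‖maj (3 / 8) k‖ₑ ^ 2 < ⊤ := by
    have := (memLp_maj (θ := 3 / 8) (by norm_num) (by norm_num)).2
    rw [eLpNorm_lt_top_iff_lintegral_rpow_enorm_lt_top (by norm_num) (by norm_num)] at this
    simpa using this
  -- Squaring the decay `y^{-3/4}` gives `y^{-3/2}`, integrable at infinity; this fixes the exponent
  -- in the hypothesis.
  have hy : ∫⁻ y in Set.Ioi (1 : ℝ), ENNReal.ofReal (y ^ (-3 / 2 : ℝ)) < ⊤ := by
    have h1 : IntegrableOn (fun y : ℝ => y ^ (-3 / 2 : ℝ)) (Set.Ioi 1) :=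
      integrableOn_Ioi_rpow_of_lt (by norm_num) zero_lt_one
    exact h1.lintegral_lt_top
  rw [volume_restrict_Omega] at hm ⊢
  rw [lintegral_prod_symm _ (hm.enorm.pow_const 2)]
  have hslice : ∀ y ∈ Set.Ioi (1 : ℝ), ∫⁻ x, ‖invFourierX g x y‖ₑ ^ 2
      ≤ (ENNReal.ofReal (1 / (2 * π)) * (ENNReal.ofReal A ^ 2 * ∫⁻ k, ‖maj (3 / 8) k‖ₑ ^ 2)) *
        ENNReal.ofReal (y ^ (-3 / 2 : ℝ)) := by
    intro y hy
    have hy1 : 1 ≤ y := le_of_lt hy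
    rw [lintegral_invFourierX_sq (hg.integrable hy) (hg.memLp hy), mul_assoc]
    gcongr
    rw [mul_assoc, mul_comm (∫⁻ k, ‖maj (3 / 8) k‖ₑ ^ 2), ← mul_assoc,
      ← lintegral_const_mul' _ _ (by finiteness)]
    refine lintegral_mono_ae ?_
    filter_upwards [ae_ne_zero] with k hk
    have h1 : ‖g k y‖ₑ ≤ ENNReal.ofReal (A * (y ^ (-3 / 4 : ℝ) * maj (3 / 8) k)) := by
      rw [← ofReal_norm]
      exact ENNReal.ofReal_le_ofReal (hA k y hk hy)
    refine (pow_le_pow_left' h1 2).trans (le_of_eq ?_)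
    rw [ENNReal.ofReal_mul hA0, ENNReal.ofReal_mul (by positivity), mul_pow, mul_pow, mul_assoc]
    congr 2
    · rw [← ENNReal.ofReal_pow (by positivity), ← rpow_mul_natCast (by linarith)]
      norm_num
    · rw [← ofReal_norm, Real.norm_of_nonneg (maj_nonneg _ _)]
  refine (setLIntegral_mono' measurableSet_Ioi hslice).trans_lt ?_
  rw [lintegral_const_mul' _ _ (by finiteness)]
  finiteness

end HalfPlaneNS

end

noncomputable section

namespace HalfPlaneNS

open MeasureTheory Filter Real
open scoped FourierTransform

/-! ### Bounds on the transforms of a small `α`-solution -/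

/-- What the size of the norm of `(ω, u, v)` in `𝓤_α` and the system of ordinary differential
equations say about the transforms of vorticity and velocity. -/
structure FourierData (N : ℝ) (ω u v : ℝ → ℝ → ℂ) : Prop where
  nonneg : 0 ≤ N
  tame_ω : Tame (-7 / 4) ω
  tame_u : Tame (-3 / 4) u
  tame_v : Tame (-3 / 4) v
  tame_ku : Tame (-7 / 4) fun k t => -(Complex.I * k) * u k t
  tame_kv : Tame (-7 / 4) fun k t => -(Complex.I * k) * v k t
  small_u : ∀ k t, k ≠ 0 → 1 < t → ‖u k t‖ ≤ 8 * N * (t ^ (-5 / 4 : ℝ) * maj (3 / 4) k)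
  small_v : ∀ k t, k ≠ 0 → 1 < t → ‖v k t‖ ≤ 8 * N * (t ^ (-5 / 4 : ℝ) * maj (3 / 4) k)
  bdd_u : ∀ k t, k ≠ 0 → 1 < t → ‖u k t‖ ≤ 2 * N
  bdd_v : ∀ k t, k ≠ 0 → 1 < t → ‖v k t‖ ≤ 2 * N
  wall_u : ∀ k, k ≠ 0 → Tendsto (fun t => u k t) (𝓝[>] 1) (𝓝 0)
  wall_v : ∀ k, k ≠ 0 → Tendsto (fun t => v k t) (𝓝[>] 1) (𝓝 0)
  deriv_u : ∀ k, k ≠ 0 → ∀ y, 1 < y →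
    HasDerivAt (fun t => u k t) (-(Complex.I * k) * v k y - ω k y) y
  deriv_v : ∀ k, k ≠ 0 → ∀ y, 1 < y → HasDerivAt (fun t => v k t) (Complex.I * k * u k y) y

theorem MemB.continuousOn {α p q : ℝ} {g : ℝ → ℝ → ℂ} (hg : MemB α p q g) :
    ContinuousOn (fun z : ℝ × ℝ => g z.1 z.2) {z | z.1 ≠ 0 ∧ 1 < z.2} :=
  hg.1.mono fun _ hz => ⟨hz.1, hz.2.le⟩

theorem continuousOn_I_mul {g : ℝ → ℝ → ℂ} {S : Set (ℝ × ℝ)}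
    (hg : ContinuousOn (fun z : ℝ × ℝ => g z.1 z.2) S) :
    ContinuousOn (fun z : ℝ × ℝ => -(Complex.I * (z.1 : ℂ)) * g z.1 z.2) S :=
  ContinuousOn.mul (Continuous.continuousOn (by fun_prop)) hg

theorem norm_I_mul (k : ℝ) (z : ℂ) : ‖-(Complex.I * (k : ℂ)) * z‖ = |k| * ‖z‖ := by
  simp

theorem MemB.tendsto_wall {α p q : ℝ} {g : ℝ → ℝ → ℂ} (hg : MemB α p q g) {k : ℝ} (hk : k ≠ 0)
    (h1 : g k 1 = 0) : Tendsto (fun t => g k t) (𝓝[>] 1) (𝓝 0) := by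
  have h2 : ContinuousOn (fun t => g k t) (Set.Ici 1) :=
    hg.1.comp (f := fun t : ℝ => (k, t)) (by fun_prop) fun t ht => ⟨hk, ht⟩
  have h3 := (h2 1 Set.self_mem_Ici).mono_left (nhdsWithin_mono 1 Set.Ioi_subset_Ici_self)
  simp only [h1] at h3
  exact h3

/-- The exponent `θ = 3/8` lies below `1/2`, so majorants are square integrable in `k`, and above
`1/4`, so the summand of `û` with `q = 0` still decays like `t^{-2θ} = t^{-3/4}`, square integrable
in `t`. The exponent `θ = 3/4` yields `t^{-5/4}` for `û` and `v̂`, which is more than `1/t`. In the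
derivatives of `-η + φ` and `ω + ψ` the terms `Q₀` and `Q₁` cancel, leaving `∂_y û = -ik v̂ - ω̂`
and `∂_y v̂ = ik û`. -/
theorem fourierData_of_isAlphaSolution {α : ℝ} (hα : 3 < α) {N : ℝ} (hN : 0 ≤ N) {f : VField}
    {ω u v : ℝ → ℝ → ℂ} {ubar : VField} (h : IsAlphaSolution α f ω u v ubar)
    (hs : uNorm α ω u v ≤ ENNReal.ofReal N) : FourierData N ω u v := by
  obtain ⟨hω, hu, hv⟩ := h.memU
  have bω : bNorm α (5 / 2) 1 ω ≤ ENNReal.ofReal N :=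
    le_trans (by unfold uNorm; rw [add_assoc]; exact le_self_add) hs
  have bu : bNorm α (1 / 2) 0 u ≤ ENNReal.ofReal N :=
    le_trans (by unfold uNorm; rw [add_right_comm]; exact le_add_self) hs
  have bv : bNorm α (1 / 2) 1 v ≤ ENNReal.ofReal N :=
    le_trans (by unfold uNorm; exact le_add_self) hs
  have wle : ∀ {p q s θ : ℝ} {g : ℝ → ℝ → ℂ}, bNorm α p q g ≤ ENNReal.ofReal N → 0 ≤ θ → θ ≤ 1 →
      s ≤ p + θ → s ≤ q + 2 * θ → ∀ k t, k ≠ 0 → 1 < t →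
      ‖g k t‖ ≤ 8 * N * (t ^ (-s) * maj θ k) := by
    intro p q s θ g hb h0 h1 hp hq k t hk ht
    refine (norm_le_of_bNorm_lt hN hb hk ht.le).trans ?_
    have := weight_le hα h0 h1 hk ht.le hp hq
    nlinarith
  have kwle : ∀ {p q s : ℝ} {g : ℝ → ℝ → ℂ}, bNorm α p q g ≤ ENNReal.ofReal N →
      s ≤ p + 1 + 3 / 8 → s ≤ q + 2 + 2 * (3 / 8) → ∀ k t : ℝ, k ≠ 0 → 1 < t →
      ‖-(Complex.I * (k : ℂ)) * g k t‖ ≤ 8 * N * (t ^ (-s) * maj (3 / 8) k) := by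
    intro p q s g hb hp hq k t hk ht
    rw [norm_I_mul]
    have h1 := norm_le_of_bNorm_lt hN hb hk ht.le
    have h2 := abs_mul_weight_le hα (by norm_num) (by norm_num) hk ht.le hp hq
    have h3 := mul_le_mul_of_nonneg_left h1 (abs_nonneg k)
    nlinarith
  have ble : ∀ {p q : ℝ} {g : ℝ → ℝ → ℂ}, bNorm α p q g ≤ ENNReal.ofReal N → 0 ≤ p → 0 ≤ q →
      ∀ k t, k ≠ 0 → 1 < t → ‖g k t‖ ≤ 2 * N := by
    intro p q g hb hp hq k t hk ht
    refine (norm_le_of_bNorm_lt hN hb hk ht.le).trans ?_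
    have := weight_le_two (α := α) (k := k) hp hq ht.le
    nlinarith
  have h8 : 0 ≤ 8 * N := by positivity
  obtain ⟨η, φ, ψ, hsys⟩ := h.system
  have ev : ∀ {y : ℝ}, 1 < y → ∀ᶠ t in 𝓝 y, 1 < t := fun hy => lt_mem_nhds hy
  refine ⟨hN, ⟨hω.continuousOn, 8 * N, h8, ?_⟩, ⟨hu.continuousOn, 8 * N, h8, ?_⟩,
    ⟨hv.continuousOn, 8 * N, h8, ?_⟩, ⟨continuousOn_I_mul hu.continuousOn, 8 * N, h8, ?_⟩,
    ⟨continuousOn_I_mul hv.continuousOn, 8 * N, h8, ?_⟩, ?_, ?_, ?_, ?_, ?_, ?_, ?_, ?_⟩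
  · rw [neg_div]; exact wle bω (by norm_num) (by norm_num) (by norm_num) (by norm_num)
  · rw [neg_div]; exact wle bu (by norm_num) (by norm_num) (by norm_num) (by norm_num)
  · rw [neg_div]; exact wle bv (by norm_num) (by norm_num) (by norm_num) (by norm_num)
  · rw [neg_div]; exact kwle bu (by norm_num) (by norm_num)
  · rw [neg_div]; exact kwle bv (by norm_num) (by norm_num)
  · rw [neg_div]; exact wle bu (by norm_num) (by norm_num) (by norm_num) (by norm_num)
  · rw [neg_div]; exact wle bv (by norm_num) (by norm_num) (by norm_num) (by norm_num)
  · exact ble bu (by norm_num) (by norm_num)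
  · exact ble bv (by norm_num) (by norm_num)
  · exact fun k hk => hu.tendsto_wall hk (h.wall k hk).1
  · exact fun k hk => hv.tendsto_wall hk (h.wall k hk).2
  · intro k hk y hy
    obtain ⟨-, h2, -, h4, -, h6⟩ := hsys k hk y hy
    refine ((h4.neg.add h6).congr_of_eventuallyEq ?_).congr_deriv ?_
    · filter_upwards [ev hy] with t ht using (hsys k hk t ht).1
    · rw [h2]; ring
  · intro k hk y hy
    obtain ⟨h1, -, h3, -, h5, -⟩ := hsys k hk y hy
    refine ((h3.add h5).congr_of_eventuallyEq ?_).congr_deriv ?_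
    · filter_upwards [ev hy] with t ht using (hsys k hk t ht).2.1
    · rw [h1]; ring

/-! ### The stream function -/

/-- A mean value inequality on `(1, ∞)` for functions vanishing at `1`. -/
theorem norm_le_of_deriv_le {F F' : ℝ → ℂ} {B B' : ℝ → ℝ} (h0 : Tendsto F (𝓝[>] 1) (𝓝 0))
    (hF : ∀ y, 1 < y → HasDerivAt F (F' y) y) (hB1 : ContinuousAt B 1)
    (hB : ∀ y, 1 < y → HasDerivAt B (B' y) y) (hle : ∀ y, 1 < y → ‖F' y‖ ≤ B' y)
    {t : ℝ} (ht : 1 < t) : ‖F t‖ ≤ B t - B 1 := by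
  have key : ∀ a ∈ Set.Ioo 1 t, ‖F t - F a‖ ≤ B t - B a := by
    intro a ha
    refine image_norm_le_of_norm_deriv_right_le_deriv_boundary' (f := fun y => F y - F a)
      (f' := F') (B := fun y => B y - B a) (B' := B') (a := a) (b := t) ?_ ?_ (by simp) ?_ ?_ ?_
      ⟨ha.2.le, le_rfl⟩
    · exact fun y hy => ((hF y (ha.1.trans_le hy.1)).sub_const _).continuousAt.continuousWithinAt
    · exact fun y hy => ((hF y (ha.1.trans_le hy.1)).sub_const _).hasDerivWithinAt
    · exact fun y hy => ((hB y (ha.1.trans_le hy.1)).sub_const _).continuousAt.continuousWithinAt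
    · exact fun y hy => ((hB y (ha.1.trans_le hy.1)).sub_const _).hasDerivWithinAt
    · exact fun y hy => hle y (ha.1.trans_le hy.1)
  have l1 : Tendsto (fun a => ‖F t - F a‖) (𝓝[>] 1) (𝓝 ‖F t - 0‖) := (tendsto_const_nhds.sub h0).norm
  have l2 : Tendsto (fun a => B t - B a) (𝓝[>] 1) (𝓝 (B t - B 1)) :=
    tendsto_const_nhds.sub (hB1.mono_left nhdsWithin_le_nhds)
  rw [sub_zero] at l1
  refine le_of_tendsto_of_tendsto l1 l2 ?_
  filter_upwards [Ioo_mem_nhdsGT ht] with a ha using key a ha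

/-- The transform of the stream function. -/
def streamHat (v : ℝ → ℝ → ℂ) (k t : ℝ) : ℂ := v k t / (Complex.I * k)

theorem I_mul_ne_zero {k : ℝ} (hk : k ≠ 0) : Complex.I * (k : ℂ) ≠ 0 :=
  mul_ne_zero Complex.I_ne_zero (by exact_mod_cast hk)

namespace FourierData

variable {N : ℝ} {ω u v : ℝ → ℝ → ℂ}

theorem tame_uy (h : FourierData N ω u v) :
    Tame (-7 / 4) fun k t => -(Complex.I * k) * v k t - ω k t := by
  obtain ⟨A, hA0, hA⟩ := h.tame_kv.bound
  obtain ⟨B, hB0, hB⟩ := h.tame_ω.bound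
  refine ⟨h.tame_kv.cont.sub h.tame_ω.cont, A + B, by positivity, fun k t hk ht => ?_⟩
  rw [add_mul]
  exact (norm_sub_le _ _).trans (add_le_add (hA k t hk ht) (hB k t hk ht))

theorem tame_vy (h : FourierData N ω u v) : Tame (-7 / 4) fun k t => Complex.I * k * u k t := by
  obtain ⟨A, hA0, hA⟩ := h.tame_ku.bound
  refine ⟨?_, A, hA0, fun k t hk ht => ?_⟩
  · refine h.tame_ku.cont.neg.congr fun z _ => ?_
    simp
  · refine le_trans (le_of_eq ?_) (hA k t hk ht)
    simp

theorem deriv_streamHat (h : FourierData N ω u v) {k : ℝ} (hk : k ≠ 0) {y : ℝ} (hy : 1 < y) :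
    HasDerivAt (fun t => streamHat v k t) (u k y) y := by
  refine ((h.deriv_v k hk y hy).div_const (Complex.I * k)).congr_deriv ?_
  rw [mul_div_cancel_left₀ _ (I_mul_ne_zero hk)]

theorem wall_streamHat (h : FourierData N ω u v) {k : ℝ} (hk : k ≠ 0) :
    Tendsto (fun t => streamHat v k t) (𝓝[>] 1) (𝓝 0) := by
  simpa [streamHat] using (h.wall_v k hk).div_const (Complex.I * k)

theorem cont_streamHat (h : FourierData N ω u v) :
    ContinuousOn (fun z : ℝ × ℝ => streamHat v z.1 z.2) {z | z.1 ≠ 0 ∧ 1 < z.2} :=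
  h.tame_v.cont.div (Continuous.continuousOn (by fun_prop)) fun _ hz => I_mul_ne_zero hz.1

/-- The decay of the derivative is discarded (`t^{-7/4} ≤ 1`); integration from the wall then gives
linear vanishing with the same majorant in `k`. -/
theorem norm_le_sub_one {g gy : ℝ → ℝ → ℂ} (hgy : Tame (-7 / 4) gy)
    (hw : ∀ k, k ≠ 0 → Tendsto (fun t => g k t) (𝓝[>] 1) (𝓝 0))
    (hd : ∀ k, k ≠ 0 → ∀ y, 1 < y → HasDerivAt (fun t => g k t) (gy k y) y) :
    ∃ A, 0 ≤ A ∧ ∀ k t, k ≠ 0 → 1 < t → ‖g k t‖ ≤ A * ((t - 1) * maj (3 / 8) k) := by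
  obtain ⟨A, hA0, hA⟩ := hgy.bound
  refine ⟨A, hA0, fun k t hk ht => ?_⟩
  have := norm_le_of_deriv_le (B := fun y => A * maj (3 / 8) k * y)
    (B' := fun _ => A * maj (3 / 8) k) (hw k hk) (hd k hk) (by fun_prop)
    (fun y _ => by simpa using (hasDerivAt_id y).const_mul (A * maj (3 / 8) k)) (fun y hy => ?_) ht
  · refine this.trans (le_of_eq ?_)
    ring
  · refine (hA k y hk hy).trans ?_
    have hm := maj_nonneg (3 / 8) k
    gcongr
    exact mul_le_of_le_one_left hm (rpow_le_one_of_one_le_of_nonpos hy.le (by norm_num))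

theorem sub_one_u (h : FourierData N ω u v) :
    ∃ A, 0 ≤ A ∧ ∀ k t, k ≠ 0 → 1 < t → ‖u k t‖ ≤ A * ((t - 1) * maj (3 / 8) k) :=
  norm_le_sub_one h.tame_uy h.wall_u h.deriv_u

theorem sub_one_v (h : FourierData N ω u v) :
    ∃ A, 0 ≤ A ∧ ∀ k t, k ≠ 0 → 1 < t → ‖v k t‖ ≤ A * ((t - 1) * maj (3 / 8) k) :=
  norm_le_sub_one h.tame_vy h.wall_v h.deriv_v

/-- The stream function has `y`-derivative `û`, which already vanishes linearly; a second
integration from the wall gives the square. Here `v̂ = 0` at the wall makes the stream function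
vanish there. -/
theorem sub_one_sq_streamHat (h : FourierData N ω u v) :
    ∃ A, 0 ≤ A ∧ ∀ k t, k ≠ 0 → 1 < t → ‖streamHat v k t‖ ≤ A * ((t - 1) ^ 2 * maj (3 / 8) k) := by
  obtain ⟨A, hA0, hA⟩ := h.sub_one_u
  refine ⟨A / 2, by positivity, fun k t hk ht => ?_⟩
  have := norm_le_of_deriv_le (B := fun y => A / 2 * maj (3 / 8) k * (y - 1) ^ 2)
    (B' := fun y => A * ((y - 1) * maj (3 / 8) k)) (h.wall_streamHat hk)
    (fun y hy => h.deriv_streamHat hk hy) (by fun_prop)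
    (fun y _ => ?_) (fun y hy => hA k y hk hy) ht
  · refine this.trans (le_of_eq ?_)
    ring
  · refine ((((hasDerivAt_id y).sub_const 1).pow 2).const_mul (A / 2 * maj (3 / 8) k)).congr_deriv ?_
    simp
    ring

/-- Integrating the square integrable majorant of `û`, of order `t^{-3/4}`, costs growth `4
t^{1/4}`. This is harmless, since the stream function is only needed after division by powers of `t
- 1`. -/
theorem rpow_streamHat (h : FourierData N ω u v) :
    ∃ A, 0 ≤ A ∧ ∀ k t, k ≠ 0 → 1 < t →
      ‖streamHat v k t‖ ≤ A * (t ^ (1 / 4 : ℝ) * maj (3 / 8) k) := by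
  obtain ⟨A, hA0, hA⟩ := h.tame_u.bound
  refine ⟨4 * A, by positivity, fun k t hk ht => ?_⟩
  have hm := maj_nonneg (3 / 8) k
  have := norm_le_of_deriv_le (B := fun y => 4 * A * maj (3 / 8) k * y ^ (1 / 4 : ℝ))
    (B' := fun y => A * (y ^ (-3 / 4 : ℝ) * maj (3 / 8) k)) (h.wall_streamHat hk)
    (fun y hy => h.deriv_streamHat hk hy) ?_ (fun y hy => ?_) (fun y hy => hA k y hk hy) ht
  · refine this.trans ?_
    have : 0 ≤ 4 * A * maj (3 / 8) k * 1 ^ (1 / 4 : ℝ) := by positivity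
    nlinarith
  · exact continuousAt_const.mul (continuousAt_id.rpow_const (Or.inl one_ne_zero))
  · refine ((Real.hasDerivAt_rpow_const (p := 1 / 4)
      (Or.inl (by linarith : y ≠ 0))).const_mul (4 * A * maj (3 / 8) k)).congr_deriv ?_
    norm_num
    ring

/-- With `θ = 3/4` the majorant `t^{-5/4}` of `û` is integrable up to infinity, with integral `4`,
whence `32 = 4 · 8`. The bound is uniform in `t` but its majorant is not square integrable in `k`,
so it serves pointwise estimates only. -/
theorem bdd_streamHat (h : FourierData N ω u v) {k t : ℝ} (hk : k ≠ 0) (ht : 1 < t) :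
    ‖streamHat v k t‖ ≤ 32 * N * maj (3 / 4) k := by
  have hm := maj_nonneg (3 / 4) k
  have hN := h.nonneg
  have := norm_le_of_deriv_le (B := fun y => -(32 * N * maj (3 / 4) k) * y ^ (-1 / 4 : ℝ))
    (B' := fun y => 8 * N * (y ^ (-5 / 4 : ℝ) * maj (3 / 4) k)) (h.wall_streamHat hk)
    (fun y hy => h.deriv_streamHat hk hy) ?_ (fun y hy => ?_) (fun y hy => h.small_u k y hk hy) ht
  · refine this.trans ?_
    have h1 : 0 ≤ 32 * N * maj (3 / 4) k * t ^ (-1 / 4 : ℝ) := by positivity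
    rw [one_rpow]
    linarith
  · exact continuousAt_const.mul (continuousAt_id.rpow_const (Or.inl one_ne_zero))
  · refine ((Real.hasDerivAt_rpow_const (p := -1 / 4)
      (Or.inl (by linarith : y ≠ 0))).const_mul (-(32 * N * maj (3 / 4) k))).congr_deriv ?_
    norm_num
    ring

theorem tame_streamHat (h : FourierData N ω u v) : Tame (1 / 4) (streamHat v) :=
  ⟨h.cont_streamHat, h.rpow_streamHat⟩

end FourierData

/-! ### Changing the weight in `t` -/

/-- Division by a power of the distance to the wall. -/
theorem tame_div {g : ℝ → ℝ → ℂ} (n : ℕ) {s : ℝ} (hs : s ≤ n - 3 / 4)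
    (hc : ContinuousOn (fun z : ℝ × ℝ => g z.1 z.2) {z | z.1 ≠ 0 ∧ 1 < z.2})
    (h1 : ∃ A, 0 ≤ A ∧ ∀ k t, k ≠ 0 → 1 < t → ‖g k t‖ ≤ A * ((t - 1) ^ n * maj (3 / 8) k))
    (h2 : ∃ A, 0 ≤ A ∧ ∀ k t, k ≠ 0 → 1 < t → ‖g k t‖ ≤ A * (t ^ s * maj (3 / 8) k)) :
    Tame (-3 / 4) fun k t => g k t / ((t - 1 : ℝ) : ℂ) ^ n := by
  obtain ⟨A, hA0, hA⟩ := h1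
  obtain ⟨B, hB0, hB⟩ := h2
  refine ⟨hc.div (Continuous.continuousOn (by fun_prop)) fun z hz => ?_, 2 * A + 2 ^ n * B,
    by positivity, fun k t hk ht => ?_⟩
  · have : z.2 - 1 ≠ 0 := by linarith [hz.2]
    exact pow_ne_zero _ (by exact_mod_cast this)
  have hm := maj_nonneg (3 / 8) k
  have ht0 : 0 < t := by linarith
  have hp : 0 < (t - 1) ^ n := pow_pos (by linarith) n
  rw [norm_div, norm_pow, Complex.norm_real, Real.norm_of_nonneg (by linarith), div_le_iff₀ hp]
  have hr : 0 < t ^ (-3 / 4 : ℝ) := by positivity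
  -- Near the wall the vanishing rate cancels the denominator; away from it `t ≤ 2(t - 1)`, so the
  -- denominator is comparable with `t ^ n`. The condition `s ≤ n - 3/4` is exactly what the second
  -- regime needs.
  rcases le_total t 2 with h | h
  · refine (hA k t hk ht).trans ?_
    have h3 : 1 ≤ 2 * t ^ (-3 / 4 : ℝ) := by
      have h4 : t ^ (3 / 4 : ℝ) ≤ 2 := by
        calc t ^ (3 / 4 : ℝ) ≤ t ^ (1 : ℝ) := rpow_le_rpow_of_exponent_le ht.le (by norm_num)
          _ ≤ 2 := by rwa [rpow_one]
      have h5 : t ^ (-3 / 4 : ℝ) * t ^ (3 / 4 : ℝ) = 1 := by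
        rw [← rpow_add ht0]
        norm_num
      nlinarith
    have h6 : 0 ≤ (t - 1) ^ n * maj (3 / 8) k := by positivity
    have h7 : 0 ≤ 2 ^ n * B * (t ^ (-3 / 4 : ℝ) * maj (3 / 8) k) * (t - 1) ^ n := by positivity
    nlinarith [mul_le_mul_of_nonneg_left h3 (mul_nonneg hA0 h6)]
  · refine (hB k t hk ht).trans ?_
    have h3 : t ^ s ≤ t ^ (-3 / 4 : ℝ) * (2 ^ n * (t - 1) ^ n) := by
      rw [← mul_pow]
      calc t ^ s ≤ t ^ (-3 / 4 + n : ℝ) := rpow_le_rpow_of_exponent_le ht.le (by linarith)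
        _ = t ^ (-3 / 4 : ℝ) * t ^ n := by rw [rpow_add ht0, rpow_natCast]
        _ ≤ _ := by
          gcongr
          linarith
    have h7 : 0 ≤ 2 * A * (t ^ (-3 / 4 : ℝ) * maj (3 / 8) k) * (t - 1) ^ n := by positivity
    have := mul_le_mul_of_nonneg_left h3 (mul_nonneg hB0 hm)
    nlinarith

/-- Multiplication by `t`. -/
theorem Tame.mul_t {g : ℝ → ℝ → ℂ} (hg : Tame (-7 / 4) g) :
    Tame (-3 / 4) fun k t => (t : ℂ) * g k t := by
  obtain ⟨A, hA0, hA⟩ := hg.bound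
  refine ⟨ContinuousOn.mul (Continuous.continuousOn (by fun_prop)) hg.cont, A, hA0,
    fun k t hk ht => ?_⟩
  have ht0 : 0 < t := by linarith
  rw [norm_mul, Complex.norm_real, Real.norm_of_nonneg ht0.le]
  calc t * ‖g k t‖ ≤ t * (A * (t ^ (-7 / 4 : ℝ) * maj (3 / 8) k)) := by
        gcongr
        exact hA k t hk ht
    _ = A * (t ^ (-3 / 4 : ℝ) * maj (3 / 8) k) := by
        rw [show (-3 / 4 : ℝ) = 1 + -7 / 4 by norm_num, rpow_add ht0, rpow_one]
        ring

theorem Tame.mono {s s' : ℝ} {g : ℝ → ℝ → ℂ} (hg : Tame s g) (h : s ≤ s') : Tame s' g := by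
  obtain ⟨A, hA0, hA⟩ := hg.bound
  refine ⟨hg.cont, A, hA0, fun k t hk ht => (hA k t hk ht).trans ?_⟩
  have hm := maj_nonneg (3 / 8) k
  gcongr
  exact ht.le

end HalfPlaneNS

end

noncomputable section

namespace HalfPlaneNS

open MeasureTheory Filter Real
open scoped FourierTransform

/-! ### The velocity field in physical space -/

/-- The real-linear functional with prescribed values on the two coordinate directions. -/
def coordR (a b : ℝ) : ℝ × ℝ →L[ℝ] ℝ :=
  a • ContinuousLinearMap.fst ℝ ℝ ℝ + b • ContinuousLinearMap.snd ℝ ℝ ℝ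

@[simp] theorem coordR_dir_zero (a b : ℝ) : coordR a b (dir 0) = a := by simp [coordR, dir]

@[simp] theorem coordR_dir_one (a b : ℝ) : coordR a b (dir 1) = b := by simp [coordR, dir]

theorem hasFDerivAt_coordR {h : ℝ × ℝ → ℝ} {p : ℝ × ℝ} (hh : DifferentiableAt ℝ h p) :
    HasFDerivAt h (coordR (pd 0 h p) (pd 1 h p)) p := by
  refine hh.hasFDerivAt.congr_fderiv ?_
  ext <;> simp [coordR, pd, dir]

theorem HasFDerivAt.pd_zero {h : ℝ × ℝ → ℝ} {p : ℝ × ℝ} {a b : ℝ}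
    (hh : HasFDerivAt h (coordR a b) p) : pd 0 h p = a := by
  rw [pd, hh.fderiv, coordR_dir_zero]

theorem HasFDerivAt.pd_one {h : ℝ × ℝ → ℝ} {p : ℝ × ℝ} {a b : ℝ}
    (hh : HasFDerivAt h (coordR a b) p) : pd 1 h p = b := by
  rw [pd, hh.fderiv, coordR_dir_one]

/-- A `C¹` solenoidal velocity field `U` with gradient `G` and stream function `Ψ`, small with
respect to the weight `y⁻¹`, together with the integrability needed for its use as a test
function. -/
structure SmallFlow (M : ℝ) (U : VField) (G : MField) (Ψ : ℝ × ℝ → ℝ) : Prop where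
  nonneg : 0 ≤ M
  hasFDerivAt : ∀ j, ∀ p ∈ Omega, HasFDerivAt (fun q => U q j) (coordR (G p 0 j) (G p 1 j)) p
  contG : ∀ i j, ContinuousOn (fun p => G p i j) Omega
  div : ∀ p ∈ Omega, G p 0 0 + G p 1 1 = 0
  bound : ∀ j, ∀ p ∈ Omega, p.2 * |U p j| ≤ M
  memLp_U : ∀ j, MemLp (fun p => U p j) 2 (volume.restrict Omega)
  memLp_G : ∀ i j, MemLp (fun p => G p i j) 2 (volume.restrict Omega)
  memLp_yG : ∀ j, MemLp (fun p => p.2 * G p 0 j) 2 (volume.restrict Omega)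
  memLp_U_div : ∀ j, MemLp (fun p => U p j / (p.2 - 1)) 2 (volume.restrict Omega)
  stream : ∀ p ∈ Omega, HasFDerivAt Ψ (coordR (-U p 1) (U p 0)) p
  memLp_stream_div : MemLp (fun p => Ψ p / (p.2 - 1)) 2 (volume.restrict Omega)
  memLp_stream_div_sq : MemLp (fun p => Ψ p / (p.2 - 1) ^ 2) 2 (volume.restrict Omega)
  stream_bound : ∃ C, 0 ≤ C ∧ ∀ p ∈ Omega, p.2 * |Ψ p| ≤ C * (p.2 - 1)

/-! ### Passage from transforms to the real fields -/

/-- The real part of the inverse transform. -/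
def rinv (g : ℝ → ℝ → ℂ) (p : ℝ × ℝ) : ℝ := (invFourierX g p.1 p.2).re

theorem Tame.continuousOn_rinv {s : ℝ} {g : ℝ → ℝ → ℂ} (hg : Tame s g) :
    ContinuousOn (rinv g) Omega :=
  Complex.continuous_re.comp_continuousOn hg.continuousOn_inv

theorem Tame.memLp_rinv {g : ℝ → ℝ → ℂ} (hg : Tame (-3 / 4) g) :
    MemLp (rinv g) 2 (volume.restrict Omega) :=
  hg.memLp_inv.re

theorem Tame.hasFDerivAt_rinv {s s₁ s₂ : ℝ} {g gy : ℝ → ℝ → ℂ} (hg : Tame s g)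
    (hgx : Tame s₁ fun k t => -(Complex.I * k) * g k t) (hgy : Tame s₂ gy)
    (hd : ∀ k, k ≠ 0 → ∀ y, 1 < y → HasDerivAt (fun t => g k t) (gy k y) y)
    {p : ℝ × ℝ} (hp : p ∈ Omega) :
    HasFDerivAt (rinv g) (coordR (rinv (fun k t => -(Complex.I * k) * g k t) p) (rinv gy p)) p := by
  have := Complex.reCLM.hasFDerivAt.comp p (hg.hasFDerivAt_inv hgx hgy hd hp)
  refine this.congr_fderiv ?_
  ext <;> simp [coordR, coordCLM, rinv]

theorem rinv_ofReal_mul (c : ℝ → ℝ) (g : ℝ → ℝ → ℂ) (p : ℝ × ℝ) :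
    rinv (fun k t => (c t : ℂ) * g k t) p = c p.2 * rinv g p := by
  have h : ∫ k : ℝ, Complex.exp (-(Complex.I * k * p.1)) * ((c p.2 : ℂ) * g k p.2)
      = (c p.2 : ℂ) * ∫ k : ℝ, Complex.exp (-(Complex.I * k * p.1)) * g k p.2 := by
    rw [← integral_const_mul]
    congr 1
    ext k
    ring
  rw [rinv, rinv, invFourierX, invFourierX, h, ← Complex.re_ofReal_mul]
  congr 1
  ring

/-- Weights depending on `y` alone commute with the inverse transform in `x`, so weighted `L²`
bounds can be proved on the Fourier side. -/
theorem rinv_div_pow (n : ℕ) (g : ℝ → ℝ → ℂ) (p : ℝ × ℝ) :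
    rinv (fun k t => g k t / ((t - 1 : ℝ) : ℂ) ^ n) p = rinv g p / (p.2 - 1) ^ n := by
  have := rinv_ofReal_mul (fun t => ((t - 1) ^ n)⁻¹) g p
  rw [div_eq_inv_mul, ← this]
  congr 1
  ext k t
  push_cast
  rw [div_eq_inv_mul]

theorem abs_rinv_le {g : ℝ → ℝ → ℂ} {p : ℝ × ℝ} {B : ℝ → ℝ} (hB : Integrable B)
    (h : ∀ k, k ≠ 0 → ‖g k p.2‖ ≤ B k) : |rinv g p| ≤ ∫ k, B k := by
  have h1 : ‖∫ k : ℝ, Complex.exp (-(Complex.I * k * p.1)) * g k p.2‖ ≤ ∫ k, B k := by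
    refine norm_integral_le_of_norm_le hB ?_
    filter_upwards [ae_ne_zero] with k hk
    rw [norm_mul, norm_exp_neg_I_mul_mul, one_mul]
    exact h k hk
  refine (Complex.abs_re_le_norm _).trans ?_
  rw [invFourierX, norm_mul]
  refine (mul_le_of_le_one_left (norm_nonneg _) ?_).trans h1
  rw [norm_div, norm_one, norm_mul, Complex.norm_real, Complex.norm_ofNat,
    Real.norm_of_nonneg pi_pos.le, div_le_one (by positivity)]
  linarith [pi_gt_three]

namespace FourierData

variable {N : ℝ} {ω u v : ℝ → ℝ → ℂ}

/-- The gradient of the velocity field with transforms `u` and `v`. -/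
def gradient (ω u v : ℝ → ℝ → ℂ) : MField := fun p =>
  ![![rinv (fun k t => -(Complex.I * k) * u k t) p, rinv (fun k t => -(Complex.I * k) * v k t) p],
    ![rinv (fun k t => -(Complex.I * k) * v k t - ω k t) p,
      rinv (fun k t => Complex.I * k * u k t) p]]

/-- The decay `y^{-5/4}` more than pays for the weight `y`. This constant is the `M` that must
finally be small, and it is linear in `N`. -/
theorem mul_abs_rinv_le (h : FourierData N ω u v) {g : ℝ → ℝ → ℂ}
    (hg : ∀ k t, k ≠ 0 → 1 < t → ‖g k t‖ ≤ 8 * N * (t ^ (-5 / 4 : ℝ) * maj (3 / 4) k))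
    {p : ℝ × ℝ} (hp : p ∈ Omega) : p.2 * |rinv g p| ≤ 8 * N * ∫ k, maj (3 / 4) k := by
  have hp1 : 1 < p.2 := hp
  have hN := h.nonneg
  have hI : Integrable (maj (3 / 4)) := integrable_maj (by norm_num) (by norm_num)
  have h0 : 0 ≤ ∫ k, maj (3 / 4) k := integral_nonneg fun k => maj_nonneg _ _
  have h1 := abs_rinv_le (p := p) ((hI.const_mul (p.2 ^ (-5 / 4 : ℝ))).const_mul (8 * N))
    fun k hk => hg k p.2 hk hp1
  rw [integral_const_mul, integral_const_mul] at h1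
  have h2 : p.2 * p.2 ^ (-5 / 4 : ℝ) ≤ 1 := by
    rw [← rpow_one_add' (by linarith) (by norm_num)]
    exact rpow_le_one_of_one_le_of_nonpos hp1.le (by norm_num)
  calc p.2 * |rinv g p| ≤ p.2 * (8 * N * (p.2 ^ (-5 / 4 : ℝ) * ∫ k, maj (3 / 4) k)) := by gcongr
    _ = (p.2 * p.2 ^ (-5 / 4 : ℝ)) * (8 * N * ∫ k, maj (3 / 4) k) := by ring
    _ ≤ _ := mul_le_of_le_one_left (by positivity) h2

/-- For `y ≤ 2` the quadratic vanishing at the wall is used; for `y ≥ 2` boundedness suffices,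
because `y ≤ 2(y - 1)`. No smallness is required of this constant. -/
theorem stream_bound (h : FourierData N ω u v) :
    ∃ C, 0 ≤ C ∧ ∀ p ∈ Omega, p.2 * |rinv (streamHat v) p| ≤ C * (p.2 - 1) := by
  obtain ⟨A, hA0, hA⟩ := h.sub_one_sq_streamHat
  have hN := h.nonneg
  have hI : Integrable (maj (3 / 4)) := integrable_maj (by norm_num) (by norm_num)
  set I₁ := ∫ k, maj (3 / 8) k with hI₁
  set I₂ := ∫ k, maj (3 / 4) k with hI₂
  have h1 : 0 ≤ I₁ := integral_nonneg fun k => maj_nonneg _ _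
  have h2 : 0 ≤ I₂ := integral_nonneg fun k => maj_nonneg _ _
  refine ⟨2 * (A * I₁) + 2 * (32 * N * I₂), by positivity, fun p hp => ?_⟩
  have hp1 : 1 < p.2 := hp
  have b1 : |rinv (streamHat v) p| ≤ A * ((p.2 - 1) ^ 2 * I₁) := by
    have := abs_rinv_le (p := p) ((integrable_maj'.const_mul ((p.2 - 1) ^ 2)).const_mul A)
      fun k hk => hA k p.2 hk hp1
    rwa [integral_const_mul, integral_const_mul] at this
  have b2 : |rinv (streamHat v) p| ≤ 32 * N * I₂ := by
    have := abs_rinv_le (p := p) (hI.const_mul (32 * N))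
      fun k hk => h.bdd_streamHat hk hp1
    rwa [integral_const_mul] at this
  have c1 : 0 ≤ A * I₁ := by positivity
  have c2 : 0 ≤ 32 * N * I₂ := by positivity
  have c3 := abs_nonneg (rinv (streamHat v) p)
  rcases le_total p.2 2 with hy | hy
  · have d1 : A * ((p.2 - 1) ^ 2 * I₁) ≤ A * I₁ * (p.2 - 1) := by
      have : (p.2 - 1) ^ 2 ≤ p.2 - 1 := by nlinarith
      nlinarith
    nlinarith [mul_nonneg c2 (sub_nonneg.2 hp1.le)]
  · nlinarith [mul_nonneg c1 (sub_nonneg.2 hp1.le)]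

/-- Every field of `SmallFlow` is read off a majorant: membership in `L²` requires decay `t^{-3/4}`
with `maj (3 / 8)`, the derivatives having a spare power of `t` that also pays for the weighted
bound on `∂ₓU`. Only the pointwise weighted bound uses the small constant. -/
theorem smallFlow (h : FourierData N ω u v) {ubar : VField}
    (hinv : ∀ x y : ℝ, 1 < y → ((ubar (x, y) 0 : ℝ) : ℂ) = invFourierX u x y ∧
      ((ubar (x, y) 1 : ℝ) : ℂ) = invFourierX v x y) :
    SmallFlow (8 * N * ∫ k, maj (3 / 4) k) ubar (gradient ω u v) (rinv (streamHat v)) := by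
  have e0 : ∀ p ∈ Omega, ubar p 0 = rinv u p := fun p hp => by
    rw [rinv, ← (hinv p.1 p.2 hp).1, Complex.ofReal_re]
  have e1 : ∀ p ∈ Omega, ubar p 1 = rinv v p := fun p hp => by
    rw [rinv, ← (hinv p.1 p.2 hp).2, Complex.ofReal_re]
  have ae0 : ∀ᵐ p ∂volume.restrict Omega, ubar p 0 = rinv u p := by
    filter_upwards [ae_restrict_mem measurableSet_Omega] with p hp using e0 p hp
  have ae1 : ∀ᵐ p ∂volume.restrict Omega, ubar p 1 = rinv v p := by
    filter_upwards [ae_restrict_mem measurableSet_Omega] with p hp using e1 p hp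
  have hN := h.nonneg
  have h34 : (-7 / 4 : ℝ) ≤ -3 / 4 := by norm_num
  have hdiv1 : ∀ {g : ℝ → ℝ → ℂ}, Tame (-3 / 4) (fun k t => g k t / ((t - 1 : ℝ) : ℂ) ^ 1) →
      MemLp (fun p => rinv g p / (p.2 - 1)) 2 (volume.restrict Omega) := fun {g} hg => by
    refine hg.memLp_rinv.ae_eq (Eventually.of_forall fun p => ?_)
    rw [rinv_div_pow, pow_one]
  refine ⟨by 
    have h0 : 0 ≤ ∫ k, maj (3 / 4) k := integral_nonneg fun k => maj_nonneg _ _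
    positivity,
    ?_, ?_, ?_, ?_, ?_, ?_, ?_, ?_, ?_, ?_, ?_, h.stream_bound⟩
  · intro j p hp
    fin_cases j
    · refine (h.tame_u.hasFDerivAt_rinv h.tame_ku h.tame_uy h.deriv_u hp).congr_of_eventuallyEq ?_
      filter_upwards [isOpen_Omega.mem_nhds hp] with q hq using e0 q hq
    · refine (h.tame_v.hasFDerivAt_rinv h.tame_kv h.tame_vy h.deriv_v hp).congr_of_eventuallyEq ?_
      filter_upwards [isOpen_Omega.mem_nhds hp] with q hq using e1 q hq
  · intro i j
    fin_cases i <;> fin_cases j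
    · exact h.tame_ku.continuousOn_rinv
    · exact h.tame_kv.continuousOn_rinv
    · exact h.tame_uy.continuousOn_rinv
    · exact h.tame_vy.continuousOn_rinv
  · intro p _
    have h1 := rinv_ofReal_mul (fun _ => -1) (fun k t => Complex.I * k * u k t) p
    have h2 : (fun (k t : ℝ) => ((-1 : ℝ) : ℂ) * (Complex.I * k * u k t))
        = fun k t => -(Complex.I * k) * u k t := by
      ext k t
      push_cast
      ring
    rw [h2] at h1
    simp only [gradient, Matrix.cons_val_zero, Matrix.cons_val_one, h1]
    ring
  · intro j p hp
    fin_cases j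
    · simp only [Fin.zero_eta, e0 p hp]
      exact h.mul_abs_rinv_le h.small_u hp
    · simp only [Fin.mk_one, e1 p hp]
      exact h.mul_abs_rinv_le h.small_v hp
  · intro j
    fin_cases j
    · exact h.tame_u.memLp_rinv.ae_eq (ae0.mono fun p hp => hp.symm)
    · exact h.tame_v.memLp_rinv.ae_eq (ae1.mono fun p hp => hp.symm)
  · intro i j
    fin_cases i <;> fin_cases j
    · exact (h.tame_ku.mono h34).memLp_rinv
    · exact (h.tame_kv.mono h34).memLp_rinv
    · exact (h.tame_uy.mono h34).memLp_rinv
    · exact (h.tame_vy.mono h34).memLp_rinv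
  · intro j
    fin_cases j
    · exact h.tame_ku.mul_t.memLp_rinv.ae_eq (Eventually.of_forall fun p => rinv_ofReal_mul id _ p)
    · exact h.tame_kv.mul_t.memLp_rinv.ae_eq (Eventually.of_forall fun p => rinv_ofReal_mul id _ p)
  · intro j
    fin_cases j
    · refine (hdiv1 (tame_div 1 (by norm_num) h.tame_u.cont (by simpa using h.sub_one_u)
        h.tame_u.bound)).ae_eq (ae0.mono fun p hp => ?_)
      simp [hp]
    · refine (hdiv1 (tame_div 1 (by norm_num) h.tame_v.cont (by simpa using h.sub_one_v)
        h.tame_v.bound)).ae_eq (ae1.mono fun p hp => ?_)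
      simp [hp]
  · intro p hp
    have hkx : ∀ k, k ≠ 0 → ∀ t, -(Complex.I * k) * streamHat v k t = -v k t := fun k hk t => by
      rw [streamHat, neg_mul, mul_div_cancel₀ _ (I_mul_ne_zero hk)]
    have hT : Tame (-3 / 4) fun k t => -(Complex.I * k) * streamHat v k t := by
      obtain ⟨A, hA0, hA⟩ := h.tame_v.bound
      refine ⟨h.tame_v.cont.neg.congr fun z hz => hkx z.1 hz.1 z.2, A, hA0, fun k t hk ht => ?_⟩
      rw [hkx k hk, norm_neg]
      exact hA k t hk ht
    have := h.tame_streamHat.hasFDerivAt_rinv hT h.tame_u (fun k hk y hy => h.deriv_streamHat hk hy)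
      hp
    -- At `k = 0` the quotient defining the stream transform takes the default value zero, so the
    -- two integrands agree only almost everywhere.
    have e2 : rinv (fun k t => -(Complex.I * k) * streamHat v k t) p = -rinv v p := by
      rw [← neg_one_mul, ← rinv_ofReal_mul (fun _ => -1)]
      simp only [rinv, invFourierX]
      congr 2
      refine integral_congr_ae ?_
      filter_upwards [ae_ne_zero] with k hk
      rw [hkx k hk]
      simp
    rwa [e2, ← e1 p hp, ← e0 p hp] at this
  · exact hdiv1 (tame_div 1 (by norm_num) h.cont_streamHat (by
      obtain ⟨A, hA0, hA⟩ := h.sub_one_sq_streamHat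
      obtain ⟨B, hB0, hB⟩ := h.rpow_streamHat
      -- Only linear vanishing is needed for one power of `y - 1`: it follows from the quadratic
      -- bound for `t ≤ 2`, and from `t^{1/4} ≤ 2(t - 1)` for `t ≥ 2`.
      refine ⟨A + 2 * B, by positivity, fun k t hk ht => ?_⟩
      have hm := maj_nonneg (3 / 8) k
      rw [pow_one]
      rcases le_total t 2 with ht2 | ht2
      · have h1 : (t - 1) ^ 2 ≤ t - 1 := by nlinarith
        have h2 := hA k t hk ht
        have h3 : A * ((t - 1) ^ 2 * maj (3 / 8) k) ≤ A * ((t - 1) * maj (3 / 8) k) := by gcongr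
        have h4 : 0 ≤ 2 * B * ((t - 1) * maj (3 / 8) k) :=
          mul_nonneg (by positivity) (mul_nonneg (by linarith) hm)
        linarith
      · have h1 : t ^ (1 / 4 : ℝ) ≤ 2 * (t - 1) := by
          calc t ^ (1 / 4 : ℝ) ≤ t ^ (1 : ℝ) := rpow_le_rpow_of_exponent_le ht.le (by norm_num)
            _ ≤ 2 * (t - 1) := by rw [rpow_one]; linarith
        have h2 := hB k t hk ht
        have h3 : B * (t ^ (1 / 4 : ℝ) * maj (3 / 8) k) ≤ B * (2 * (t - 1) * maj (3 / 8) k) := by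
          gcongr
        have h4 : 0 ≤ A * ((t - 1) * maj (3 / 8) k) :=
          mul_nonneg hA0 (mul_nonneg (by linarith) hm)
        linarith) (by simpa using h.rpow_streamHat) (s := 1 / 4))
  · refine (tame_div 2 (s := 1 / 4) (by norm_num) h.cont_streamHat h.sub_one_sq_streamHat
      h.rpow_streamHat).memLp_rinv.ae_eq (Eventually.of_forall fun p => ?_)
    rw [rinv_div_pow]

end FourierData

end HalfPlaneNS

end

noncomputable section

namespace HalfPlaneNS

open MeasureTheory Filter Real
open scoped ContDiff

/-! ### Parseval's identity on the half-plane -/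

/-- Scalar smooth functions with compact support in `Omega`. -/
structure IsBump (h : ℝ × ℝ → ℝ) : Prop where
  smooth : ContDiff ℝ ∞ h
  compact : HasCompactSupport h
  support : tsupport h ⊆ Omega

theorem IsBump.pd {h : ℝ × ℝ → ℝ} (hh : IsBump h) (i : Fin 2) : IsBump (pd i h) :=
  ⟨contDiff_pd hh.smooth i, hasCompactSupport_pd hh.compact i,
    (tsupport_pd_subset h i).trans hh.support⟩

theorem IsBump.sub {g h : ℝ × ℝ → ℝ} (hg : IsBump g) (hh : IsBump h) : IsBump (g - h) :=
  ⟨hg.smooth.sub hh.smooth, hg.compact.sub hh.compact,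
    (tsupport_sub g h).trans (Set.union_subset hg.support hh.support)⟩

theorem IsSmoothCompact.isBump {f : VField} (hf : IsSmoothCompact f) (j : Fin 2) :
    IsBump fun p => f p j := by
  have hs : tsupport (fun p => f p j) ⊆ tsupport f :=
    closure_mono fun p hp => by
      simp only [Function.mem_support] at hp ⊢
      exact fun h0 => hp (by rw [h0]; rfl)
  exact ⟨contDiff_pi.1 hf.smooth j, hf.compact.of_isClosed_subset (isClosed_tsupport _) hs,
    hs.trans hf.support⟩

/-- The projection of the support to the `y`-axis is compact and misses `1`, hence stays at a
positive distance from the wall. -/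
theorem exists_slab {h : ℝ × ℝ → ℝ} (hc : HasCompactSupport h) (hs : tsupport h ⊆ Omega) :
    ∃ c d : ℝ, 1 < c ∧ ∀ x y, y ∉ Set.Icc c d → h (x, y) = 0 := by
  have hK : IsCompact (Prod.snd '' tsupport h) := hc.isCompact.image continuous_snd
  obtain ⟨d, hd⟩ := hK.bddAbove
  have h1 : (1 : ℝ) ∉ Prod.snd '' tsupport h := by
    rintro ⟨p, hp, hp1⟩
    exact (hs hp).ne' hp1
  obtain ⟨ε, hε, hball⟩ := Metric.isOpen_iff.1 hK.isClosed.isOpen_compl 1 h1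
  refine ⟨1 + ε, d, by linarith, fun x y hy => ?_⟩
  by_contra hne
  have hmem : (x, y) ∈ tsupport h := subset_tsupport _ hne
  have hy1 : 1 < y := hs hmem
  refine hy ⟨?_, hd ⟨_, hmem, rfl⟩⟩
  by_contra hlt
  refine hball (a := y) ?_ ⟨_, hmem, rfl⟩
  rw [Metric.mem_ball, Real.dist_eq, abs_lt]
  constructor <;> linarith

theorem fourierX_eq_zero {h : ℝ × ℝ → ℝ} {y : ℝ} (h0 : ∀ x, h (x, y) = 0) (k : ℝ) :
    fourierX h k y = 0 := by
  simp [fourierX, h0]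

theorem integrable_mul_bump {φ : ℝ × ℝ → ℂ} (hφ : ContinuousOn φ Omega) {h : ℝ × ℝ → ℝ}
    (hh : IsBump h) : IntegrableOn (fun p => φ p * (h p : ℂ)) Omega := by
  have h1 : IntegrableOn (fun p => φ p * (h p : ℂ)) (tsupport h) :=
    ((hφ.mono hh.support).mul
      (Complex.continuous_ofReal.comp hh.smooth.continuous).continuousOn).integrableOn_compact
      hh.compact
  have h2 : IntegrableOn (fun p => φ p * (h p : ℂ)) Set.univ := by
    rw [← Set.union_compl_self (tsupport h)]
    refine h1.union (IntegrableOn.congr_fun integrableOn_zero (fun p hp => ?_)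
      (isClosed_tsupport h).measurableSet.compl)
    simp [image_eq_zero_of_notMem_tsupport hp]
  exact h2.mono_set (Set.subset_univ _)

/-- The properties of a function of `(k, y)` needed for Parseval's identity. -/
structure ParsevalData (g : ℝ → ℝ → ℂ) : Prop where
  slice : ∀ y, 1 < y → Integrable fun k => g k y
  cont : ContinuousOn (fun z : ℝ × ℝ => g z.1 z.2) {z | z.1 ≠ 0 ∧ 1 < z.2}
  dom : ∃ B : ℝ → ℝ, Integrable B ∧ ∀ k y, k ≠ 0 → 1 < y → ‖g k y‖ * (1 + k ^ 2)⁻¹ ≤ B k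
  inv : ContinuousOn (fun p : ℝ × ℝ => invFourierX g p.1 p.2) Omega

theorem Tame.parsevalData {s : ℝ} {g : ℝ → ℝ → ℂ} (hg : Tame s g) (hs : s ≤ 0) :
    ParsevalData g := by
  obtain ⟨A, hA0, hA⟩ := hg.bound
  refine ⟨fun y hy => hg.integrable hy, hg.cont, ⟨fun k => A * maj (3 / 8) k,
    integrable_maj'.const_mul A, fun k y hk hy => ?_⟩, hg.continuousOn_inv⟩
  have hm := maj_nonneg (3 / 8) k
  have h1 : (1 + k ^ 2)⁻¹ ≤ 1 := inv_le_one_of_one_le₀ (by nlinarith [sq_nonneg k])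
  refine (mul_le_of_le_one_right (norm_nonneg _) h1).trans ((hA k y hk hy).trans ?_)
  exact mul_le_mul_of_nonneg_left
    (mul_le_of_le_one_left hm (rpow_le_one_of_one_le_of_nonpos hy.le hs)) hA0

/-- The decay `(1 + k²)⁻¹` of the test function's transform is paired with `g`, and its compact
support in `y` bounds the other variable; the majorant is a product `B(k) · C 1_{[c,d]}(y)`. Thus
`g` itself may be merely bounded in `k`, uniformly in `y`, as happens for convolutions. -/
theorem ParsevalData.integrable_prod {g : ℝ → ℝ → ℂ} (hg : ParsevalData g) {h : ℝ × ℝ → ℝ}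
    (hh : IsBump h) : Integrable (Function.uncurry fun k y => g k y * fourierX h (-k) y)
      ((volume : Measure ℝ).prod (volume.restrict (Set.Ioi 1))) := by
  obtain ⟨B, hB, hBle⟩ := hg.dom
  obtain ⟨C, hC⟩ := exists_fourierX_decay hh.smooth hh.compact
  obtain ⟨c, d, hc, hcd⟩ := exists_slab hh.compact hh.support
  have hμ : ((volume : Measure ℝ).prod (volume.restrict (Set.Ioi 1)))
      = (volume : Measure (ℝ × ℝ)).restrict {z | z.1 ≠ 0 ∧ 1 < z.2} := by
    have h1 : {z : ℝ × ℝ | z.1 ≠ 0 ∧ 1 < z.2} = ({0}ᶜ : Set ℝ) ×ˢ Set.Ioi (1 : ℝ) := by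
      ext z
      simp
    rw [h1, Measure.volume_eq_prod, ← Measure.prod_restrict, restrict_compl_singleton]
  have hC0 : 0 ≤ C := by
    have := (norm_nonneg _).trans (hC 0 0)
    simpa using this
  have hdom : Integrable (fun z : ℝ × ℝ => B z.1 * (Set.Icc c d).indicator (fun _ => C) z.2)
      ((volume : Measure ℝ).prod (volume.restrict (Set.Ioi 1))) := by
    refine hB.mul_prod (Integrable.integrableOn ?_)
    exact (integrable_indicator_iff measurableSet_Icc).2
      (integrableOn_const (by simp))
  refine hdom.mono' ?_ ?_
  · rw [hμ]
    refine ContinuousOn.aestronglyMeasurable ?_ ?_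
    · refine hg.cont.mul ((continuous_fourierX hh.smooth.continuous hh.compact).comp
        (by fun_prop : Continuous fun z : ℝ × ℝ => (-z.1, z.2))).continuousOn
    · exact ((measurable_fst (measurableSet_singleton (0 : ℝ)).compl)).inter
        (measurableSet_lt measurable_const measurable_snd)
  · rw [hμ]
    have hm : MeasurableSet {z : ℝ × ℝ | z.1 ≠ 0 ∧ 1 < z.2} :=
      ((measurable_fst (measurableSet_singleton (0 : ℝ)).compl)).inter
        (measurableSet_lt measurable_const measurable_snd)
    filter_upwards [ae_restrict_mem hm] with z hz
    simp only [Function.uncurry]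
    by_cases hy : z.2 ∈ Set.Icc c d
    · rw [Set.indicator_of_mem hy, norm_mul]
      have h1 := hC (-z.1) z.2
      rw [neg_sq] at h1
      calc ‖g z.1 z.2‖ * ‖fourierX h (-z.1) z.2‖ ≤ ‖g z.1 z.2‖ * (C * (1 + z.1 ^ 2)⁻¹) := by gcongr
        _ = (‖g z.1 z.2‖ * (1 + z.1 ^ 2)⁻¹) * C := by ring
        _ ≤ _ := by
          gcongr
          exact hBle _ _ hz.1 hz.2
    · rw [Set.indicator_of_notMem hy, fourierX_eq_zero (fun x => hcd x z.2 hy)]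
      simp

/-- Parseval's identity on each horizontal line, framed by two applications of Fubini: in the plane
the product is continuous with compact support, and in `(k, y)` integrability is
`ParsevalData.integrable_prod`. -/
theorem ParsevalData.integral_eq {g : ℝ → ℝ → ℂ} (hg : ParsevalData g) {h : ℝ × ℝ → ℝ}
    (hh : IsBump h) : ∫ p in Omega, invFourierX g p.1 p.2 * (h p : ℂ)
      = (1 / (2 * π) : ℂ) * ∫ k, ∫ y in Set.Ioi 1, g k y * fourierX h (-k) y := by
  have h1 : Integrable (fun p : ℝ × ℝ => invFourierX g p.1 p.2 * (h p : ℂ))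
      ((volume : Measure ℝ).prod (volume.restrict (Set.Ioi 1))) := by
    rw [← volume_restrict_Omega]
    exact integrable_mul_bump hg.inv hh
  rw [volume_restrict_Omega, integral_prod_symm _ h1, integral_integral_swap (hg.integrable_prod hh),
    ← integral_const_mul]
  refine setIntegral_congr_fun measurableSet_Ioi fun y hy => ?_
  exact integral_invFourierX_mul (hg.slice y hy) (integrable_slice hh.smooth.continuous hh.compact y)

/-! ### The right-hand sides of the system -/

theorem ParsevalData.of_bump {h : ℝ × ℝ → ℝ} (hh : IsBump h) : ParsevalData (fourierX h) := by
  obtain ⟨C, hC⟩ := exists_fourierX_decay hh.smooth hh.compact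
  have hc := continuous_fourierX hh.smooth.continuous hh.compact
  have hC0 : 0 ≤ C := by simpa using (norm_nonneg _).trans (hC 0 0)
  refine ⟨fun y _ => ?_, hc.continuousOn, ⟨fun k => C * (1 + k ^ 2)⁻¹,
    integrable_inv_one_add_sq.const_mul C, fun k y _ _ => ?_⟩, ?_⟩
  · exact (integrable_inv_one_add_sq.const_mul C).mono'
      (hc.comp (by fun_prop : Continuous fun k : ℝ => (k, y))).aestronglyMeasurable
      (Eventually.of_forall fun k => hC k y)
  · have h1 : (1 + k ^ 2)⁻¹ ≤ 1 := inv_le_one_of_one_le₀ (by nlinarith [sq_nonneg k])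
    exact (mul_le_of_le_one_right (norm_nonneg _) h1).trans (hC k y)
  · simp_rw [invFourierX_fourierX hh.smooth hh.compact]
    exact (Complex.continuous_ofReal.comp hh.smooth.continuous).continuousOn

theorem ParsevalData.add {g g' : ℝ → ℝ → ℂ} (hg : ParsevalData g) (hg' : ParsevalData g') :
    ParsevalData (fun k y => g k y + g' k y) ∧ ∀ p ∈ Omega,
      invFourierX (fun k y => g k y + g' k y) p.1 p.2
        = invFourierX g p.1 p.2 + invFourierX g' p.1 p.2 := by
  have hadd : ∀ p ∈ Omega, invFourierX (fun k y => g k y + g' k y) p.1 p.2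
        = invFourierX g p.1 p.2 + invFourierX g' p.1 p.2 := by
    intro p hp
    have hb : ∀ {g : ℝ → ℂ}, Integrable g →
        Integrable fun k : ℝ => Complex.exp (-(Complex.I * k * p.1)) * g k := fun hg =>
      hg.bdd_mul (c := 1) (by fun_prop)
        (Eventually.of_forall fun k => (norm_exp_neg_I_mul_mul k p.1).le)
    simp only [invFourierX, mul_add]
    rw [integral_add (hb (hg.slice _ hp)) (hb (hg'.slice _ hp)), mul_add]
  refine ⟨⟨fun y hy => (hg.slice y hy).add (hg'.slice y hy), hg.cont.add hg'.cont, ?_,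
    (hg.inv.add hg'.inv).congr hadd⟩, hadd⟩
  obtain ⟨B, hB, hBle⟩ := hg.dom
  obtain ⟨B', hB', hBle'⟩ := hg'.dom
  refine ⟨fun k => B k + B' k, hB.add hB', fun k y hk hy => ?_⟩
  have h0 : 0 ≤ (1 + k ^ 2)⁻¹ := by positivity
  have h1 := norm_add_le (g k y) (g' k y)
  nlinarith [hBle k y hk hy, hBle' k y hk hy]

/-- One factor is bounded and the other is dominated by a fixed integrable function of `l`, so the
convolution is bounded and dominated convergence gives joint continuity. -/
theorem continuousOn_convK {N : ℝ} {g h : ℝ → ℝ → ℂ}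
    (hg : ContinuousOn (fun z : ℝ × ℝ => g z.1 z.2) {z | z.1 ≠ 0 ∧ 1 < z.2})
    (hgN : ∀ k t, k ≠ 0 → 1 < t → ‖g k t‖ ≤ N) (hh : Tame (-7 / 4) h) :
    ContinuousOn (fun z : ℝ × ℝ => convK g h z.1 z.2) {z | 1 < z.2} ∧
      ∃ C, ∀ k y, 1 < y → ‖convK g h k y‖ ≤ C := by
  obtain ⟨A, hA0, hA⟩ := hh.bound
  have hle : ∀ z : ℝ × ℝ, 1 < z.2 → ∀ᵐ l : ℝ, ‖g (z.1 - l) z.2 * h l z.2‖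
      ≤ N * (A * maj (3 / 8) l) := by
    intro z hz
    -- Bounds are available off frequency zero only, and the first factor sits at frequency `k - l`;
    -- so `l = k` is discarded as well as `l = 0`.
    have h1 : ∀ᵐ l : ℝ, l ≠ z.1 := by simp [ae_iff, measure_singleton]
    filter_upwards [ae_ne_zero, h1] with l hl hl1
    have h2 := hgN (z.1 - l) z.2 (sub_ne_zero.2 hl1.symm) hz
    have hm := maj_nonneg (3 / 8) l
    rw [norm_mul]
    refine mul_le_mul h2 ((hA l z.2 hl hz).trans ?_) (norm_nonneg _) ((norm_nonneg _).trans h2)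
    gcongr
    exact mul_le_of_le_one_left hm (rpow_le_one_of_one_le_of_nonpos hz.le (by norm_num))
  have hB : Integrable fun l => N * (A * maj (3 / 8) l) :=
    (integrable_maj'.const_mul A).const_mul N
  refine ⟨fun z hz => ContinuousAt.continuousWithinAt ?_,
    ∫ l, N * (A * maj (3 / 8) l), fun k y hy => norm_integral_le_of_norm_le hB (hle (k, y) hy)⟩
  have hz1 : 1 < z.2 := hz
  have hev : ∀ᶠ z' : ℝ × ℝ in 𝓝 z, 1 < z'.2 :=
    (isOpen_lt continuous_const continuous_snd).mem_nhds hz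
  refine continuousAt_of_dominated ?_ ?_ hB ?_
  · filter_upwards [hev] with z' hz'
    refine AEStronglyMeasurable.mul ?_ (aestronglyMeasurable_slice hh.cont hz')
    exact (aestronglyMeasurable_slice hg hz').comp_measurePreserving
      (Measure.measurePreserving_sub_left volume z'.1)
  · filter_upwards [hev] with z' hz' using hle z' hz'
  · have h1 : ∀ᵐ l : ℝ, l ≠ z.1 := by simp [ae_iff, measure_singleton]
    filter_upwards [ae_ne_zero, h1] with l hl hl1
    refine ContinuousAt.mul ?_ ?_
    · exact (continuousAt_fst_slice hg (sub_ne_zero.2 hl1.symm) hz1).comp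
        (f := fun z' : ℝ × ℝ => (z'.1 - l, z'.2)) (by fun_prop)
    · exact (continuousAt_fst_slice hh.cont hl hz1).comp
        (f := fun z' : ℝ × ℝ => (l, z'.2)) (by fun_prop)

theorem parsevalData_convK {N : ℝ} {g h : ℝ → ℝ → ℂ} {s : ℝ} (hg : Tame s g)
    (hgN : ∀ k t, k ≠ 0 → 1 < t → ‖g k t‖ ≤ N) (hh : Tame (-7 / 4) h) :
    ParsevalData (fun k y => (1 / (2 * π) : ℂ) * convK g h k y) := by
  obtain ⟨hc, C, hC⟩ := continuousOn_convK hg.cont hgN hh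
  have hsub : {z : ℝ × ℝ | z.1 ≠ 0 ∧ 1 < z.2} ⊆ {z | 1 < z.2} := fun z hz => hz.2
  refine ⟨fun y hy => (integrable_convK (hg.integrable hy) (hh.integrable hy)).const_mul _,
    continuousOn_const.mul (hc.mono hsub), ⟨fun k => (‖(1 / (2 * π) : ℂ)‖ * C) * (1 + k ^ 2)⁻¹,
      integrable_inv_one_add_sq.const_mul _, fun k y _ hy => ?_⟩, ?_⟩
  · rw [norm_mul]
    exact mul_le_mul_of_nonneg_right
      (mul_le_mul_of_nonneg_left (hC k y hy) (norm_nonneg _)) (by positivity)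
  · refine (hg.continuousOn_inv.mul hh.continuousOn_inv).congr fun p hp => ?_
    exact invFourierX_convK (hg.integrable hp) (hh.integrable hp) p.1

end HalfPlaneNS

end

noncomputable section

namespace HalfPlaneNS

open MeasureTheory Filter Real

/-! ### The weak form of the vorticity equation -/

theorem integral_add_add_sub {X E : Type*} [MeasurableSpace X] {μ : Measure X}
    [NormedAddCommGroup E] [NormedSpace ℝ E] {a b c d : X → E} (ha : Integrable a μ)
    (hb : Integrable b μ) (hc : Integrable c μ) (hd : Integrable d μ) :
    ∫ x, (a x + b x + c x - d x) ∂μ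
      = (∫ x, a x ∂μ) + (∫ x, b x ∂μ) + (∫ x, c x ∂μ) - ∫ x, d x ∂μ := by
  have h1 := integral_sub' ((ha.add hb).add hc) hd
  rwa [integral_add' (ha.add hb) hc, integral_add' ha hb] at h1

theorem hasDerivAt_fourierX {h : ℝ × ℝ → ℝ} (hh : IsBump h) (k y : ℝ) :
    HasDerivAt (fun y => fourierX h k y) (fourierX (pd 1 h) k y) y := by
  obtain ⟨B, hB, hBle⟩ := exists_slice_bound (hh.pd 1).smooth.continuous (hh.pd 1).compact
  have hcont : ∀ {g : ℝ × ℝ → ℝ}, IsBump g → ∀ y, AEStronglyMeasurable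
      (fun x : ℝ => Complex.exp (Complex.I * k * x) * (g (x, y) : ℂ)) volume := fun hg y => by
    have := hg.smooth.continuous
    exact Continuous.aestronglyMeasurable (by fun_prop)
  refine (hasDerivAt_integral_of_dominated_loc_of_deriv_le (μ := volume) (s := Set.univ)
    (F := fun y x => Complex.exp (Complex.I * k * x) * (h (x, y) : ℂ))
    (F' := fun y x => Complex.exp (Complex.I * k * x) * (pd 1 h (x, y) : ℂ))
    (bound := B) univ_mem (Eventually.of_forall fun y => hcont hh y) ?_ (hcont (hh.pd 1) y) ?_ hB
    ?_).2
  · have h1 : Integrable fun x => (h (x, y) : ℂ) :=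
      (integrable_slice hh.smooth.continuous hh.compact y).ofReal
    exact h1.bdd_mul (c := 1) (by fun_prop)
      (Eventually.of_forall fun x => (norm_exp_I_mul_mul k x).le)
  · refine Eventually.of_forall fun x y _ => ?_
    rw [norm_mul, norm_exp_I_mul_mul, one_mul, Complex.norm_real]
    exact hBle x y
  · refine Eventually.of_forall fun x y _ => ?_
    have h1 : HasDerivAt (fun y => (h (x, y) : ℂ)) (pd 1 h (x, y) : ℂ) y :=
      (hasDerivAt_snd (hh.smooth.differentiable (by simp) _)).ofReal_comp
    exact h1.const_mul _

theorem IsTest.isBump {w : VField} (hw : IsTest w) (j : Fin 2) : IsBump fun p => w p j :=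
  hw.smoothCompact.isBump j

theorem IsTest.pd_eq_grad {w : VField} (hw : IsTest w) (i j : Fin 2) (p : ℝ × ℝ) :
    pd i (fun q => w q j) p = grad w p i j := by
  have h1 : DifferentiableAt ℝ w p := hw.smoothCompact.smooth.differentiable (by simp) p
  rw [grad, pd]
  have h2 := (hasFDerivAt_pi'.1 h1.hasFDerivAt j).fderiv
  rw [h2]
  rfl

/-- The divergence condition in frequency space. It expresses `∂_y` of the second component through
the first, which is what later removes `η̂`. -/
theorem IsTest.fourierX_div {w : VField} (hw : IsTest w) (k y : ℝ) :
    fourierX (pd 1 fun p => w p 1) (-k) y = -(Complex.I * k) * fourierX (fun p => w p 0) (-k) y := by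
  have h1 := fourierX_pd_zero (hw.isBump 0).smooth (hw.isBump 0).compact (-k) y
  have h2 : fourierX (pd 1 fun p => w p 1) (-k) y = -fourierX (pd 0 fun p => w p 0) (-k) y := by
    rw [fourierX, fourierX, ← integral_neg]
    congr 1
    ext x
    have h3 := hw.divFree (x, y)
    rw [← hw.pd_eq_grad, ← hw.pd_eq_grad] at h3
    have h4 : pd 1 (fun p => w p 1) (x, y) = -pd 0 (fun p => w p 0) (x, y) := by linarith
    rw [h4]
    push_cast
    ring
  rw [h2, h1]
  push_cast
  ring

/-- The curl of a vector field. -/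
def curl (w : VField) : ℝ × ℝ → ℝ := pd 0 (fun p => w p 1) - pd 1 fun p => w p 0

theorem IsTest.isBump_curl {w : VField} (hw : IsTest w) : IsBump (curl w) :=
  ((hw.isBump 1).pd 0).sub ((hw.isBump 0).pd 1)

theorem IsTest.fourierX_curl {w : VField} (hw : IsTest w) (k y : ℝ) :
    fourierX (curl w) (-k) y = Complex.I * k * fourierX (fun p => w p 1) (-k) y
      - fourierX (pd 1 fun p => w p 0) (-k) y := by
  have h1 := fourierX_pd_zero (hw.isBump 1).smooth (hw.isBump 1).compact (-k) y
  have hi : ∀ {g : ℝ × ℝ → ℝ}, IsBump g → Integrable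
      fun x : ℝ => Complex.exp (Complex.I * (-k : ℝ) * x) * (g (x, y) : ℂ) := fun {g} hg => by
    have h2 : Integrable fun x : ℝ => (g (x, y) : ℂ) :=
      (integrable_slice hg.smooth.continuous hg.compact y).ofReal
    exact h2.bdd_mul (c := 1) (by fun_prop)
      (Eventually.of_forall fun x => (norm_exp_I_mul_mul (-k) x).le)
  have h3 : fourierX (curl w) (-k) y = fourierX (pd 0 fun p => w p 1) (-k) y
      - fourierX (pd 1 fun p => w p 0) (-k) y := by
    rw [fourierX, fourierX, fourierX,
      ← integral_sub (hi ((hw.isBump 1).pd 0)) (hi ((hw.isBump 0).pd 1))]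
    congr 1
    ext x
    simp only [curl, Pi.sub_apply]
    push_cast
    ring
  rw [h3, h1]
  push_cast
  ring

namespace FourierData

variable {N : ℝ} {ω u v : ℝ → ℝ → ℂ}

theorem parsevalData_Q0 (h : FourierData N ω u v) {f : VField} (hf : IsSmoothCompact f) :
    ParsevalData (Q0 f ω u) ∧ ∀ p ∈ Omega, invFourierX (Q0 f ω u) p.1 p.2
      = invFourierX u p.1 p.2 * invFourierX ω p.1 p.2 + (f p 1 : ℂ) := by
  obtain ⟨h1, h2⟩ := (parsevalData_convK h.tame_u h.bdd_u h.tame_ω).add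
    (ParsevalData.of_bump (hf.isBump 1))
  refine ⟨h1, fun p hp => (h2 p hp).trans ?_⟩
  rw [invFourierX_convK (h.tame_u.integrable hp) (h.tame_ω.integrable hp),
    invFourierX_fourierX (hf.isBump 1).smooth (hf.isBump 1).compact]

theorem parsevalData_Q1 (h : FourierData N ω u v) {f : VField} (hf : IsSmoothCompact f) :
    ParsevalData (Q1 f ω v) ∧ ∀ p ∈ Omega, invFourierX (Q1 f ω v) p.1 p.2
      = invFourierX v p.1 p.2 * invFourierX ω p.1 p.2 - (f p 0 : ℂ) := by
  have hb : IsBump fun p => -f p 0 :=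
    ⟨(hf.isBump 0).smooth.neg, (hf.isBump 0).compact.neg, by
      have := (hf.isBump 0).support
      rwa [← tsupport_neg] at this⟩
  obtain ⟨h1, h2⟩ := (parsevalData_convK h.tame_v h.bdd_v h.tame_ω).add (ParsevalData.of_bump hb)
  have h3 : Q1 f ω v = fun k y => (1 / (2 * π) : ℂ) * convK v ω k y + fourierX (fun p => -f p 0) k y := by
    ext k y
    have : fourierX (fun p => -f p 0) k y = -fourierX (fun p => f p 0) k y := by
      rw [fourierX, fourierX, ← integral_neg]
      congr 1
      ext x
      push_cast
      ring
    rw [Q1, this, sub_eq_add_neg]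
  rw [h3]
  refine ⟨h1, fun p hp => (h2 p hp).trans ?_⟩
  rw [invFourierX_convK (h.tame_v.integrable hp) (h.tame_ω.integrable hp),
    invFourierX_fourierX hb.smooth hb.compact]
  push_cast
  ring

/-- The system of ordinary differential equations at a fixed frequency, tested with the transform
of a solenoidal field. -/
theorem integral_system (h : FourierData N ω u v) {α : ℝ} {f : VField} (hf : IsSmoothCompact f)
    {ubar : VField} (ha : IsAlphaSolution α f ω u v ubar) {w : VField} (hw : IsTest w) {k : ℝ}
    (hk : k ≠ 0) :
    ∫ y in Set.Ioi 1, (ω k y * fourierX (curl w) (-k) y + ω k y * fourierX (fun p => w p 1) (-k) y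
      + Q0 f ω u k y * fourierX (fun p => w p 1) (-k) y
      - Q1 f ω v k y * fourierX (fun p => w p 0) (-k) y) = 0 := by
  obtain ⟨η, φ, ψ, hsys⟩ := ha.system
  obtain ⟨c₀, d₀, hc₀, hz₀⟩ := exists_slab (hw.isBump 0).compact (hw.isBump 0).support
  obtain ⟨c₁, d₁, hc₁, hz₁⟩ := exists_slab (hw.isBump 1).compact (hw.isBump 1).support
  set a₀ : ℝ → ℂ := fun y => fourierX (fun p => w p 0) (-k) y with ha₀
  set a₁ : ℝ → ℂ := fun y => fourierX (fun p => w p 1) (-k) y with ha₁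
  have hd₀ : ∀ y, HasDerivAt a₀ (fourierX (pd 1 fun p => w p 0) (-k) y) y :=
    hasDerivAt_fourierX (hw.isBump 0) (-k)
  have hd₁ : ∀ y, HasDerivAt a₁ (-(Complex.I * k) * a₀ y) y := fun y => by
    have := hasDerivAt_fourierX (hw.isBump 1) (-k) y
    rwa [hw.fourierX_div] at this
  set c := min c₀ c₁ with hc
  set d := max d₀ d₁ with hd
  have hc1 : 1 < c := lt_min hc₀ hc₁
  have za₀ : ∀ y, y ∉ Set.Icc c d → a₀ y = 0 := fun y hy =>
    fourierX_eq_zero (fun x => hz₀ x y fun hm => hy ⟨(min_le_left _ _).trans hm.1,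
      hm.2.trans (le_max_left _ _)⟩) _
  have za₁ : ∀ y, y ∉ Set.Icc c d → a₁ y = 0 := fun y hy =>
    fourierX_eq_zero (fun x => hz₁ x y fun hm => hy ⟨(min_le_right _ _).trans hm.1,
      hm.2.trans (le_max_right _ _)⟩) _
  have zb : ∀ y, y ∉ Set.Icc c d → fourierX (pd 1 fun p => w p 0) (-k) y = 0 := fun y hy => by
    refine (hd₀ y).unique ?_
    refine (hasDerivAt_const y (0 : ℂ)).congr_of_eventuallyEq ?_
    filter_upwards [isClosed_Icc.isOpen_compl.mem_nhds hy] with y' hy' using za₀ y' hy'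
  -- In the derivative of this combination the two occurrences of `ikη a₀` cancel, one from the
  -- equation for `ω̂` and one from the divergence condition on the test field. The unknown `η̂`, on
  -- which no bound is assumed, thereby disappears, and the identity expresses that a compactly
  -- supported derivative has zero integral.
  set F : ℝ → ℂ := fun y => ω k y * a₀ y - η k y * a₁ y with hF
  set F' : ℝ → ℂ := fun y => -(ω k y * fourierX (curl w) (-k) y + ω k y * a₁ y
    + Q0 f ω u k y * a₁ y - Q1 f ω v k y * a₀ y) with hF'
  have zF : ∀ y, y ∉ Set.Icc c d → F y = 0 := fun y hy => by
    simp only [hF, za₀ y hy, za₁ y hy, mul_zero, sub_zero]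
  have zF' : ∀ y, y ∉ Set.Icc c d → F' y = 0 := fun y hy => by
    have e := hw.fourierX_curl k y
    rw [zb y hy, show fourierX (fun p => w p 1) (-k) y = a₁ y from rfl, za₁ y hy] at e
    simp only [hF', za₀ y hy, za₁ y hy, e]
    ring
  have hder : ∀ y, HasDerivAt F (F' y) y := by
    intro y
    by_cases hy : y < c
    · have hn : y ∉ Set.Icc c d := fun hm => absurd hm.1 (not_le.2 hy)
      rw [zF' y hn]
      refine (hasDerivAt_const y (0 : ℂ)).congr_of_eventuallyEq ?_
      filter_upwards [isClosed_Icc.isOpen_compl.mem_nhds hn] with y' hy' using zF y' hy'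
    · have hy1 : 1 < y := hc1.trans_le (not_lt.1 hy)
      obtain ⟨-, -, hω, hη, -, -⟩ := hsys k hk y hy1
      refine ((hω.mul (hd₀ y)).sub (hη.mul (hd₁ y))).congr_deriv ?_
      simp only [hF', hw.fourierX_curl]
      rw [show fourierX (fun p => w p 1) (-k) y = a₁ y from rfl]
      ring
  have hint : ∀ {E : ℝ → ℂ}, ContinuousOn E (Set.Ioi 1) → (∀ y, y ∉ Set.Icc c d → E y = 0) →
      Integrable E := by
    intro E hE hz
    have h1 : IntegrableOn E (Set.Icc c d) :=
      (hE.mono fun y hy => hc1.trans_le hy.1).integrableOn_Icc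
    exact (integrableOn_iff_integrable_of_support_subset
      (Function.support_subset_iff'.2 hz)).1 h1
  have slice : ∀ {g : ℝ → ℝ → ℂ}, ContinuousOn (fun z : ℝ × ℝ => g z.1 z.2)
      {z | z.1 ≠ 0 ∧ 1 < z.2} → ContinuousOn (fun y => g k y) (Set.Ioi 1) := fun hg =>
    hg.comp (f := fun y : ℝ => (k, y)) (by fun_prop) fun y hy => ⟨hk, hy⟩
  have cF : Continuous fun y => fourierX (curl w) (-k) y :=
    (continuous_fourierX hw.isBump_curl.smooth.continuous hw.isBump_curl.compact).comp
      (by fun_prop : Continuous fun y : ℝ => (-k, y))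
  have ca₀ : Continuous a₀ := continuous_iff_continuousAt.2 fun y => (hd₀ y).continuousAt
  have ca₁ : Continuous a₁ := continuous_iff_continuousAt.2 fun y => (hd₁ y).continuousAt
  have hFc : ContinuousOn F' (Set.Ioi 1) :=
    (((((slice h.tame_ω.cont).mul cF.continuousOn).add
      ((slice h.tame_ω.cont).mul ca₁.continuousOn)).add
      ((slice (h.parsevalData_Q0 hf).1.cont).mul ca₁.continuousOn)).sub
      ((slice (h.parsevalData_Q1 hf).1.cont).mul ca₀.continuousOn)).neg
  have hFi : Integrable F :=
    hint (fun y _ => (hder y).continuousAt.continuousWithinAt) zF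
  have key := integral_eq_zero_of_hasDerivAt_of_integrable hder (hint hFc zF') hFi
  have h2 : ∫ y in Set.Ioi 1, F' y = ∫ y, F' y :=
    setIntegral_eq_integral_of_forall_compl_eq_zero fun y hy => zF' y fun hm =>
      hy (hc1.trans_le hm.1)
  rw [key] at h2
  simp only [hF', integral_neg, neg_eq_zero] at h2
  exact h2

/-- The weak form of the vorticity equation. -/
theorem vorticity_weak (h : FourierData N ω u v) {α : ℝ} {f : VField} (hf : IsSmoothCompact f)
    {ubar : VField} (ha : IsAlphaSolution α f ω u v ubar) {w : VField} (hw : IsTest w) :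
    ∫ p in Omega, (rinv ω p * curl w p + rinv ω p * w p 1
      + (ubar p 0 * rinv ω p + f p 1) * w p 1 - (ubar p 1 * rinv ω p - f p 0) * w p 0) = 0 := by
  obtain ⟨pQ0, iQ0⟩ := h.parsevalData_Q0 hf
  obtain ⟨pQ1, iQ1⟩ := h.parsevalData_Q1 hf
  have pω := h.tame_ω.parsevalData (by norm_num)
  have bc := hw.isBump_curl
  have b0 := hw.isBump 0
  have b1 := hw.isBump 1
  have i1 := integrable_mul_bump pω.inv bc
  have i2 := integrable_mul_bump pω.inv b1
  have i3 := integrable_mul_bump pQ0.inv b1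
  have i4 := integrable_mul_bump pQ1.inv b0
  have k1 := pω.integrable_prod bc
  have k2 := pω.integrable_prod b1
  have k3 := pQ0.integrable_prod b1
  have k4 := pQ1.integrable_prod b0
  have hC : ∫ p in Omega, (invFourierX ω p.1 p.2 * (curl w p : ℂ)
      + invFourierX ω p.1 p.2 * (w p 1 : ℂ) + invFourierX (Q0 f ω u) p.1 p.2 * (w p 1 : ℂ)
      - invFourierX (Q1 f ω v) p.1 p.2 * (w p 0 : ℂ)) = 0 := by
    rw [integral_add_add_sub i1 i2 i3 i4, pω.integral_eq bc, pω.integral_eq b1, pQ0.integral_eq b1, pQ1.integral_eq b0,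
      ← mul_add, ← mul_add, ← mul_sub]
    have hsum := integral_add_add_sub k1.integral_prod_left k2.integral_prod_left
      k3.integral_prod_left k4.integral_prod_left
    simp only [Function.uncurry] at hsum
    rw [← hsum]
    -- The identity at fixed frequency is available for `k ≠ 0` only, and splitting its integral
    -- requires almost every `k`-slice to be integrable.
    have hz : ∀ᵐ k : ℝ, ((∫ y in Set.Ioi 1, ω k y * fourierX (curl w) (-k) y)
        + (∫ y in Set.Ioi 1, ω k y * fourierX (fun p => w p 1) (-k) y)
        + (∫ y in Set.Ioi 1, Q0 f ω u k y * fourierX (fun p => w p 1) (-k) y)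
        - ∫ y in Set.Ioi 1, Q1 f ω v k y * fourierX (fun p => w p 0) (-k) y) = 0 := by
      filter_upwards [ae_ne_zero, k1.prod_right_ae, k2.prod_right_ae, k3.prod_right_ae,
        k4.prod_right_ae] with k hk j1 j2 j3 j4
      simp only [Function.uncurry] at j1 j2 j3 j4
      rw [← h.integral_system hf ha hw hk, integral_add_add_sub j1 j2 j3 j4]
    rw [integral_congr_ae (g := fun _ => (0 : ℂ))]
    · simp
    · exact hz
  have hre := congrArg Complex.re hC
  have hi : Integrable (fun p : ℝ × ℝ => invFourierX ω p.1 p.2 * (curl w p : ℂ)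
      + invFourierX ω p.1 p.2 * (w p 1 : ℂ) + invFourierX (Q0 f ω u) p.1 p.2 * (w p 1 : ℂ)
      - invFourierX (Q1 f ω v) p.1 p.2 * (w p 0 : ℂ)) (volume.restrict Omega) :=
    ((i1.add i2).add i3).sub i4
  have h5 := Complex.reCLM.integral_comp_comm hi
  rw [Complex.reCLM_apply, hC, Complex.zero_re] at h5
  rw [← h5]
  refine setIntegral_congr_fun measurableSet_Omega fun p hp => ?_
  simp only [Complex.reCLM_apply, iQ0 p hp, iQ1 p hp, ← (ha.inverse p.1 p.2 hp).1,
    ← (ha.inverse p.1 p.2 hp).2, Complex.sub_re, Complex.add_re, Complex.re_mul_ofReal,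
    Complex.re_ofReal_mul, Complex.ofReal_re, rinv]

end FourierData

end HalfPlaneNS

end

noncomputable section

namespace HalfPlaneNS

open MeasureTheory Filter Real

/-! ### Integration by parts in the half-plane -/

theorem IsBump.eq_zero {h : ℝ × ℝ → ℝ} (hh : IsBump h) {p : ℝ × ℝ} (hp : p ∉ Omega) : h p = 0 :=
  image_eq_zero_of_notMem_tsupport fun hm => hp (hh.support hm)

theorem IsBump.integrable_mul {φ : ℝ × ℝ → ℝ} (hφ : ContinuousOn φ Omega) {h : ℝ × ℝ → ℝ}
    (hh : IsBump h) : Integrable fun p => φ p * h p := by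
  have h1 : IntegrableOn (fun p => φ p * h p) (tsupport h) :=
    ((hφ.mono hh.support).mul hh.smooth.continuous.continuousOn).integrableOn_compact hh.compact
  refine (integrableOn_iff_integrable_of_support_subset ?_).1 h1
  exact Function.support_subset_iff'.2 fun p hp => by
    simp [image_eq_zero_of_notMem_tsupport hp]

/-- `φ` is continuously differentiable in the half-plane, with partial derivatives `g 0`, `g 1`. -/
structure HasGrad (φ : ℝ × ℝ → ℝ) (g : Fin 2 → ℝ × ℝ → ℝ) : Prop where
  hasFDerivAt : ∀ p ∈ Omega, HasFDerivAt φ (coordR (g 0 p) (g 1 p)) p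
  cont : ∀ i, ContinuousOn (g i) Omega

namespace HasGrad

variable {φ φ' : ℝ × ℝ → ℝ} {g g' : Fin 2 → ℝ × ℝ → ℝ}

theorem continuousOn (h : HasGrad φ g) : ContinuousOn φ Omega :=
  fun p hp => (h.hasFDerivAt p hp).continuousAt.continuousWithinAt

theorem mul (h : HasGrad φ g) (h' : HasGrad φ' g') :
    HasGrad (fun p => φ p * φ' p) fun i p => g i p * φ' p + φ p * g' i p := by
  refine ⟨fun p hp => ?_, fun i => ?_⟩
  · refine ((h.hasFDerivAt p hp).mul (h'.hasFDerivAt p hp)).congr_fderiv ?_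
    ext <;> simp [coordR] <;> ring
  · exact ((h.cont i).mul h'.continuousOn).add (h.continuousOn.mul (h'.cont i))

theorem add (h : HasGrad φ g) (h' : HasGrad φ' g') :
    HasGrad (fun p => φ p + φ' p) fun i p => g i p + g' i p := by
  refine ⟨fun p hp => ?_, fun i => (h.cont i).add (h'.cont i)⟩
  refine ((h.hasFDerivAt p hp).add (h'.hasFDerivAt p hp)).congr_fderiv ?_
  ext <;> simp [coordR]

/-- The bump function vanishes near the wall, so both integrals extend to the whole plane without
boundary terms and nothing is required of `φ` outside the half-plane. -/
theorem integral_mul_pd (hφ : HasGrad φ g) {h : ℝ × ℝ → ℝ} (hh : IsBump h) (i : Fin 2) :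
    ∫ p in Omega, φ p * pd i h p = -∫ p in Omega, g i p * h p := by
  rw [setIntegral_eq_integral_of_forall_compl_eq_zero fun p hp => by
      rw [(hh.pd i).eq_zero hp, mul_zero],
    setIntegral_eq_integral_of_forall_compl_eq_zero fun p hp => by rw [hh.eq_zero hp, mul_zero]]
  refine integral_bilinear_hasLineDerivAt_right_eq_neg_left_of_integrable
    (μ := (volume : Measure (ℝ × ℝ))) (B := ContinuousLinearMap.mul ℝ ℝ) (v := dir i)
    (hh.integrable_mul (hφ.cont i)) ((hh.pd i).integrable_mul hφ.continuousOn)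
    (hh.integrable_mul hφ.continuousOn) (fun p hp => ?_) fun p _ => ?_
  · have := (hφ.hasFDerivAt p (hh.support hp)).hasLineDerivAt (dir i)
    fin_cases i
    · simpa using this
    · simpa using this
  · exact (hh.smooth.differentiable (by simp) p).hasFDerivAt.hasLineDerivAt (dir i)

/-- Gradients are orthogonal to solenoidal test fields. -/
theorem integral_grad_mul (hφ : HasGrad φ g) {w : VField} (hw : IsTest w) :
    ∫ p in Omega, (g 0 p * w p 0 + g 1 p * w p 1) = 0 := by
  have b0 := hw.isBump 0
  have b1 := hw.isBump 1
  have h0 := hφ.integral_mul_pd b0 0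
  have h1 := hφ.integral_mul_pd b1 1
  rw [integral_add (b0.integrable_mul (hφ.cont 0)).integrableOn
    (b1.integrable_mul (hφ.cont 1)).integrableOn]
  have h2 : ∫ p in Omega, (φ p * pd 0 (fun q => w q 0) p + φ p * pd 1 (fun q => w q 1) p) = 0 := by
    rw [integral_congr_ae (g := fun _ => (0 : ℝ))]
    · simp
    · refine Eventually.of_forall fun p => ?_
      simp only
      rw [← mul_add, hw.pd_eq_grad, hw.pd_eq_grad, hw.divFree, mul_zero]
  rw [integral_add ((b0.pd 0).integrable_mul hφ.continuousOn).integrableOn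
    ((b1.pd 1).integrable_mul hφ.continuousOn).integrableOn] at h2
  linarith

end HasGrad

theorem IsBump.hasGrad {h : ℝ × ℝ → ℝ} (hh : IsBump h) : HasGrad h fun i => HalfPlaneNS.pd i h :=
  ⟨fun p _ => hasFDerivAt_coordR (hh.smooth.differentiable (by simp) p),
    fun i => (hh.pd i).smooth.continuous.continuousOn⟩

theorem pd_comm {h : ℝ × ℝ → ℝ} (hh : IsBump h) (i j : Fin 2) (p : ℝ × ℝ) :
    pd i (pd j h) p = pd j (pd i h) p := by
  have hd : DifferentiableAt ℝ (fderiv ℝ h) p :=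
    (hh.smooth.fderiv_right (m := ((⊤ : ℕ∞) : WithTop ℕ∞)) (by simp)).differentiable (by simp) p
  have key : ∀ i j, pd i (pd j h) p = fderiv ℝ (fderiv ℝ h) p (dir i) (dir j) := by
    intro i j
    have : HasFDerivAt (pd j h) _ p :=
      hd.hasFDerivAt.clm_apply (hasFDerivAt_const (dir j) p)
    rw [pd, this.fderiv]
    simp
  rw [key, key]
  exact (hh.smooth.contDiffAt.isSymmSndFDerivAt (by
    simp only [minSmoothness_of_isRCLikeNormedField]
    exact WithTop.coe_le_coe.2 (le_top : (2 : ℕ∞) ≤ ⊤))).eq _ _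

/-- Symmetry of second derivatives preserves the divergence condition. This permits testing with
`∂ₓw` and `∂_y w`, which turns `∫ ω curl w` into the full Dirichlet form. -/
theorem IsTest.deriv {w : VField} (hw : IsTest w) (i : Fin 2) : IsTest fun p j => grad w p i j := by
  have hb : ∀ j, IsBump fun p => grad w p i j := fun j => by
    have := (hw.isBump j).pd i
    rwa [funext (hw.pd_eq_grad i j)] at this
  have hsup : tsupport (fun p j => grad w p i j) ⊆ tsupport w :=
    closure_minimal (fun p hp => by
      refine tsupport_fderiv_subset ℝ (f := w) (subset_tsupport _ fun h0 => hp ?_)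
      ext j
      simp [grad, h0]) (isClosed_tsupport w)
  have hsm : IsSmoothCompact fun p j => grad w p i j :=
    ⟨contDiff_pi.2 fun j => (hb j).smooth,
      hw.smoothCompact.compact.of_isClosed_subset (isClosed_tsupport _) hsup,
      hsup.trans hw.smoothCompact.support⟩
  refine ⟨hsm, fun p => ?_⟩
  have hg : ∀ a j, grad (fun p j => grad w p i j) p a j = pd a (pd i fun q => w q j) p := by
    intro a j
    have h1 : DifferentiableAt ℝ (fun p j => grad w p i j) p :=
      hsm.smooth.differentiable (by simp) p
    have h2 := (hasFDerivAt_pi'.1 h1.hasFDerivAt j).fderiv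
    rw [funext (hw.pd_eq_grad i j), pd, h2]
    rfl
  rw [hg, hg, pd_comm (hw.isBump 0), pd_comm (hw.isBump 1)]
  have h0 : (pd 0 fun q => w q 0) + (pd 1 fun q => w q 1) = 0 := by
    ext q
    simp [hw.pd_eq_grad, hw.divFree]
  have h1 : pd i ((pd 0 fun q => w q 0) + (pd 1 fun q => w q 1)) p = 0 := by
    rw [h0, pd]
    simp
  rwa [pd, fderiv_add (((hw.isBump 0).pd 0).smooth.differentiable (by simp) p)
    (((hw.isBump 1).pd 1).smooth.differentiable (by simp) p)] at h1

/-! ### The weak form of the momentum equation -/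

/-- The weak form of the momentum equation, tested with solenoidal fields. -/
def MomentumWeak (f U : VField) (G : MField) : Prop :=
  ∀ w : VField, IsTest w →
    (∫ p in Omega, contract G (grad w) p) + (∫ p in Omega, dot (advection U G) w p)
      = -∫ p in Omega, dot f w p

namespace SmallFlow

variable {M : ℝ} {U : VField} {G : MField} {Ψ : ℝ × ℝ → ℝ}

theorem hasGrad (h : SmallFlow M U G Ψ) (j : Fin 2) :
    HasGrad (fun p => U p j) fun i p => G p i j :=
  ⟨h.hasFDerivAt j, fun i => h.contG i j⟩

theorem contU (h : SmallFlow M U G Ψ) (j : Fin 2) : ContinuousOn (fun p => U p j) Omega :=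
  (h.hasGrad j).continuousOn

/-- The vorticity form of the equations implies the velocity form. -/
theorem momentumWeak (h : SmallFlow M U G Ψ) {f : VField} (hf : IsSmoothCompact f)
    (hvort : ∀ w, IsTest w → ∫ p in Omega, ((G p 0 1 - G p 1 0) * curl w p
      + (G p 0 1 - G p 1 0) * w p 1 + (U p 0 * (G p 0 1 - G p 1 0) + f p 1) * w p 1
      - (U p 1 * (G p 0 1 - G p 1 0) - f p 0) * w p 0) = 0) : MomentumWeak f U G := by
  intro w hw
  have b0 := hw.isBump 0
  have b1 := hw.isBump 1
  have v := hvort w hw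
  -- The difference between `∇U : ∇w` and `ω curl w` is `∇U₀·∂ₓw + ∇U₁·∂_y w`. Each term is a
  -- gradient against a solenoidal test field and integrates to zero.
  have g0 := (h.hasGrad 0).integral_grad_mul (hw.deriv 0)
  have g1 := (h.hasGrad 1).integral_grad_mul (hw.deriv 1)
  -- Twice the Bernoulli function `|U|²/2 + U₀`. Indeed `(U·∇)U = ∇|U|²/2 + ω(-U₁, U₀)` and `∂ₓU =
  -- ∇U₀ + (0, ω)`; the factor `1/2` is restored when the integrals are combined.
  have hφ := (((h.hasGrad 0).mul (h.hasGrad 0)).add ((h.hasGrad 1).mul (h.hasGrad 1))).add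
    ((h.hasGrad 0).add (h.hasGrad 0))
  have g2 := hφ.integral_grad_mul hw
  have bd : ∀ i j, IsBump fun p => grad w p i j := fun i j => (hw.deriv i).isBump j
  have ia : Integrable (contract G (grad w)) (volume.restrict Omega) := by
    refine integrable_finsetSum _ fun i _ => integrable_finsetSum _ fun j _ => ?_
    exact ((bd i j).integrable_mul (h.contG i j)).integrableOn
  have cadv : ∀ j, ContinuousOn (fun p => advection U G p j) Omega := fun j =>
    continuousOn_finsetSum _ fun i _ => ((h.contU i).add continuousOn_const).mul (h.contG i j)
  have ib : Integrable (dot (advection U G) w) (volume.restrict Omega) :=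
    integrable_finsetSum _ fun j _ => ((hw.isBump j).integrable_mul (cadv j)).integrableOn
  have ic : Integrable (dot f w) (volume.restrict Omega) :=
    integrable_finsetSum _ fun j _ => ((hw.isBump j).integrable_mul
      (hf.isBump j).smooth.continuous.continuousOn).integrableOn
  have i0 : Integrable (fun p => G p 0 0 * grad w p 0 0 + G p 1 0 * grad w p 0 1)
      (volume.restrict Omega) :=
    (((bd 0 0).integrable_mul (h.contG 0 0)).add
      ((bd 0 1).integrable_mul (h.contG 1 0))).integrableOn
  have i1 : Integrable (fun p => G p 0 1 * grad w p 1 0 + G p 1 1 * grad w p 1 1)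
      (volume.restrict Omega) :=
    (((bd 1 0).integrable_mul (h.contG 0 1)).add
      ((bd 1 1).integrable_mul (h.contG 1 1))).integrableOn
  have i2 := ((b0.integrable_mul (hφ.cont 0)).add (b1.integrable_mul (hφ.cont 1))).integrableOn
    (s := Omega)
  have esum : (∫ p in Omega, contract G (grad w) p) + (∫ p in Omega, dot (advection U G) w p)
      + ∫ p in Omega, dot f w p
      = ∫ p in Omega, (contract G (grad w) p + dot (advection U G) w p + dot f w p) := by
    have := integral_add' (ia.add ib) ic
    rw [integral_add' ia ib] at this
    exact this.symm
  have e2 := integral_sub ((ia.add ib).add ic) ((i0.add i1).add (i2.const_mul (1 / 2)))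
  have e3 := integral_add (i0.add i1) (i2.const_mul (1 / 2))
  have e4 := integral_add i0 i1
  have e5 := integral_const_mul (μ := volume.restrict Omega) (1 / 2 : ℝ) fun p =>
    ((((G p 0 0 * U p 0 + U p 0 * G p 0 0) + (G p 0 1 * U p 1 + U p 1 * G p 0 1))
      + (G p 0 0 + G p 0 0)) * w p 0
    + (((G p 1 0 * U p 0 + U p 0 * G p 1 0) + (G p 1 1 * U p 1 + U p 1 * G p 1 1))
      + (G p 1 0 + G p 1 0)) * w p 1)
  have e6 : ∫ p in Omega, ((contract G (grad w) p + dot (advection U G) w p + dot f w p)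
      - (((G p 0 0 * grad w p 0 0 + G p 1 0 * grad w p 0 1)
        + (G p 0 1 * grad w p 1 0 + G p 1 1 * grad w p 1 1))
        + 1 / 2 * ((((G p 0 0 * U p 0 + U p 0 * G p 0 0) + (G p 0 1 * U p 1 + U p 1 * G p 0 1))
      + (G p 0 0 + G p 0 0)) * w p 0
    + (((G p 1 0 * U p 0 + U p 0 * G p 1 0) + (G p 1 1 * U p 1 + U p 1 * G p 1 1))
      + (G p 1 0 + G p 1 0)) * w p 1))) = 0 := by
    rw [← v]
    refine integral_congr_ae (Eventually.of_forall fun p => ?_)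
    simp only [contract, dot, advection, curl, Fin.sum_univ_two, Pi.sub_apply, hw.pd_eq_grad,
      e1]
    norm_num
    ring
  simp only [Pi.add_apply] at e2 e3 e4
  rw [e5, g2] at e3
  rw [e4, g0, g1] at e3
  rw [e3, e6] at e2
  linarith

end SmallFlow

/-- The inverse transform of `ω̂` is the curl of the velocity, because `-ik v̂` occurs both in `∂ₓv`
and in `∂_y u`. -/
theorem FourierData.momentumWeak {N : ℝ} {ω u v : ℝ → ℝ → ℂ} (h : FourierData N ω u v) {α : ℝ}
    {f : VField} (hf : IsSmoothCompact f) {ubar : VField} (ha : IsAlphaSolution α f ω u v ubar) :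
    MomentumWeak f ubar (gradient ω u v) := by
  refine (h.smallFlow ha.inverse).momentumWeak hf fun w hw => ?_
  rw [← h.vorticity_weak hf ha hw]
  refine setIntegral_congr_fun measurableSet_Omega fun p hp => ?_
  have hb : ∀ {g : ℝ → ℂ}, Integrable g →
      Integrable fun k : ℝ => Complex.exp (-(Complex.I * k * p.1)) * g k := fun hg =>
    hg.bdd_mul (c := 1) (by fun_prop)
      (Eventually.of_forall fun k => (norm_exp_neg_I_mul_mul k p.1).le)
  have e : gradient ω u v p 0 1 - gradient ω u v p 1 0 = rinv ω p := by
    simp only [gradient, Matrix.cons_val_zero, Matrix.cons_val_one, rinv, invFourierX, mul_sub]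
    rw [integral_sub (hb (h.tame_kv.integrable hp)) (hb (h.tame_ω.integrable hp)), mul_sub,
      Complex.sub_re]
    ring
  simp only [e]

end HalfPlaneNS

end

noncomputable section

namespace HalfPlaneNS

open MeasureTheory Filter Real

/-! ### Square integrable functions -/

section L2

variable {X : Type*} [MeasurableSpace X] {μ : Measure X}

theorem eLpNorm_two_le_iff {f : X → ℝ} {C : ℝ≥0∞} :
    eLpNorm f 2 μ ≤ C ↔ ∫⁻ x, ‖f x‖ₑ ^ 2 ∂μ ≤ C ^ 2 := by
  rw [eLpNorm_eq_lintegral_rpow_enorm_toReal (by norm_num) (by norm_num)]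
  simp only [ENNReal.toReal_ofNat, ENNReal.rpow_ofNat]
  rw [one_div, ENNReal.rpow_inv_le_iff (by norm_num), ENNReal.rpow_ofNat]

theorem eLpNorm_two_sq {f : X → ℝ} (hf : MemLp f 2 μ) :
    eLpNorm f 2 μ ^ 2 = ENNReal.ofReal (∫ x, f x ^ 2 ∂μ) := by
  rw [eLpNorm_eq_lintegral_rpow_enorm_toReal (by norm_num) (by norm_num),
    ofReal_integral_eq_lintegral_ofReal hf.integrable_sq (Eventually.of_forall fun x => sq_nonneg _)]
  simp only [ENNReal.toReal_ofNat, ENNReal.rpow_ofNat]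
  rw [← ENNReal.rpow_natCast, ← ENNReal.rpow_mul]
  norm_num
  refine lintegral_congr fun x => ?_
  rw [← ofReal_norm, ← ENNReal.ofReal_pow (norm_nonneg _), Real.norm_eq_abs, sq_abs]

theorem integrable_mul_of_memLp {f g : X → ℝ} (hf : MemLp f 2 μ) (hg : MemLp g 2 μ) :
    Integrable (fun x => f x * g x) μ :=
  MemLp.integrable_mul (p := 2) (q := 2) hf hg

theorem tendsto_integral_mul {T g : X → ℝ} {G : ℕ → X → ℝ} (hT : MemLp T 2 μ) (hg : MemLp g 2 μ)
    (hG : ∀ n, MemLp (G n) 2 μ)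
    (h : Tendsto (fun n => eLpNorm (fun x => G n x - g x) 2 μ) atTop (𝓝 0)) :
    Tendsto (fun n => ∫ x, T x * G n x ∂μ) atTop (𝓝 (∫ x, T x * g x ∂μ)) := by
  refine tendsto_integral_of_L1' _ (integrable_mul_of_memLp hT hg).1
    (Eventually.of_forall fun n => integrable_mul_of_memLp hT (hG n)) ?_
  have hle : ∀ n, eLpNorm ((fun x => T x * G n x) - fun x => T x * g x) 1 μ
      ≤ eLpNorm T 2 μ * eLpNorm (fun x => G n x - g x) 2 μ := by
    intro n
    have := eLpNorm_smul_le_mul_eLpNorm (p := 2) (q := 2) (r := 1) (μ := μ)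
      (((hG n).sub hg).1) hT.1
    refine le_trans (le_of_eq ?_) this
    congr 1
    ext x
    simp [mul_sub]
  have h0 : Tendsto (fun n => eLpNorm T 2 μ * eLpNorm (fun x => G n x - g x) 2 μ) atTop (𝓝 0) := by
    have := ENNReal.Tendsto.const_mul h (Or.inr hT.2.ne)
    rwa [mul_zero] at this
  exact tendsto_of_tendsto_of_tendsto_of_le_of_le tendsto_const_nhds h0 (fun _ => zero_le) hle

end L2

/-! ### Hardy's inequality and the energy space -/

theorem IsBump.memLp {h : ℝ × ℝ → ℝ} (hh : IsBump h) (μ : Measure (ℝ × ℝ))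
    [IsFiniteMeasureOnCompacts μ] : MemLp h 2 μ :=
  hh.smooth.continuous.memLp_of_hasCompactSupport hh.compact

/-- The restriction of `volume` to the half-plane. -/
abbrev volΩ : Measure (ℝ × ℝ) := volume.restrict Omega

theorem hasGrad_inv_snd : HasGrad (fun p => p.2⁻¹) fun i p => if i = 0 then 0 else -(p.2 ^ 2)⁻¹ := by
  have hne : ∀ p ∈ Omega, p.2 ≠ 0 := fun p hp => by
    have : 1 < p.2 := hp
    linarith
  refine ⟨fun p hp => ?_, fun i => ?_⟩
  · refine ((hasDerivAt_inv (hne p hp)).hasFDerivAt.comp p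
      (hasFDerivAt_snd (𝕜 := ℝ) (p := p))).congr_fderiv ?_
    ext <;> simp [coordR]
  · fin_cases i
    · exact continuousOn_const
    · simp only [Fin.mk_one, one_ne_zero, if_false]
      exact (ContinuousOn.inv₀ (by fun_prop) fun p hp => pow_ne_zero _ (hne p hp)).neg

theorem IsBump.memLp_div {h : ℝ × ℝ → ℝ} (hh : IsBump h) :
    MemLp (fun p => h p / p.2) 2 volΩ := by
  have hm : AEStronglyMeasurable (fun p : ℝ × ℝ => h p / p.2) volΩ :=
    (hh.smooth.continuous.measurable.div measurable_snd).aestronglyMeasurable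
  refine (hh.memLp volΩ).mono hm ?_
  filter_upwards [ae_restrict_mem measurableSet_Omega] with p hp
  have : 1 < p.2 := hp
  rw [norm_div]
  refine div_le_self (norm_nonneg _) ?_
  rw [Real.norm_eq_abs]
  exact this.le.trans (le_abs_self _)

/-- Hardy's inequality for smooth functions with compact support. -/
theorem IsBump.hardy {h : ℝ × ℝ → ℝ} (hh : IsBump h) :
    eLpNorm (fun p => h p / p.2) 2 volΩ ≤ 2 * eLpNorm (HalfPlaneNS.pd 1 h) 2 volΩ := by
  have hsq : IsBump fun p => h p * h p :=
    ⟨hh.smooth.mul hh.smooth, hh.compact.mul_right,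
      (closure_mono (Function.support_mul_subset_left h h)).trans hh.support⟩
  have h1 := hasGrad_inv_snd.integral_mul_pd hsq 1
  have i1 := hh.memLp_div.integrable_sq
  have i2 := ((hh.pd 1).memLp volΩ).integrable_sq
  -- The weight is `y⁻² = -∂_y y⁻¹`, and the derivative is moved onto `h²`.
  have e1 : ∫ p in Omega, (h p / p.2) ^ 2 = ∫ p in Omega, 2 * ((h p / p.2) * HalfPlaneNS.pd 1 h p) := by
    have h2 : ∫ p in Omega, (h p / p.2) ^ 2
        = -∫ p in Omega, (if (1 : Fin 2) = 0 then 0 else -(p.2 ^ 2)⁻¹) * (h p * h p) := by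
      rw [← integral_neg]
      refine integral_congr_ae (Eventually.of_forall fun p => ?_)
      simp only [one_ne_zero, if_false, div_pow]
      ring
    rw [h2, ← h1]
    refine integral_congr_ae (Eventually.of_forall fun p => ?_)
    have hd := (hh.smooth.differentiable (by simp) p).hasFDerivAt
    simp only [HalfPlaneNS.pd]
    have h3 : HasFDerivAt (fun p => h p * h p) _ p := hd.mul hd
    rw [h3.fderiv]
    simp
    ring
  -- Young's inequality `2ab ≤ a²/2 + 2b²` lets half of the left side be absorbed, which produces
  -- the constant `4` for squares.
  have e2 : ∫ p in Omega, 2 * ((h p / p.2) * HalfPlaneNS.pd 1 h p)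
      ≤ ∫ p in Omega, ((1 / 2) * (h p / p.2) ^ 2 + 2 * HalfPlaneNS.pd 1 h p ^ 2) := by
    refine integral_mono ((integrable_mul_of_memLp hh.memLp_div ((hh.pd 1).memLp volΩ)).const_mul 2)
      ((i1.const_mul _).add (i2.const_mul _)) fun p => ?_
    simp only
    nlinarith [sq_nonneg (h p / p.2 - 2 * HalfPlaneNS.pd 1 h p)]
  rw [← e1, integral_add (i1.const_mul _) (i2.const_mul _), integral_const_mul,
    integral_const_mul] at e2
  have e3 : ∫ p in Omega, (h p / p.2) ^ 2 ≤ 4 * ∫ p in Omega, HalfPlaneNS.pd 1 h p ^ 2 := by linarith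
  have e4 : eLpNorm (fun p => h p / p.2) 2 volΩ ^ 2 ≤ (2 * eLpNorm (HalfPlaneNS.pd 1 h) 2 volΩ) ^ 2 := by
    rw [mul_pow, eLpNorm_two_sq hh.memLp_div, eLpNorm_two_sq ((hh.pd 1).memLp volΩ)]
    refine (ENNReal.ofReal_le_ofReal e3).trans (le_of_eq ?_)
    rw [ENNReal.ofReal_mul (by norm_num)]
    norm_num
  exact (ENNReal.pow_le_pow_left_iff (by norm_num)).1 e4

/-- Monotone convergence along a compact exhaustion. It upgrades the local convergence in the
definition of `D` to a statement on the whole half-plane. -/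
theorem eLpNorm_Omega_le {f : ℝ × ℝ → ℝ} {C : ℝ≥0∞}
    (h : ∀ K, IsCompact K → K ⊆ Omega → eLpNorm f 2 (volume.restrict K) ≤ C) :
    eLpNorm f 2 volΩ ≤ C := by
  set K : ℕ → Set (ℝ × ℝ) := fun n => Metric.closedBall 0 n ∩ {p | 1 + 1 / ((n : ℝ) + 1) ≤ p.2} with hK
  have hKc : ∀ n, IsCompact (K n) := fun n =>
    (isCompact_closedBall _ _).inter_right (isClosed_le continuous_const continuous_snd)
  have hKs : ∀ n, K n ⊆ Omega := fun n p hp => by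
    have h1 : 1 + 1 / ((n : ℝ) + 1) ≤ p.2 := hp.2
    have h2 : 0 < 1 / ((n : ℝ) + 1) := by positivity
    show 1 < p.2
    linarith
  have hmono : Monotone K := by
    intro m n hmn p hp
    have hmn' : (m : ℝ) ≤ n := by exact_mod_cast hmn
    refine ⟨Metric.closedBall_subset_closedBall hmn' hp.1, le_trans (?_ : _ ≤ 1 + 1 / ((m : ℝ) + 1)) hp.2⟩
    have := one_div_le_one_div_of_le (by positivity : (0 : ℝ) < m + 1) (by linarith : (m : ℝ) + 1 ≤ n + 1)
    linarith
  have hU : Omega = ⋃ n, K n := by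
    refine Set.Subset.antisymm (fun p hp => ?_) (Set.iUnion_subset hKs)
    have hp1 : 0 < p.2 - 1 := sub_pos.2 hp
    obtain ⟨n, hn⟩ := exists_nat_ge (max ‖p‖ (1 / (p.2 - 1)))
    refine Set.mem_iUnion.2 ⟨n, ?_, ?_⟩
    · rw [mem_closedBall_zero_iff]
      exact (le_max_left _ _).trans hn
    · have h1 : 1 / (p.2 - 1) ≤ n + 1 := ((le_max_right _ _).trans hn).trans (by linarith)
      have h2 := (one_div_le hp1 (by positivity)).1 h1
      show 1 + 1 / ((n : ℝ) + 1) ≤ p.2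
      linarith
  rw [eLpNorm_two_le_iff, volΩ, hU, setLIntegral_iUnion_of_directed _ (hmono.directed_le)]
  exact iSup_le fun n => eLpNorm_two_le_iff.1 (h _ (hKc n) (hKs n))

theorem IsTest.sub {w w' : VField} (hw : IsTest w) (hw' : IsTest w') : IsTest (w - w') := by
  refine ⟨⟨hw.smoothCompact.smooth.sub hw'.smoothCompact.smooth,
    hw.smoothCompact.compact.sub hw'.smoothCompact.compact, (tsupport_sub w w').trans
      (Set.union_subset hw.smoothCompact.support hw'.smoothCompact.support)⟩, fun p => ?_⟩
  have h1 := hw.divFree p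
  have h2 := hw'.divFree p
  simp only [grad] at h1 h2 ⊢
  rw [fderiv_sub (hw.smoothCompact.smooth.differentiable (by simp) p)
    (hw'.smoothCompact.smooth.differentiable (by simp) p)]
  simp only [sub_apply, Pi.sub_apply]
  linarith

theorem IsTest.grad_sub {w w' : VField} (hw : IsTest w) (hw' : IsTest w') (p : ℝ × ℝ) (i j : Fin 2) :
    grad (w - w') p i j = grad w p i j - grad w' p i j := by
  simp only [grad]
  rw [fderiv_sub (hw.smoothCompact.smooth.differentiable (by simp) p)
    (hw'.smoothCompact.smooth.differentiable (by simp) p)]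
  simp

theorem IsTest.isBump_grad {w : VField} (hw : IsTest w) (i j : Fin 2) :
    IsBump fun p => grad w p i j :=
  (hw.deriv i).isBump j

theorem IsTest.hardy {w : VField} (hw : IsTest w) (j : Fin 2) :
    eLpNorm (fun p => w p j / p.2) 2 volΩ ≤ 2 * eLpNorm (fun p => grad w p 1 j) 2 volΩ := by
  have := (hw.isBump j).hardy
  rwa [funext (hw.pd_eq_grad 1 j)] at this

/-! ### Hardy's inequality transferred to the energy space -/

/-- Approximation of an element of the energy space, with convergence in the weighted space given by
Hardy's inequality. -/
structure EnergyApprox (u : VField) (G : MField) (w : ℕ → VField) : Prop where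
  test : ∀ n, IsTest (w n)
  memLp_grad : ∀ i j, MemLp (fun p => G p i j) 2 volΩ
  memLp_div : ∀ j, MemLp (fun p => u p j / p.2) 2 volΩ
  tendsto_grad : ∀ i j, Tendsto (fun n => eLpNorm (fun p => grad (w n) p i j - G p i j) 2 volΩ)
    atTop (𝓝 0)
  tendsto_div : ∀ j, Tendsto (fun n => eLpNorm (fun p => w n p j / p.2 - u p j / p.2) 2 volΩ)
    atTop (𝓝 0)

theorem memLp_of_tendsto {X : Type*} [MeasurableSpace X] {μ : Measure X} {g : X → ℝ}
    {G : ℕ → X → ℝ} (hg : AEStronglyMeasurable g μ) (hG : ∀ n, MemLp (G n) 2 μ)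
    (h : Tendsto (fun n => eLpNorm (fun x => G n x - g x) 2 μ) atTop (𝓝 0)) : MemLp g 2 μ := by
  obtain ⟨n, hn⟩ := (h.eventually (gt_mem_nhds ENNReal.zero_lt_top)).exists
  have h1 : MemLp (fun x => G n x - g x) 2 μ := ⟨(hG n).1.sub hg, hn⟩
  refine ((hG n).sub h1).ae_eq (Eventually.of_forall fun x => ?_)
  simp

/-- Hardy's inequality applied to differences `w n - w m` bounds them in the weighted norm by their
gradients. Local convergence identifies the limit in `m` as `u` on each compact set, with a bound
independent of that set. -/
theorem MemDWith.exists_energyApprox {u : VField} {G : MField} (hu : MemDWith u G) :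
    ∃ w, EnergyApprox u G w := by
  obtain ⟨w, hw, hg, hK⟩ := hu.approx
  have mG : ∀ i j, MemLp (fun p => G p i j) 2 volΩ := fun i j =>
    memLp_of_tendsto (hu.measGrad i j) (fun n => ((hw n).isBump_grad i j).memLp volΩ) (hg i j)
  have mu' : ∀ j, AEStronglyMeasurable (fun p => u p j / p.2) volΩ := fun j =>
    ((hu.meas j).aemeasurable.div measurable_snd.aemeasurable).aestronglyMeasurable
  have key : ∀ n j, eLpNorm (fun p => w n p j / p.2 - u p j / p.2) 2 volΩ
      ≤ 2 * eLpNorm (fun p => grad (w n) p 1 j - G p 1 j) 2 volΩ := by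
    intro n j
    refine eLpNorm_Omega_le fun K hKc hKs => ?_
    have hμ : volume.restrict K ≤ volΩ := Measure.restrict_mono hKs le_rfl
    -- Hardy's inequality is known for test fields only, so `u` is reached through the intermediate
    -- field `w m`, and then `m → ∞`.
    have hm : ∀ m, eLpNorm (fun p => w n p j / p.2 - u p j / p.2) 2 (volume.restrict K)
        ≤ 2 * (eLpNorm (fun p => grad (w n) p 1 j - G p 1 j) 2 volΩ
          + eLpNorm (fun p => grad (w m) p 1 j - G p 1 j) 2 volΩ)
          + eLpNorm (fun p => w m p j - u p j) 2 (volume.restrict K) := by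
      intro m
      have hnm := (hw n).sub (hw m)
      have e1 : (fun p => w n p j / p.2 - u p j / p.2)
          = (fun p => (w n - w m) p j / p.2) + fun p : ℝ × ℝ => (w m p j - u p j) / p.2 := by
        ext p
        simp only [Pi.add_apply, Pi.sub_apply]
        ring
      have m1 : AEStronglyMeasurable (fun p => (w n - w m) p j / p.2) (volume.restrict K) :=
        ((hnm.isBump j).memLp_div.1).mono_measure hμ
      have m2 : AEStronglyMeasurable (fun p => (w m p j - u p j) / p.2) (volume.restrict K) := by
        have : AEStronglyMeasurable (fun p => w m p j / p.2 - u p j / p.2) volΩ :=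
          ((hw m).isBump j).memLp_div.1.sub (mu' j)
        refine (this.mono_measure hμ).congr (Eventually.of_forall fun p => ?_)
        simp only
        ring
      rw [e1]
      refine (eLpNorm_add_le m1 m2 (by norm_num)).trans (add_le_add ?_ ?_)
      · refine (eLpNorm_mono_measure _ hμ).trans ((hnm.hardy j).trans ?_)
        gcongr
        have e2 : (fun p => grad (w n - w m) p 1 j) = (fun p => grad (w n) p 1 j - G p 1 j)
            - fun p => grad (w m) p 1 j - G p 1 j := by
          ext p
          simp only [Pi.sub_apply, (hw n).grad_sub (hw m)]
          ring
        rw [e2]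
        exact eLpNorm_sub_le ((((hw n).isBump_grad 1 j).memLp volΩ).1.sub (mG 1 j).1)
          ((((hw m).isBump_grad 1 j).memLp volΩ).1.sub (mG 1 j).1) (by norm_num)
      · refine eLpNorm_mono_ae ?_
        filter_upwards [ae_restrict_mem hKc.measurableSet] with p hp
        have : 1 < p.2 := hKs hp
        rw [norm_div]
        refine div_le_self (norm_nonneg _) ?_
        rw [Real.norm_eq_abs]
        exact this.le.trans (le_abs_self _)
    have hlim : Tendsto (fun m => 2 * (eLpNorm (fun p => grad (w n) p 1 j - G p 1 j) 2 volΩ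
          + eLpNorm (fun p => grad (w m) p 1 j - G p 1 j) 2 volΩ)
          + eLpNorm (fun p => w m p j - u p j) 2 (volume.restrict K)) atTop
        (𝓝 (2 * (eLpNorm (fun p => grad (w n) p 1 j - G p 1 j) 2 volΩ + 0) + 0)) :=
      (ENNReal.Tendsto.const_mul (tendsto_const_nhds.add (hg 1 j)) (Or.inr (by norm_num))).add
        (hK K hKc hKs j)
    rw [add_zero, add_zero] at hlim
    exact ge_of_tendsto' hlim hm
  have htd : ∀ j, Tendsto (fun n => eLpNorm (fun p => w n p j / p.2 - u p j / p.2) 2 volΩ)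
      atTop (𝓝 0) := fun j => by
    have h0 := ENNReal.Tendsto.const_mul (a := 2) (hg 1 j) (Or.inr (by norm_num))
    rw [mul_zero] at h0
    exact tendsto_of_tendsto_of_tendsto_of_le_of_le tendsto_const_nhds h0 (fun _ => zero_le)
      fun n => key n j
  exact ⟨w, hw, mG, fun j => memLp_of_tendsto (mu' j) (fun n => ((hw n).isBump j).memLp_div) (htd j),
    hg, htd⟩

theorem EnergyApprox.hardy {u : VField} {G : MField} {w : ℕ → VField} (h : EnergyApprox u G w)
    (j : Fin 2) : eLpNorm (fun p => u p j / p.2) 2 volΩ ≤ 2 * eLpNorm (fun p => G p 1 j) 2 volΩ := by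
  have hle : ∀ n, eLpNorm (fun p => u p j / p.2) 2 volΩ
      ≤ eLpNorm (fun p => w n p j / p.2 - u p j / p.2) 2 volΩ
        + 2 * (eLpNorm (fun p => grad (w n) p 1 j - G p 1 j) 2 volΩ
          + eLpNorm (fun p => G p 1 j) 2 volΩ) := by
    intro n
    have hwn := ((h.test n).isBump j).memLp_div
    have hgn := ((h.test n).isBump_grad 1 j).memLp volΩ
    have e1 : (fun p => u p j / p.2) = (fun p => w n p j / p.2)
        - fun p : ℝ × ℝ => w n p j / p.2 - u p j / p.2 := by
      ext p
      simp
    have e2 : (fun p => grad (w n) p 1 j) = (fun p => grad (w n) p 1 j - G p 1 j)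
        + fun p => G p 1 j := by
      ext p
      simp
    calc eLpNorm (fun p => u p j / p.2) 2 volΩ
        ≤ eLpNorm (fun p => w n p j / p.2) 2 volΩ
          + eLpNorm (fun p : ℝ × ℝ => w n p j / p.2 - u p j / p.2) 2 volΩ := by
          rw [e1]
          exact eLpNorm_sub_le hwn.1 (hwn.1.sub (h.memLp_div j).1) (by norm_num)
      _ ≤ 2 * eLpNorm (fun p => grad (w n) p 1 j) 2 volΩ
          + eLpNorm (fun p : ℝ × ℝ => w n p j / p.2 - u p j / p.2) 2 volΩ := by
          gcongr
          exact (h.test n).hardy j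
      _ ≤ _ := by
          rw [add_comm]
          gcongr
          conv_lhs => rw [e2]
          exact eLpNorm_add_le (hgn.1.sub (h.memLp_grad 1 j).1) (h.memLp_grad 1 j).1 (by norm_num)
  have hlim := (h.tendsto_div j).add (ENNReal.Tendsto.const_mul (a := 2)
    ((h.tendsto_grad 1 j).add (tendsto_const_nhds (x := eLpNorm (fun p => G p 1 j) 2 volΩ)))
    (Or.inr (by norm_num)))
  rw [zero_add, zero_add] at hlim
  exact ge_of_tendsto' hlim hle

end HalfPlaneNS

end

noncomputable section

namespace HalfPlaneNS

open MeasureTheory Filter Real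
open scoped Convolution ContDiff

/-! ### Mollification -/

/-- Bump functions concentrating at the origin. -/
def shrinkingBump (n : ℕ) : ContDiffBump (0 : ℝ × ℝ) :=
  ⟨1 / (2 * ((n : ℝ) + 1)), 1 / ((n : ℝ) + 1), by positivity,
    one_div_lt_one_div_of_lt (by positivity) (by linarith [(n.cast_nonneg : (0 : ℝ) ≤ n)])⟩

/-- The convolution with the normalized bump functions. -/
def mollify (n : ℕ) (g : ℝ × ℝ → ℝ) : ℝ × ℝ → ℝ :=
  (shrinkingBump n).normed volume ⋆[ContinuousLinearMap.lsmul ℝ ℝ, volume] g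

theorem contDiff_mollify {g : ℝ × ℝ → ℝ} (hg : Continuous g) (n : ℕ) :
    ContDiff ℝ ∞ (mollify n g) :=
  (shrinkingBump n).hasCompactSupport_normed.contDiff_convolution_left _
    (shrinkingBump n).contDiff_normed hg.locallyIntegrable

/-- The derivative falls on the rough factor rather than on the kernel, so convergence of mollified
derivatives reduces to convergence of mollifications. -/
theorem pd_mollify {g : ℝ × ℝ → ℝ} (hg : ContDiff ℝ 1 g) (hc : HasCompactSupport g) (i : Fin 2)
    (n : ℕ) : pd i (mollify n g) = mollify n (pd i g) := by
  have hl : LocallyIntegrable ((shrinkingBump n).normed (volume : Measure (ℝ × ℝ))) :=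
    (shrinkingBump n).continuous_normed.locallyIntegrable
  ext p
  rw [pd, mollify, (hc.hasFDerivAt_convolution_right _ hl hg p).fderiv,
    convolution_precompR_apply _ hl (hc.fderiv ℝ) (hg.continuous_fderiv one_ne_zero)]
  rfl

theorem tendsto_rOut_shrinkingBump : Tendsto (fun n => (shrinkingBump n).rOut) atTop (𝓝 0) :=
  tendsto_one_div_add_atTop_nhds_zero_nat

theorem eventually_tsupport_mollify {g : ℝ × ℝ → ℝ} {r : ℝ} (hr : 0 < r) :
    ∀ᶠ n in atTop, tsupport (mollify n g) ⊆ Metric.cthickening r (tsupport g) := by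
  filter_upwards [tendsto_rOut_shrinkingBump.eventually (gt_mem_nhds hr)] with n hn
  refine closure_minimal ?_ Metric.isClosed_cthickening
  refine (support_convolution_subset _).trans ?_
  rintro _ ⟨a, ha, b, hb, rfl⟩
  rw [ContDiffBump.support_normed_eq, mem_ball_zero_iff] at ha
  refine Metric.mem_cthickening_of_dist_le _ b _ _ (subset_tsupport _ hb) ?_
  rw [dist_eq_norm, add_sub_cancel_right]
  exact (ha.trans hn).le

theorem eventually_mollify_sub_le {g : ℝ × ℝ → ℝ} (hg : Continuous g) (hc : HasCompactSupport g)
    {ε : ℝ} (hε : 0 < ε) : ∀ᶠ n in atTop, ∀ p, |mollify n g p - g p| ≤ ε := by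
  obtain ⟨δ, hδ, h⟩ := Metric.uniformContinuous_iff.1
    (hc.uniformContinuous_of_continuous hg) ε hε
  filter_upwards [tendsto_rOut_shrinkingBump.eventually (gt_mem_nhds hδ)] with n hn p
  refine (shrinkingBump n).dist_normed_convolution_le (μ := volume) (g := g)
    hg.aestronglyMeasurable fun x hx => (h ?_).le
  exact (Metric.mem_ball.1 hx).trans hn

/-- Mollification converges uniformly with the weight `y` and in `L²`. -/
theorem eventually_mollify_close {g : ℝ × ℝ → ℝ} (hg : Continuous g) (hc : HasCompactSupport g)
    {ε : ℝ} (hε : 0 < ε) : ∀ᶠ n in atTop, (∀ p ∈ Omega, p.2 * |mollify n g p - g p| ≤ ε) ∧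
      eLpNorm (fun p => mollify n g p - g p) 2 volΩ ≤ ENNReal.ofReal ε := by
  set K := Metric.cthickening 1 (tsupport g) with hK
  have hKc : IsCompact K := hc.isCompact.cthickening
  obtain ⟨B, hB⟩ := hKc.bddAbove_image (f := fun p : ℝ × ℝ => p.2) (by fun_prop)
  set B' := max B 0 + 1
  have hB' : 0 < B' := by positivity
  -- The added one makes `m` positive and ensures `volume K ≤ m²`, so the uniform error `ε / m` has
  -- `L²` norm at most `ε`.
  set m := (volume K).toReal + 1
  have hm : 0 < m := by positivity
  have hε1 : 0 < ε / B' := by positivity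
  have hε2 : 0 < ε / m := by positivity
  filter_upwards [eventually_tsupport_mollify (g := g) one_pos, eventually_mollify_sub_le hg hc hε1,
    eventually_mollify_sub_le hg hc hε2] with n h0 h1 h2
  have hz : ∀ p ∉ K, mollify n g p - g p = 0 := fun p hp => by
    rw [image_eq_zero_of_notMem_tsupport fun h => hp (h0 h),
      image_eq_zero_of_notMem_tsupport fun h => hp (Metric.self_subset_cthickening _ h), sub_zero]
  refine ⟨fun p hp => ?_, ?_⟩
  · by_cases hpK : p ∈ K
    · have hpB : p.2 ≤ B' := by
        have := hB ⟨p, hpK, rfl⟩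
        simp only at this
        linarith [le_max_left B 0]
      calc p.2 * |mollify n g p - g p| ≤ B' * (ε / B') :=
            mul_le_mul hpB (h1 p) (abs_nonneg _) hB'.le
        _ = ε := by field_simp
    · rw [hz p hpK, abs_zero, mul_zero]
      exact hε.le
  · rw [eLpNorm_two_le_iff]
    calc ∫⁻ p in Omega, ‖mollify n g p - g p‖ₑ ^ 2
        ≤ ∫⁻ p, ‖mollify n g p - g p‖ₑ ^ 2 := setLIntegral_le_lintegral _ _
      _ ≤ ∫⁻ p, K.indicator (fun _ => ENNReal.ofReal (ε / m) ^ 2) p := by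
          refine lintegral_mono fun p => ?_
          by_cases hpK : p ∈ K
          · rw [Set.indicator_of_mem hpK]
            gcongr
            rw [← ofReal_norm, Real.norm_eq_abs]
            exact ENNReal.ofReal_le_ofReal (h2 p)
          · rw [Set.indicator_of_notMem hpK, hz p hpK]
            simp
      _ = ENNReal.ofReal (ε / m) ^ 2 * volume K := by
          rw [lintegral_indicator_const hKc.measurableSet]
      _ ≤ ENNReal.ofReal (ε / m) ^ 2 * ENNReal.ofReal (m ^ 2) := by
          gcongr
          rw [← ENNReal.ofReal_toReal hKc.measure_lt_top.ne]
          refine ENNReal.ofReal_le_ofReal ?_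
          have : (0 : ℝ) ≤ (volume K).toReal := ENNReal.toReal_nonneg
          simp only [m]
          nlinarith
      _ = ENNReal.ofReal ε ^ 2 := by
          rw [← ENNReal.ofReal_pow hε2.le, ← ENNReal.ofReal_mul (by positivity),
            ← ENNReal.ofReal_pow hε.le]
          congr 1
          field_simp

theorem contDiff_pd_of_succ {g : ℝ × ℝ → ℝ} {n : ℕ} (hg : ContDiff ℝ (n + 1) g) (i : Fin 2) :
    ContDiff ℝ n (pd i g) :=
  (hg.fderiv_right le_rfl).clm_apply contDiff_const

/-- Approximation of the first and second derivatives of a `C²` function by those of smooth ones. -/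
theorem exists_isBump_close {S : ℝ × ℝ → ℝ} (hS : ContDiff ℝ 2 S) (hc : HasCompactSupport S)
    (hs : tsupport S ⊆ Omega) {ε : ℝ} (hε : 0 < ε) :
    ∃ h, IsBump h ∧ (∀ i, ∀ p ∈ Omega, p.2 * |pd i h p - pd i S p| ≤ ε) ∧
      (∀ i, eLpNorm (fun p => pd i h p - pd i S p) 2 volΩ ≤ ENNReal.ofReal ε) ∧
      ∀ i j, eLpNorm (fun p => pd i (pd j h) p - pd i (pd j S) p) 2 volΩ ≤ ENNReal.ofReal ε := by
  have h1 : ∀ i, ContDiff ℝ 1 (pd i S) := fun i => by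
    exact_mod_cast contDiff_pd_of_succ (n := 1) (by exact_mod_cast hS) i
  have h2 : ∀ i j, Continuous (pd i (pd j S)) := fun i j =>
    (contDiff_pd_of_succ (n := 0) (by exact_mod_cast h1 j) i).continuous
  obtain ⟨r, hr, hrΩ⟩ := hc.isCompact.exists_cthickening_subset_open isOpen_Omega hs
  have ev1 := fun i => eventually_mollify_close (h1 i).continuous (hasCompactSupport_pd hc i) hε
  have ev2 := fun i j => eventually_mollify_close (h2 i j)
    (hasCompactSupport_pd (hasCompactSupport_pd hc j) i) hε
  obtain ⟨n, ⟨hn0, hn1⟩, hn2⟩ := (((eventually_tsupport_mollify (g := S) hr).and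
    (eventually_all.2 ev1)).and (eventually_all.2 fun i => eventually_all.2 (ev2 i))).exists
  have e1 : ∀ i, pd i (mollify n S) = mollify n (pd i S) := fun i =>
    pd_mollify (hS.of_le (by norm_num)) hc i n
  have e2 : ∀ i j, pd i (pd j (mollify n S)) = mollify n (pd i (pd j S)) := fun i j => by
    rw [e1, pd_mollify (h1 j) (hasCompactSupport_pd hc j)]
  refine ⟨mollify n S, ⟨contDiff_mollify hS.continuous n,
    (hc.isCompact.cthickening (r := r)).of_isClosed_subset (isClosed_tsupport _) hn0,
    hn0.trans hrΩ⟩, fun i p hp => ?_, fun i => ?_, fun i j => ?_⟩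
  · rw [e1]
    exact (hn1 i).1 p hp
  · rw [e1]
    exact (hn1 i).2
  · rw [e2]
    exact (hn2 i j).2

/-! ### Solenoidal test fields from stream functions -/

/-- The solenoidal field with a given stream function. -/
def curlField (h : ℝ × ℝ → ℝ) : VField := fun p => ![pd 1 h p, -pd 0 h p]

theorem IsBump.isTest_curlField {h : ℝ × ℝ → ℝ} (hh : IsBump h) : IsTest (curlField h) := by
  have hsm : IsSmoothCompact (curlField h) := by
    have hsup : tsupport (curlField h) ⊆ tsupport h := closure_minimal (fun p hp => by
      by_contra hn
      refine hp ?_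
      ext j
      have h0 : ∀ i, HalfPlaneNS.pd i h p = 0 := fun i =>
        image_eq_zero_of_notMem_tsupport fun hm => hn (tsupport_pd_subset h i hm)
      fin_cases j <;> simp [curlField, h0]) (isClosed_tsupport h)
    refine ⟨contDiff_pi.2 fun j => ?_, hh.compact.of_isClosed_subset (isClosed_tsupport _) hsup,
      hsup.trans hh.support⟩
    fin_cases j
    · exact (hh.pd 1).smooth
    · exact (hh.pd 0).smooth.neg
  refine ⟨hsm, fun p => ?_⟩
  have hd := hasFDerivAt_pi'.1 (hsm.smooth.differentiable (by simp) p).hasFDerivAt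
  have e : ∀ i j, grad (curlField h) p i j = HalfPlaneNS.pd i (fun q => curlField h q j) p :=
    fun i j => by
      rw [HalfPlaneNS.pd, (hd j).fderiv]
      rfl
  rw [e, e]
  have e1 : HalfPlaneNS.pd 1 (fun q => -HalfPlaneNS.pd 0 h q) p
      = -HalfPlaneNS.pd 1 (HalfPlaneNS.pd 0 h) p := by
    rw [HalfPlaneNS.pd, fderiv_fun_neg]
    rfl
  have := pd_comm hh 0 1 p
  simp only [curlField, Matrix.cons_val_zero, Matrix.cons_val_one, e1]
  linarith

end HalfPlaneNS

end

noncomputable section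

namespace HalfPlaneNS

open MeasureTheory Filter Real
open scoped ContDiff

/-! ### Scale-invariant cutoff functions -/

/-- Bounds on a smooth function and its first two derivatives which are invariant under dilations. -/
structure ScaleBound (C : ℝ) (f : ℝ → ℝ) : Prop where
  smooth : ContDiff ℝ ∞ f
  bound_zero : ∀ s, |f s| ≤ C
  bound_one : ∀ s, |s * deriv f s| ≤ C
  bound_two : ∀ s, |s ^ 2 * deriv (deriv f) s| ≤ C

theorem contDiff_deriv_top {f : ℝ → ℝ} (hf : ContDiff ℝ ∞ f) : ContDiff ℝ ∞ (deriv f) :=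
  ((contDiff_succ_iff_deriv (n := ∞)).1 (by simpa using hf)).2.2

/-- Since `f'` has compact support, `s f'` and `s² f''` are continuous with compact support, hence
bounded. Constancy near infinity is allowed for `f` itself. -/
theorem exists_scaleBound {f : ℝ → ℝ} (hf : ContDiff ℝ ∞ f) (h1 : ∀ s, |f s| ≤ 1)
    (hc : HasCompactSupport (deriv f)) :
    ∃ C, ScaleBound C f ∧ (∀ s, |deriv f s| ≤ C) ∧ ∀ s, |deriv (deriv f) s| ≤ C := by
  have c1 := (contDiff_deriv_top hf).continuous
  have c2 := (contDiff_deriv_top (contDiff_deriv_top hf)).continuous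
  obtain ⟨A, hA⟩ := (hc.mul_left (f := fun s => s)).exists_bound_of_continuous (by fun_prop)
  obtain ⟨B, hB⟩ := (hc.deriv.mul_left (f := fun s => s ^ 2)).exists_bound_of_continuous (by fun_prop)
  obtain ⟨D, hD⟩ := hc.exists_bound_of_continuous c1
  obtain ⟨E, hE⟩ := hc.deriv.exists_bound_of_continuous c2
  have hA0 := (norm_nonneg _).trans (hA 0)
  have hB0 := (norm_nonneg _).trans (hB 0)
  have hD0 := (norm_nonneg _).trans (hD 0)
  have hE0 := (norm_nonneg _).trans (hE 0)
  refine ⟨1 + A + B + D + E, ⟨hf, fun s => (h1 s).trans (by linarith),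
    fun s => (hA s).trans (by linarith), fun s => (hB s).trans (by linarith)⟩,
    fun s => (hD s).trans (by linarith), fun s => (hE s).trans (by linarith)⟩

theorem deriv_dilate (f : ℝ → ℝ) (c : ℝ) :
    deriv (fun s => f (c * s)) = fun s => c * deriv f (c * s) := by
  ext s
  rw [deriv_comp_mul_left, smul_eq_mul]

theorem deriv_deriv_dilate (f : ℝ → ℝ) (c : ℝ) :
    deriv (deriv fun s => f (c * s)) = fun s => c ^ 2 * deriv (deriv f) (c * s) := by
  ext s
  rw [deriv_dilate, deriv_const_mul_field, deriv_comp_mul_left, smul_eq_mul]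
  ring

theorem ScaleBound.dilate {C : ℝ} {f : ℝ → ℝ} (hf : ScaleBound C f) (c : ℝ) :
    ScaleBound C fun s => f (c * s) := by
  refine ⟨hf.smooth.comp (by fun_prop), fun s => hf.bound_zero _, fun s => ?_, fun s => ?_⟩
  · rw [deriv_dilate]
    convert hf.bound_one (c * s) using 2
    ring
  · rw [deriv_deriv_dilate]
    convert hf.bound_two (c * s) using 2
    ring

/-- The factor `4` is the sum `1 + 2 + 1` of the coefficients in Leibniz' rule for the second
derivative. -/
theorem ScaleBound.mul {C D : ℝ} {f g : ℝ → ℝ} (hf : ScaleBound C f) (hg : ScaleBound D g) :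
    ScaleBound (4 * (C * D)) fun s => f s * g s := by
  have hC : 0 ≤ C := (abs_nonneg _).trans (hf.bound_zero 0)
  have hD : 0 ≤ D := (abs_nonneg _).trans (hg.bound_zero 0)
  have hCD : 0 ≤ C * D := mul_nonneg hC hD
  have df := fun s => (hf.smooth.differentiable (by simp) s).hasDerivAt
  have dg := fun s => (hg.smooth.differentiable (by simp) s).hasDerivAt
  have df' := fun s => ((contDiff_deriv_top hf.smooth).differentiable (by simp) s).hasDerivAt
  have dg' := fun s => ((contDiff_deriv_top hg.smooth).differentiable (by simp) s).hasDerivAt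
  have e1 : deriv (fun s => f s * g s) = fun s => deriv f s * g s + f s * deriv g s :=
    funext fun s => ((df s).mul (dg s)).deriv
  have hm : ∀ {a b : ℝ}, |a| ≤ C → |b| ≤ D → |a * b| ≤ C * D := fun ha hb => by
    rw [abs_mul]
    exact mul_le_mul ha hb (abs_nonneg _) hC
  refine ⟨hf.smooth.mul hg.smooth, fun s => ?_, fun s => ?_, fun s => ?_⟩
  · linarith [hm (hf.bound_zero s) (hg.bound_zero s)]
  · rw [e1]
    have h1 := hm (hf.bound_one s) (hg.bound_zero s)
    have h2 := hm (hf.bound_zero s) (hg.bound_one s)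
    have := abs_add_le (s * deriv f s * g s) (f s * (s * deriv g s))
    rw [show s * (deriv f s * g s + f s * deriv g s)
      = s * deriv f s * g s + f s * (s * deriv g s) by ring]
    linarith
  · have e2 : deriv (deriv fun s => f s * g s) s = (deriv (deriv f) s * g s + deriv f s * deriv g s)
        + (deriv f s * deriv g s + f s * deriv (deriv g) s) := by
      rw [e1]
      exact (((df' s).mul (dg s)).add ((df s).mul (dg' s))).deriv
    rw [e2]
    have h1 := hm (hf.bound_two s) (hg.bound_zero s)
    have h2 := hm (hf.bound_one s) (hg.bound_one s)
    have h3 := hm (hf.bound_zero s) (hg.bound_two s)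
    rw [show s ^ 2 * ((deriv (deriv f) s * g s + deriv f s * deriv g s)
        + (deriv f s * deriv g s + f s * deriv (deriv g) s))
      = s ^ 2 * deriv (deriv f) s * g s + (s * deriv f s * (s * deriv g s)
        + s * deriv f s * (s * deriv g s)) + f s * (s ^ 2 * deriv (deriv g) s) by ring]
    refine (abs_add_three _ _ _).trans ?_
    linarith [abs_add_le (s * deriv f s * (s * deriv g s)) (s * deriv f s * (s * deriv g s))]

/-- A smooth function vanishing for `s ≤ 1` and equal to `1` for `s ≥ 2`. -/
def riseFun (s : ℝ) : ℝ := smoothTransition (s - 1)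

/-- A smooth function equal to `1` for `s ^ 2 ≤ 1` and vanishing for `s ^ 2 ≥ 2`. -/
def plateauFun (s : ℝ) : ℝ := smoothTransition (2 - s ^ 2)

theorem contDiff_riseFun : ContDiff ℝ ∞ riseFun :=
  smoothTransition.contDiff.comp (by fun_prop)

theorem contDiff_plateauFun : ContDiff ℝ ∞ plateauFun :=
  smoothTransition.contDiff.comp (by fun_prop)

theorem hasCompactSupport_deriv_riseFun : HasCompactSupport (deriv riseFun) := by
  refine HasCompactSupport.intro (isCompact_Icc (a := 1) (b := 2)) fun s hs => ?_
  rcases lt_or_ge s 1 with h | h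
  · have : riseFun =ᶠ[𝓝 s] fun _ => 0 := by
      filter_upwards [gt_mem_nhds h] with t ht
      exact smoothTransition.zero_of_nonpos (by linarith)
    rw [this.deriv_eq, deriv_const]
  · have h2 : 2 < s := by
      by_contra hn
      exact hs ⟨h, not_lt.1 hn⟩
    have : riseFun =ᶠ[𝓝 s] fun _ => 1 := by
      filter_upwards [lt_mem_nhds h2] with t ht
      exact smoothTransition.one_of_one_le (by linarith)
    rw [this.deriv_eq, deriv_const]

theorem plateauFun_eq_zero {s : ℝ} (hs : 2 ≤ s ^ 2) : plateauFun s = 0 :=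
  smoothTransition.zero_of_nonpos (by linarith)

theorem hasCompactSupport_plateauFun : HasCompactSupport plateauFun := by
  refine HasCompactSupport.intro (isCompact_Icc (a := -2) (b := 2)) fun s hs => ?_
  refine plateauFun_eq_zero ?_
  by_contra h
  exact hs ⟨by nlinarith, by nlinarith⟩

theorem pd_tensor {c d : ℝ → ℝ} (hc : ContDiff ℝ ∞ c) (hd : ContDiff ℝ ∞ d) :
    (pd 0 fun p => c (p.2 - 1) * d p.1) = (fun p => c (p.2 - 1) * deriv d p.1) ∧
    (pd 1 fun p => c (p.2 - 1) * d p.1) = fun p => deriv c (p.2 - 1) * d p.1 := by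
  have key : ∀ p : ℝ × ℝ, HasFDerivAt (fun p : ℝ × ℝ => c (p.2 - 1) * d p.1)
      (coordR (c (p.2 - 1) * deriv d p.1) (deriv c (p.2 - 1) * d p.1)) p := by
    intro p
    have h1 := (hc.differentiable (by simp) (p.2 - 1)).hasDerivAt.hasFDerivAt.comp p
      ((hasFDerivAt_snd (𝕜 := ℝ) (p := p)).sub_const 1)
    have h2 := (hd.differentiable (by simp) p.1).hasDerivAt.hasFDerivAt.comp p
      (hasFDerivAt_fst (𝕜 := ℝ) (p := p))
    refine (h1.mul h2).congr_fderiv ?_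
    ext <;> simp [coordR, mul_comm]
  exact ⟨funext fun p => HasFDerivAt.pd_zero (key p), funext fun p => HasFDerivAt.pd_one (key p)⟩

/-! ### Cutoffs adapted to the distance from the wall -/

/-- Cutoff functions in the half-plane, with bounds on derivatives in terms of the distance to the
boundary. -/
structure IsCutoff (C : ℝ) (χ : ℝ × ℝ → ℝ) : Prop where
  isBump : IsBump χ
  abs_le : ∀ p, |χ p| ≤ C
  pd_le : ∀ i, ∀ p ∈ Omega, (p.2 - 1) * |pd i χ p| ≤ C
  pd_pd_le : ∀ i j, ∀ p ∈ Omega, (p.2 - 1) ^ 2 * |pd i (pd j χ) p| ≤ C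

/-- The profile in `y - 1` of the cutoff functions. -/
def profile (m s : ℝ) : ℝ := riseFun (m * s) * plateauFun (m⁻¹ * s)

/-- The cutoff functions. -/
def cutoff (m : ℝ) (p : ℝ × ℝ) : ℝ := profile m (p.2 - 1) * plateauFun (m⁻¹ * p.1)

theorem contDiff_profile (m : ℝ) : ContDiff ℝ ∞ (profile m) :=
  (contDiff_riseFun.comp (by fun_prop)).mul (contDiff_plateauFun.comp (by fun_prop))

theorem plateauFun_inv_mul_eq_zero {m s : ℝ} (hm : 0 < m) (hs : 2 * m ≤ |s|) :
    plateauFun (m⁻¹ * s) = 0 := by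
  refine plateauFun_eq_zero ?_
  have h1 : 2 ≤ |m⁻¹ * s| := by
    rw [abs_mul, abs_of_pos (inv_pos.2 hm)]
    have := mul_le_mul_of_nonneg_left hs (inv_pos.2 hm).le
    rwa [mul_comm 2 m, inv_mul_cancel_left₀ hm.ne'] at this
  rw [← sq_abs]
  nlinarith

theorem isBump_cutoff {m : ℝ} (hm : 0 < m) : IsBump (cutoff m) := by
  have hz : ∀ p, p ∉ Set.Icc (-(2 * m)) (2 * m) ×ˢ Set.Icc (1 + m⁻¹) (1 + 2 * m) →
      cutoff m p = 0 := by
    intro p hp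
    by_contra hne
    refine hp ⟨?_, ?_⟩
    · have h1 : plateauFun (m⁻¹ * p.1) ≠ 0 := right_ne_zero_of_mul hne
      rw [Set.mem_Icc, ← abs_le]
      by_contra hn
      exact h1 (plateauFun_inv_mul_eq_zero hm (not_le.1 hn).le)
    · have h1 : profile m (p.2 - 1) ≠ 0 := left_ne_zero_of_mul hne
      have h2 : riseFun (m * (p.2 - 1)) ≠ 0 := left_ne_zero_of_mul h1
      have h3 : plateauFun (m⁻¹ * (p.2 - 1)) ≠ 0 := right_ne_zero_of_mul h1
      constructor
      · by_contra hn
        refine h2 (smoothTransition.zero_of_nonpos ?_)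
        have : p.2 - 1 ≤ m⁻¹ := by linarith
        have := mul_le_mul_of_nonneg_left this hm.le
        rw [mul_inv_cancel₀ hm.ne'] at this
        linarith
      · by_contra hn
        exact h3 (plateauFun_inv_mul_eq_zero hm ((by linarith : _ ≤ p.2 - 1).trans (le_abs_self _)))
  have hK : IsCompact (Set.Icc (-(2 * m)) (2 * m) ×ˢ Set.Icc (1 + m⁻¹) (1 + 2 * m)) :=
    isCompact_Icc.prod isCompact_Icc
  refine ⟨((contDiff_profile m).comp (by fun_prop)).mul (contDiff_plateauFun.comp (by fun_prop)),
    HasCompactSupport.intro hK hz, (closure_minimal (fun p hp => ?_) hK.isClosed).trans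
      fun p hp => ?_⟩
  · by_contra hn
    exact hp (hz p hn)
  · have h1 : 1 + m⁻¹ ≤ p.2 := hp.2.1
    have h2 := inv_pos.2 hm
    show 1 < p.2
    linarith

/-- The point is that `C` does not depend on `m`. Derivatives in `y` are controlled by the
dilation-invariant bounds on the profile. Each derivative in `x` costs `m⁻¹`, and since `y - 1 ≤ 2m`
on the support, this too is paid for by one factor `y - 1`. -/
theorem exists_isCutoff : ∃ C, 0 ≤ C ∧ ∀ m, 0 < m → IsCutoff C (cutoff m) := by
  obtain ⟨A, hA, -, -⟩ := exists_scaleBound contDiff_riseFun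
    (fun s => by
      rw [riseFun, abs_of_nonneg (smoothTransition.nonneg _)]
      exact smoothTransition.le_one _) hasCompactSupport_deriv_riseFun
  obtain ⟨B, hB, hB1, hB2⟩ := exists_scaleBound contDiff_plateauFun
    (fun s => by
      rw [plateauFun, abs_of_nonneg (smoothTransition.nonneg _)]
      exact smoothTransition.le_one _) hasCompactSupport_plateauFun.deriv
  set D := 4 * (A * B)
  have hA0 : 0 ≤ A := (abs_nonneg _).trans (hA.bound_zero 0)
  have hB0 : 0 ≤ B := (abs_nonneg _).trans (hB.bound_zero 0)
  have hD0 : 0 ≤ D := by positivity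
  have hDB : 0 ≤ D * B := by positivity
  refine ⟨4 * (D * B), by positivity, fun m hm => ?_⟩
  have hP : ScaleBound D (profile m) := (hA.dilate m).mul (hB.dilate m⁻¹)
  have hQ : ContDiff ℝ ∞ fun x => plateauFun (m⁻¹ * x) := contDiff_plateauFun.comp (by fun_prop)
  have z0 : ∀ s, 2 * m < s → profile m s = 0 := fun s hs => by
    rw [profile, plateauFun_inv_mul_eq_zero hm (hs.le.trans (le_abs_self _)), mul_zero]
  have z1 : ∀ s, 2 * m < s → deriv (profile m) s = 0 := fun s hs => by
    have : profile m =ᶠ[𝓝 s] fun _ => 0 := by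
      filter_upwards [lt_mem_nhds hs] with t ht using z0 t ht
    rw [this.deriv_eq, deriv_const]
  have hdil : ∀ s, 0 < s → s ≤ 2 * m → s * m⁻¹ ≤ 2 := fun s _ hs => by
    rw [← div_eq_mul_inv, div_le_iff₀ hm]
    exact hs
  have mi := inv_pos.2 hm
  have q1 : ∀ s x, 0 < s → s ≤ 2 * m → |s * (m⁻¹ * deriv plateauFun (m⁻¹ * x))| ≤ 2 * B := by
    intro s x hs hs2
    rw [← mul_assoc, abs_mul, abs_of_nonneg (by positivity)]
    exact mul_le_mul (hdil s hs hs2) (hB1 _) (abs_nonneg _) (by norm_num)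
  have q2 : ∀ s x, 0 < s → s ≤ 2 * m →
      |s ^ 2 * (m⁻¹ ^ 2 * deriv (deriv plateauFun) (m⁻¹ * x))| ≤ 4 * B := by
    intro s x hs hs2
    rw [← mul_assoc, ← mul_pow, abs_mul, abs_of_nonneg (by positivity)]
    refine mul_le_mul ?_ (hB2 _) (abs_nonneg _) (by norm_num)
    have := hdil s hs hs2
    have h0 : 0 ≤ s * m⁻¹ := by positivity
    nlinarith
  have hm' : ∀ {a b c d : ℝ}, |a| ≤ c → |b| ≤ d → |a * b| ≤ c * d := fun ha hb => by
    rw [abs_mul]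
    exact mul_le_mul ha hb (abs_nonneg _) ((abs_nonneg _).trans ha)
  have hP' := contDiff_deriv_top (contDiff_profile m)
  have hQ' := contDiff_deriv_top hQ
  obtain ⟨e0, e1⟩ := pd_tensor (contDiff_profile m) hQ
  obtain ⟨e00, e10⟩ := pd_tensor (contDiff_profile m) hQ'
  obtain ⟨e01, e11⟩ := pd_tensor hP' hQ
  have f0 : pd 0 (cutoff m) = _ := e0
  have f1 : pd 1 (cutoff m) = _ := e1
  -- Above height `2m` the profile factor vanishes, so `y - 1 ≤ 2m` may be assumed when estimating
  -- `x`-derivatives.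
  have case : ∀ {s a b : ℝ}, (2 * m < s → a = 0) → (s ≤ 2 * m → |a * b| ≤ 4 * (D * B)) →
      |a * b| ≤ 4 * (D * B) := by
    intro s a b h0 h1
    rcases lt_or_ge (2 * m) s with h | h
    · rw [h0 h, zero_mul, abs_zero]
      positivity
    · exact h1 h
  have hs : ∀ p ∈ Omega, 0 < p.2 - 1 := fun p hp => sub_pos.2 hp
  have b00 : ∀ p ∈ Omega, (p.2 - 1) ^ 2 * |pd 0 (pd 0 (cutoff m)) p| ≤ 4 * (D * B) := by
    intro p hp
    rw [f0, e00, deriv_deriv_dilate, ← abs_of_nonneg (sq_nonneg (p.2 - 1)), ← abs_mul,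
      mul_left_comm]
    refine case (z0 _) fun h => (hm' (hP.bound_zero _) (q2 _ _ (hs p hp) h)).trans (le_of_eq ?_)
    ring
  have b01 : ∀ p ∈ Omega,
      (p.2 - 1) ^ 2 * |deriv (profile m) (p.2 - 1) * deriv (fun x => plateauFun (m⁻¹ * x)) p.1|
        ≤ 4 * (D * B) := by
    intro p hp
    rw [deriv_dilate, ← abs_of_nonneg (sq_nonneg (p.2 - 1)), ← abs_mul,
      show ∀ s a b : ℝ, s ^ 2 * (a * b) = (s * a) * (s * b) by intros; ring]
    refine case (fun h => by rw [z1 _ h, mul_zero]) fun h =>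
      (hm' (hP.bound_one _) (q1 _ _ (hs p hp) h)).trans ?_
    linarith
  have b11 : ∀ p ∈ Omega, (p.2 - 1) ^ 2 * |pd 1 (pd 1 (cutoff m)) p| ≤ 4 * (D * B) := by
    intro p hp
    rw [f1, e11, ← abs_of_nonneg (sq_nonneg (p.2 - 1)), ← abs_mul, ← mul_assoc]
    refine (hm' (hP.bound_two _) (hB.bound_zero _)).trans ?_
    linarith
  refine ⟨isBump_cutoff hm, fun p => ?_, fun i p hp => ?_, fun i j p hp => ?_⟩
  · refine (hm' (hP.bound_zero _) (hB.bound_zero _)).trans ?_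
    linarith
  · fin_cases i
    · simp only [Fin.zero_eta]
      rw [f0, deriv_dilate, ← abs_of_pos (hs p hp), ← abs_mul, mul_left_comm]
      refine case (z0 _) fun h => (hm' (hP.bound_zero _) (q1 _ _ (hs p hp) h)).trans ?_
      linarith
    · simp only [Fin.mk_one]
      rw [f1, ← abs_of_pos (hs p hp), ← abs_mul, ← mul_assoc]
      refine (hm' (hP.bound_one _) (hB.bound_zero _)).trans ?_
      linarith
  · fin_cases i <;> fin_cases j <;> simp only [Fin.zero_eta, Fin.mk_one]
    · exact b00 p hp
    · rw [f1, e01]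
      exact b01 p hp
    · rw [f0, e10]
      exact b01 p hp
    · exact b11 p hp

/-- Equality holds on a neighbourhood, not just at the point, so that derivatives of the cutoff
vanish there too. -/
theorem eventually_cutoff_eq_one {p : ℝ × ℝ} (hp : p ∈ Omega) :
    ∀ᶠ m : ℝ in atTop, cutoff m =ᶠ[𝓝 p] fun _ => 1 := by
  have hs : 0 < p.2 - 1 := sub_pos.2 hp
  filter_upwards [eventually_gt_atTop 0, eventually_gt_atTop (2 / (p.2 - 1)),
    eventually_gt_atTop (p.2 - 1), eventually_gt_atTop |p.1|] with m h0 h1 h2 h3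
  have g1 : 2 < m * (p.2 - 1) := (div_lt_iff₀ hs).1 h1
  have c1 : ∀ᶠ q : ℝ × ℝ in 𝓝 p, 2 < m * (q.2 - 1) :=
    (isOpen_lt continuous_const (by fun_prop)).mem_nhds g1
  have c2 : ∀ᶠ q : ℝ × ℝ in 𝓝 p, |q.2 - 1| < m :=
    (isOpen_lt (by fun_prop) continuous_const).mem_nhds (by simpa [abs_of_pos hs] using h2)
  have c3 : ∀ᶠ q : ℝ × ℝ in 𝓝 p, |q.1| < m :=
    (isOpen_lt (by fun_prop) continuous_const).mem_nhds h3
  have hpl : ∀ s, |s| < m → plateauFun (m⁻¹ * s) = 1 := fun s hs => by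
    refine smoothTransition.one_of_one_le ?_
    have h5 : |m⁻¹ * s| ≤ 1 := by
      rw [abs_mul, abs_of_pos (inv_pos.2 h0), inv_mul_le_iff₀ h0]
      linarith
    have h6 := (sq_le_one_iff_abs_le_one _).2 h5
    linarith
  filter_upwards [c1, c2, c3] with q q1 q2 q3
  rw [cutoff, profile, hpl _ q2, hpl _ q3, riseFun, smoothTransition.one_of_one_le (by linarith)]
  norm_num

end HalfPlaneNS

end

noncomputable section

namespace HalfPlaneNS

open MeasureTheory Filter Real

/-! ### Approximation of small flows by test fields -/

theorem tendsto_eLpNorm_two_of_dominated {X : Type*} [MeasurableSpace X] {μ : Measure X}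
    {F : ℕ → X → ℝ} {D : X → ℝ} (hF : ∀ n, AEStronglyMeasurable (F n) μ) (hD : MemLp D 2 μ)
    (hle : ∀ n, ∀ᵐ x ∂μ, |F n x| ≤ D x) (h0 : ∀ᵐ x ∂μ, Tendsto (fun n => F n x) atTop (𝓝 0)) :
    Tendsto (fun n => eLpNorm (F n) 2 μ) atTop (𝓝 0) := by
  have hint : ∫⁻ x, ‖D x‖ₑ ^ 2 ∂μ ≠ ∞ := by
    have h1 : eLpNorm D 2 μ ≤ eLpNorm D 2 μ := le_rfl
    exact ((eLpNorm_two_le_iff.1 h1).trans_lt (ENNReal.pow_lt_top hD.2)).ne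
  have h1 : Tendsto (fun n => ∫⁻ x, ‖F n x‖ₑ ^ 2 ∂μ) atTop (𝓝 (∫⁻ _, 0 ∂μ)) := by
    refine tendsto_lintegral_of_dominated_convergence' (fun x => ‖D x‖ₑ ^ 2)
      (fun n => (hF n).enorm.pow_const 2) (fun n => ?_) hint ?_
    · filter_upwards [hle n] with x hx
      gcongr
      rw [← ofReal_norm, ← ofReal_norm, Real.norm_eq_abs, Real.norm_eq_abs]
      exact ENNReal.ofReal_le_ofReal (hx.trans (le_abs_self _))
    · filter_upwards [h0] with x hx
      have := (ENNReal.continuous_pow 2).tendsto _ |>.comp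
        ((continuous_enorm.tendsto _).comp hx)
      simpa [Function.comp_def] using this
  rw [lintegral_zero] at h1
  have h2 : ∀ n, eLpNorm (F n) 2 μ = (∫⁻ x, ‖F n x‖ₑ ^ 2 ∂μ) ^ (1 / 2 : ℝ) := fun n => by
    rw [eLpNorm_eq_lintegral_rpow_enorm_toReal (by norm_num) (by norm_num)]
    simp only [ENNReal.toReal_ofNat, ENNReal.rpow_ofNat]
  simp_rw [h2]
  have h3 := (ENNReal.continuous_rpow_const (y := (1 / 2 : ℝ))).tendsto 0 |>.comp h1
  rwa [ENNReal.zero_rpow_of_pos (by norm_num)] at h3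

namespace HasGrad

variable {φ : ℝ × ℝ → ℝ} {g : Fin 2 → ℝ × ℝ → ℝ}

theorem pd_eq (h : HasGrad φ g) (i : Fin 2) {p : ℝ × ℝ} (hp : p ∈ Omega) : pd i φ p = g i p := by
  fin_cases i
  · exact HasFDerivAt.pd_zero (h.hasFDerivAt p hp)
  · exact HasFDerivAt.pd_one (h.hasFDerivAt p hp)

/-- Applied twice, starting from the continuity of `G`, it shows that the stream function is `C²`.
-/
theorem contDiffOn_succ (h : HasGrad φ g) {n : ℕ} (hg : ∀ i, ContDiffOn ℝ n (g i) Omega) :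
    ContDiffOn ℝ (n + 1) φ Omega := by
  refine (contDiffOn_succ_iff_fderiv_of_isOpen isOpen_Omega).2
    ⟨fun p hp => (h.hasFDerivAt p hp).differentiableAt.differentiableWithinAt,
      fun hn => absurd hn (by simp), ?_⟩
  refine ContDiffOn.congr (f := fun p => coordR (g 0 p) (g 1 p)) ?_
    fun p hp => (h.hasFDerivAt p hp).fderiv
  exact ((hg 0).smul contDiffOn_const).add ((hg 1).smul contDiffOn_const)

end HasGrad

theorem pd_congr {φ ψ : ℝ × ℝ → ℝ} {p : ℝ × ℝ} (h : φ =ᶠ[𝓝 p] ψ) (i : Fin 2) :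
    pd i φ =ᶠ[𝓝 p] pd i ψ := by
  filter_upwards [h.fderiv (𝕜 := ℝ)] with q hq
  rw [pd, pd, hq]

namespace SmallFlow

variable {M : ℝ} {U : VField} {G : MField} {Ψ : ℝ × ℝ → ℝ}

/-- The gradient of the stream function. -/
def streamGrad (U : VField) (i : Fin 2) (p : ℝ × ℝ) : ℝ := ![-U p 1, U p 0] i

/-- The second derivatives of the stream function. -/
def streamHess (G : MField) (i j : Fin 2) (p : ℝ × ℝ) : ℝ := ![-G p i 1, G p i 0] j

theorem hasGrad_stream (h : SmallFlow M U G Ψ) : HasGrad Ψ (streamGrad U) :=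
  ⟨h.stream, fun i => by
    fin_cases i
    · exact (h.contU 1).neg
    · exact h.contU 0⟩

theorem hasGrad_streamGrad (h : SmallFlow M U G Ψ) (j : Fin 2) :
    HasGrad (streamGrad U j) fun i => streamHess G i j := by
  fin_cases j
  · refine ⟨fun p hp => ((h.hasFDerivAt 1 p hp).neg).congr_fderiv ?_, fun i => (h.contG i 1).neg⟩
    ext <;> simp [coordR, streamHess]
  · exact ⟨h.hasFDerivAt 0, fun i => h.contG i 0⟩

theorem memLp_streamGrad (h : SmallFlow M U G Ψ) (j : Fin 2) : MemLp (streamGrad U j) 2 volΩ := by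
  fin_cases j
  · exact (h.memLp_U 1).neg
  · exact h.memLp_U 0

theorem memLp_streamGrad_div (h : SmallFlow M U G Ψ) (j : Fin 2) :
    MemLp (fun p => streamGrad U j p / (p.2 - 1)) 2 volΩ := by
  fin_cases j
  · refine (h.memLp_U_div 1).neg.ae_eq (Eventually.of_forall fun p => ?_)
    simp [streamGrad, neg_div]
  · exact h.memLp_U_div 0

theorem memLp_streamHess (h : SmallFlow M U G Ψ) (i j : Fin 2) :
    MemLp (streamHess G i j) 2 volΩ := by
  fin_cases j
  · exact (h.memLp_G i 1).neg
  · exact h.memLp_G i 0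

theorem mul_abs_streamGrad_le (h : SmallFlow M U G Ψ) (j : Fin 2) {p : ℝ × ℝ} (hp : p ∈ Omega) :
    p.2 * |streamGrad U j p| ≤ M := by
  fin_cases j
  · simpa [streamGrad] using h.bound 1 p hp
  · exact h.bound 0 p hp

variable {C : ℝ} {χ : ℝ × ℝ → ℝ}

theorem pd_mul_stream (h : SmallFlow M U G Ψ) (hχ : IsBump χ) (j : Fin 2) {p : ℝ × ℝ}
    (hp : p ∈ Omega) : pd j (fun p => χ p * Ψ p) p = pd j χ p * Ψ p + χ p * streamGrad U j p :=
  (hχ.hasGrad.mul h.hasGrad_stream).pd_eq j hp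

theorem pd_pd_mul_stream (h : SmallFlow M U G Ψ) (hχ : IsBump χ) (i j : Fin 2) {p : ℝ × ℝ}
    (hp : p ∈ Omega) : pd i (pd j fun p => χ p * Ψ p) p
      = (pd i (pd j χ) p * Ψ p + pd j χ p * streamGrad U i p)
        + (pd i χ p * streamGrad U j p + χ p * streamHess G i j p) := by
  have h1 : (pd j fun p => χ p * Ψ p) =ᶠ[𝓝 p]
      fun p => pd j χ p * Ψ p + χ p * streamGrad U j p := by
    filter_upwards [isOpen_Omega.mem_nhds hp] with q hq using h.pd_mul_stream hχ j hq
  rw [(pd_congr h1 i).eq_of_nhds]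
  exact (((hχ.pd j).hasGrad.mul h.hasGrad_stream).add
    (hχ.hasGrad.mul (h.hasGrad_streamGrad j))).pd_eq i hp

theorem contDiff_mul_stream (h : SmallFlow M U G Ψ) (hχ : IsBump χ) :
    ContDiff ℝ 2 (fun p => χ p * Ψ p) ∧ HasCompactSupport (fun p => χ p * Ψ p) ∧
      tsupport (fun p => χ p * Ψ p) ⊆ Omega := by
  have hΨ : ContDiffOn ℝ 2 Ψ Omega := by
    have h1 : ∀ i, ContDiffOn ℝ 1 (streamGrad U i) Omega := fun i => by
      have := (h.hasGrad_streamGrad i).contDiffOn_succ (n := 0)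
        fun k => by simpa using (h.hasGrad_streamGrad i).cont k
      simpa using this
    have := h.hasGrad_stream.contDiffOn_succ (n := 1) fun i => by exact_mod_cast h1 i
    exact_mod_cast this
  have hs : tsupport (fun p => χ p * Ψ p) ⊆ tsupport χ :=
    closure_mono (Function.support_mul_subset_left χ Ψ)
  refine ⟨contDiff_iff_contDiffAt.2 fun p => ?_, hχ.compact.mul_right, hs.trans hχ.support⟩
  by_cases hp : p ∈ tsupport χ
  · exact (hχ.smooth.contDiffAt.of_le (WithTop.coe_le_coe.2 (le_top : (2 : ℕ∞) ≤ ⊤))).mul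
      (hΨ.contDiffAt (isOpen_Omega.mem_nhds (hχ.support hp)))
  · refine (contDiffAt_const (c := (0 : ℝ))).congr_of_eventuallyEq ?_
    filter_upwards [(isClosed_tsupport χ).isOpen_compl.mem_nhds hp] with q hq
    rw [image_eq_zero_of_notMem_tsupport hq, zero_mul]

/-- A bound free of the cutoff parameter: a derivative falling on `χ` becomes a division by `y - 1`.
The right side is square integrable and serves as a dominating function. -/
theorem abs_pd_sub_le (h : SmallFlow M U G Ψ) (hχ : IsCutoff C χ) (j : Fin 2) {p : ℝ × ℝ}
    (hp : p ∈ Omega) : |pd j (fun p => χ p * Ψ p) p - streamGrad U j p|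
      ≤ C * |Ψ p / (p.2 - 1)| + (C + 1) * |streamGrad U j p| := by
  have hs : 0 < p.2 - 1 := sub_pos.2 hp
  rw [h.pd_mul_stream hχ.isBump j hp, show ∀ a b c d : ℝ, a * b + c * d - d = a * b + (c * d - d) by
    intros; ring]
  refine (abs_add_le _ _).trans (add_le_add ?_ ?_)
  · rw [abs_mul, abs_div, abs_of_pos hs, ← mul_div_assoc, le_div_iff₀ hs]
    nlinarith [hχ.pd_le j p hp, abs_nonneg (Ψ p)]
  · refine (abs_sub _ _).trans ?_
    rw [abs_mul]
    nlinarith [hχ.abs_le p, abs_nonneg (streamGrad U j p)]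

/-- The same at second order; two derivatives on `χ` cost `(y - 1)²`, which the quadratic vanishing
of the stream function at the wall compensates. -/
theorem abs_pd_pd_sub_le (h : SmallFlow M U G Ψ) (hχ : IsCutoff C χ) (i j : Fin 2) {p : ℝ × ℝ}
    (hp : p ∈ Omega) : |pd i (pd j fun p => χ p * Ψ p) p - streamHess G i j p|
      ≤ (C * |Ψ p / (p.2 - 1) ^ 2| + C * |streamGrad U i p / (p.2 - 1)|)
        + (C * |streamGrad U j p / (p.2 - 1)| + (C + 1) * |streamHess G i j p|) := by
  have hs : 0 < p.2 - 1 := sub_pos.2 hp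
  have hk : ∀ k l, |pd k χ p * streamGrad U l p| ≤ C * |streamGrad U l p / (p.2 - 1)| := by
    intro k l
    rw [abs_mul, abs_div, abs_of_pos hs, ← mul_div_assoc, le_div_iff₀ hs]
    nlinarith [hχ.pd_le k p hp, abs_nonneg (streamGrad U l p)]
  rw [h.pd_pd_mul_stream hχ.isBump i j hp, add_sub_assoc, add_sub_assoc]
  refine (abs_add_le _ _).trans (add_le_add ((abs_add_le _ _).trans (add_le_add ?_ (hk j i)))
    ((abs_add_le _ _).trans (add_le_add (hk i j) ?_)))
  · rw [abs_mul, abs_div, abs_of_pos (pow_pos hs 2), ← mul_div_assoc, le_div_iff₀ (pow_pos hs 2)]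
    nlinarith [hχ.pd_pd_le i j p hp, abs_nonneg (Ψ p)]
  · refine (abs_sub _ _).trans ?_
    rw [abs_mul]
    nlinarith [hχ.abs_le p, abs_nonneg (streamHess G i j p)]

/-- Smooth approximations of the stream function. -/
theorem exists_stream_approx (h : SmallFlow M U G Ψ) : ∃ η : ℕ → ℝ × ℝ → ℝ,
    (∀ n, IsBump (η n)) ∧
    (∃ B, ∀ n j, ∀ p ∈ Omega, p.2 * |pd j (η n) p| ≤ B) ∧
    (∀ j, ∀ p ∈ Omega, Tendsto (fun n => pd j (η n) p) atTop (𝓝 (streamGrad U j p))) ∧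
    (∀ j, Tendsto (fun n => eLpNorm (fun p => pd j (η n) p - streamGrad U j p) 2 volΩ)
      atTop (𝓝 0)) ∧
    ∀ i j, Tendsto (fun n => eLpNorm (fun p => pd i (pd j (η n)) p - streamHess G i j p) 2 volΩ)
      atTop (𝓝 0) := by
  obtain ⟨C, hC0, hC⟩ := exists_isCutoff
  obtain ⟨B, hB0, hB⟩ := h.stream_bound
  have hpos : ∀ n : ℕ, (0 : ℝ) < (n : ℝ) + 1 := fun n => by positivity
  have hcut := fun n : ℕ => hC _ (hpos n)
  set S : ℕ → ℝ × ℝ → ℝ := fun n p => cutoff ((n : ℝ) + 1) p * Ψ p with hS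
  have hS2 := fun n => h.contDiff_mul_stream (hcut n).isBump
  have hε : ∀ n : ℕ, 0 < 1 / ((n : ℝ) + 1) := fun n => by positivity
  have htop : Tendsto (fun n : ℕ => (n : ℝ) + 1) atTop atTop :=
    tendsto_natCast_atTop_atTop.atTop_add tendsto_const_nhds
  -- At each point the truncated stream function eventually agrees with `Ψ` nearby, so all
  -- derivative errors are eventually zero there; domination then gives convergence in `L²`.
  have hev : ∀ p ∈ Omega, ∀ᶠ n in atTop, S n =ᶠ[𝓝 p] Ψ := fun p hp => by
    filter_upwards [htop.eventually (eventually_cutoff_eq_one hp)] with n hn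
    filter_upwards [hn] with q hq
    simp [hS, hq]
  have hΨ1 : ∀ j, ∀ p ∈ Omega, pd j Ψ =ᶠ[𝓝 p] streamGrad U j := fun j p hp => by
    filter_upwards [isOpen_Omega.mem_nhds hp] with q hq using h.hasGrad_stream.pd_eq j hq
  have p1 : ∀ j, ∀ p ∈ Omega, ∀ᶠ n in atTop, pd j (S n) p - streamGrad U j p = 0 := fun j p hp => by
    filter_upwards [hev p hp] with n hn
    rw [(pd_congr hn j).eq_of_nhds, h.hasGrad_stream.pd_eq j hp, sub_self]
  have p2 : ∀ i j, ∀ p ∈ Omega, ∀ᶠ n in atTop, pd i (pd j (S n)) p - streamHess G i j p = 0 :=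
    fun i j p hp => by
      filter_upwards [hev p hp] with n hn
      rw [(pd_congr ((pd_congr hn j).trans (hΨ1 j p hp)) i).eq_of_nhds,
        (h.hasGrad_streamGrad j).pd_eq i hp, sub_self]
  have c1 : ∀ n j, ContDiff ℝ 1 (pd j (S n)) := fun n j => by
    exact_mod_cast contDiff_pd_of_succ (n := 1) (by
      have := (hS2 n).1
      norm_num
      exact this) j
  have c2 : ∀ n i j, Continuous (pd i (pd j (S n))) := fun n i j =>
    (contDiff_pd_of_succ (n := 0) (by exact_mod_cast c1 n j) i).continuous
  have m1 := fun j => (h.memLp_streamGrad j).1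
  have m2 := fun i j => (h.memLp_streamHess i j).1
  have l1 : ∀ j, Tendsto (fun n => eLpNorm (fun p => pd j (S n) p - streamGrad U j p) 2 volΩ)
      atTop (𝓝 0) := fun j => by
    refine tendsto_eLpNorm_two_of_dominated
      (fun n => (c1 n j).continuous.aestronglyMeasurable.sub (m1 j))
      ((h.memLp_stream_div.abs.const_mul C).add ((h.memLp_streamGrad j).abs.const_mul (C + 1)))
      (fun n => ?_) ?_
    · filter_upwards [ae_restrict_mem measurableSet_Omega] with p hp
        using h.abs_pd_sub_le (hcut n) j hp
    · filter_upwards [ae_restrict_mem measurableSet_Omega] with p hp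
        using tendsto_const_nhds.congr' ((p1 j p hp).mono fun n hn => hn.symm)
  have l2 : ∀ i j, Tendsto (fun n => eLpNorm (fun p => pd i (pd j (S n)) p - streamHess G i j p) 2
      volΩ) atTop (𝓝 0) := fun i j => by
    refine tendsto_eLpNorm_two_of_dominated (fun n => (c2 n i j).aestronglyMeasurable.sub (m2 i j))
      (((h.memLp_stream_div_sq.abs.const_mul C).add
        ((h.memLp_streamGrad_div i).abs.const_mul C)).add
        (((h.memLp_streamGrad_div j).abs.const_mul C).add
          ((h.memLp_streamHess i j).abs.const_mul (C + 1)))) (fun n => ?_) ?_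
    · filter_upwards [ae_restrict_mem measurableSet_Omega] with p hp
        using h.abs_pd_pd_sub_le (hcut n) i j hp
    · filter_upwards [ae_restrict_mem measurableSet_Omega] with p hp
        using tendsto_const_nhds.congr' ((p2 i j p hp).mono fun n hn => hn.symm)
  choose η hη hη1 hη2 hη3 using fun n => exists_isBump_close (hS2 n).1 (hS2 n).2.1 (hS2 n).2.2 (hε n)
  have hlim := tendsto_one_div_add_atTop_nhds_zero_nat (𝕜 := ℝ)
  have hlimE : Tendsto (fun n : ℕ => ENNReal.ofReal (1 / ((n : ℝ) + 1))) atTop (𝓝 0) := by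
    simpa using ENNReal.tendsto_ofReal hlim
  have key : ∀ {a b : ℕ → ℝ × ℝ → ℝ} {c : ℝ × ℝ → ℝ}, (∀ n, Continuous (a n)) →
      (∀ n, Continuous (b n)) → AEStronglyMeasurable c volΩ →
      (∀ n, eLpNorm (fun p => a n p - b n p) 2 volΩ ≤ ENNReal.ofReal (1 / ((n : ℝ) + 1))) →
      Tendsto (fun n => eLpNorm (fun p => b n p - c p) 2 volΩ) atTop (𝓝 0) →
      Tendsto (fun n => eLpNorm (fun p => a n p - c p) 2 volΩ) atTop (𝓝 0) := by
    intro a b c ha hb hc hab hbc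
    have := hlimE.add hbc
    rw [add_zero] at this
    refine tendsto_of_tendsto_of_tendsto_of_le_of_le tendsto_const_nhds this (fun _ => zero_le)
      fun n => ?_
    have e : (fun p => a n p - c p) = (fun p => a n p - b n p) + fun p => b n p - c p := by
      ext p
      simp
    simp only
    rw [e]
    exact (eLpNorm_add_le ((ha n).sub (hb n)).aestronglyMeasurable
      ((hb n).aestronglyMeasurable.sub hc) (by norm_num)).trans (add_le_add_left (hab n) _)
  refine ⟨η, hη, ⟨1 + (C * B + C * M), fun n j p hp => ?_⟩, fun j p hp => ?_, fun j => ?_,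
    fun i j => ?_⟩
  · have hp1 : 1 < p.2 := hp
    have hs : 0 < p.2 - 1 := sub_pos.2 hp
    have h1 : p.2 * |pd j (S n) p| ≤ C * B + C * M := by
      rw [h.pd_mul_stream (hcut n).isBump j hp]
      -- The factor `y - 1` that controls the derivative of the cutoff is supplied by the bound
      -- `y|Ψ| ≤ B(y - 1)`.
      have e1 : p.2 * |pd j (cutoff ((n : ℝ) + 1)) p * Ψ p| ≤ C * B := by
        rw [abs_mul]
        have a1 := (hcut n).pd_le j p hp
        have a2 := hB p hp
        have a3 := abs_nonneg (pd j (cutoff ((n : ℝ) + 1)) p)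
        nlinarith [mul_le_mul_of_nonneg_left a2 a3, mul_le_mul_of_nonneg_left a1 hB0]
      have e2 : p.2 * |cutoff ((n : ℝ) + 1) p * streamGrad U j p| ≤ C * M := by
        rw [abs_mul]
        have a1 := (hcut n).abs_le p
        have a2 := h.mul_abs_streamGrad_le j hp
        have a3 : 0 ≤ p.2 * |streamGrad U j p| := by positivity
        calc _ = |cutoff ((n : ℝ) + 1) p| * (p.2 * |streamGrad U j p|) := by ring
          _ ≤ C * M := mul_le_mul a1 a2 a3 hC0
      have := mul_le_mul_of_nonneg_left (abs_add_le (pd j (cutoff ((n : ℝ) + 1)) p * Ψ p)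
        (cutoff ((n : ℝ) + 1) p * streamGrad U j p)) (by linarith : 0 ≤ p.2)
      linarith
    have h2 := hη1 n j p hp
    have h3 : 1 / ((n : ℝ) + 1) ≤ 1 := by
      rw [div_le_one (hpos n)]
      linarith [(n.cast_nonneg : (0 : ℝ) ≤ n)]
    have h4 := mul_le_mul_of_nonneg_left (abs_sub_abs_le_abs_sub (pd j (η n) p) (pd j (S n) p))
      (by linarith : 0 ≤ p.2)
    have h5 : p.2 * |pd j (η n) p - pd j (S n) p| ≤ 1 / ((n : ℝ) + 1) := h2
    linarith
  · have hp1 : 1 < p.2 := hp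
    have h1 : Tendsto (fun n => pd j (η n) p - pd j (S n) p) atTop (𝓝 0) := by
      refine squeeze_zero_norm (fun n => ?_) hlim
      refine le_trans ?_ (hη1 n j p hp)
      rw [Real.norm_eq_abs]
      exact le_mul_of_one_le_left (abs_nonneg _) hp1.le
    have h2 : Tendsto (fun n => pd j (S n) p) atTop (𝓝 (streamGrad U j p)) :=
      tendsto_const_nhds.congr' ((p1 j p hp).mono fun n hn => (sub_eq_zero.1 hn).symm)
    simpa using h1.add h2
  · exact key (fun n => ((hη n).pd j).smooth.continuous) (fun n => (c1 n j).continuous) (m1 j)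
      (fun n => hη2 n j) (l1 j)
  · exact key (fun n => (((hη n).pd j).pd i).smooth.continuous) (fun n => c2 n i j) (m2 i j)
      (fun n => hη3 n i j) (l2 i j)

end SmallFlow

theorem IsBump.grad_curlField {h : ℝ × ℝ → ℝ} (hh : IsBump h) (i : Fin 2) (p : ℝ × ℝ) :
    grad (curlField h) p i 0 = HalfPlaneNS.pd i (HalfPlaneNS.pd 1 h) p ∧
      grad (curlField h) p i 1 = -HalfPlaneNS.pd i (HalfPlaneNS.pd 0 h) p := by
  rw [← hh.isTest_curlField.pd_eq_grad, ← hh.isTest_curlField.pd_eq_grad]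
  refine ⟨rfl, ?_⟩
  have : (fun q => curlField h q 1) = fun q => -HalfPlaneNS.pd 0 h q := rfl
  rw [this, HalfPlaneNS.pd, fderiv_fun_neg]
  rfl

/-- Small flows are limits of test fields, in `L²` with their gradients and boundedly with the
weight `y`. -/
theorem SmallFlow.exists_approx {M : ℝ} {U : VField} {G : MField} {Ψ : ℝ × ℝ → ℝ}
    (h : SmallFlow M U G Ψ) : ∃ z : ℕ → VField, EnergyApprox U G z ∧
      (∃ B, ∀ n j, ∀ p ∈ Omega, p.2 * |z n p j| ≤ B) ∧
      (∀ j, ∀ p ∈ Omega, Tendsto (fun n => z n p j) atTop (𝓝 (U p j))) ∧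
      ∀ j, Tendsto (fun n => eLpNorm (fun p => z n p j - U p j) 2 volΩ) atTop (𝓝 0) := by
  obtain ⟨η, hη, ⟨B, hB⟩, hp, h1, h2⟩ := h.exists_stream_approx
  have hneg : ∀ {a : ℕ → ℝ × ℝ → ℝ} {b : ℝ × ℝ → ℝ},
      Tendsto (fun n => eLpNorm (fun p => a n p - -b p) 2 volΩ) atTop (𝓝 0) →
      Tendsto (fun n => eLpNorm (fun p => -a n p - b p) 2 volΩ) atTop (𝓝 0) := by
    intro a b hab
    refine hab.congr fun n => ?_
    rw [← eLpNorm_neg]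
    congr 1
    ext p
    simp only [Pi.neg_apply]
    ring
  have hL : ∀ j, Tendsto (fun n => eLpNorm (fun p => curlField (η n) p j - U p j) 2 volΩ)
      atTop (𝓝 0) := fun j => by
    fin_cases j
    · exact h1 1
    · exact hneg (h1 0)
  refine ⟨fun n => curlField (η n), ⟨fun n => (hη n).isTest_curlField, h.memLp_G, fun j => ?_,
    fun i j => ?_, fun j => ?_⟩, ⟨B, fun n j p hpΩ => ?_⟩, fun j p hpΩ => ?_, hL⟩
  · have hm : AEStronglyMeasurable (fun p => U p j / p.2) volΩ :=
      ((h.memLp_U j).1.aemeasurable.div measurable_snd.aemeasurable).aestronglyMeasurable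
    refine (h.memLp_U j).mono hm ?_
    filter_upwards [ae_restrict_mem measurableSet_Omega] with p hp
    have : 1 < p.2 := hp
    rw [norm_div]
    refine div_le_self (norm_nonneg _) ?_
    rw [Real.norm_eq_abs]
    exact this.le.trans (le_abs_self _)
  · fin_cases j
    · refine (h2 i 1).congr fun n => ?_
      simp only [Fin.zero_eta, ((hη n).grad_curlField i _).1]
      rfl
    · refine (hneg (h2 i 0)).congr fun n => ?_
      simp only [Fin.mk_one, ((hη n).grad_curlField i _).2]
  · refine tendsto_of_tendsto_of_tendsto_of_le_of_le tendsto_const_nhds (hL j) (fun _ => zero_le)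
      fun n => eLpNorm_mono_ae ?_
    filter_upwards [ae_restrict_mem measurableSet_Omega] with p hp
    have : 1 < p.2 := hp
    rw [← sub_div, norm_div]
    refine div_le_self (norm_nonneg _) ?_
    rw [Real.norm_eq_abs]
    exact this.le.trans (le_abs_self _)
  · fin_cases j
    · exact hB n 1 p hpΩ
    · simpa [curlField] using hB n 0 p hpΩ
  · fin_cases j
    · exact hp 1 p hpΩ
    · simpa [curlField, SmallFlow.streamGrad] using (hp 0 p hpΩ).neg

end HalfPlaneNS

end

noncomputable section

namespace HalfPlaneNS

open MeasureTheory Filter Real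

/-! ### Identities in the energy space -/

theorem integrable_contract {T H : MField} (hT : ∀ i j, MemLp (fun p => T p i j) 2 volΩ)
    (hH : ∀ i j, MemLp (fun p => H p i j) 2 volΩ) : Integrable (contract T H) volΩ :=
  integrable_finsetSum _ fun i _ => integrable_finsetSum _ fun j _ =>
    integrable_mul_of_memLp (hT i j) (hH i j)

theorem integral_contract {T H : MField} (hT : ∀ i j, MemLp (fun p => T p i j) 2 volΩ)
    (hH : ∀ i j, MemLp (fun p => H p i j) 2 volΩ) :
    ∫ p in Omega, contract T H p = ∑ i, ∑ j, ∫ p in Omega, T p i j * H p i j := by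
  have h1 := fun i j => integrable_mul_of_memLp (hT i j) (hH i j)
  simp only [contract]
  rw [integral_finsetSum _ fun i _ => integrable_finsetSum _ fun j _ => h1 i j]
  exact Finset.sum_congr rfl fun i _ => integral_finsetSum _ fun j _ => h1 i j

theorem integral_dot {A Z : VField} (h : ∀ j, Integrable (fun p => A p j * Z p j) volΩ) :
    ∫ p in Omega, dot A Z p = ∑ j, ∫ p in Omega, A p j * Z p j :=
  integral_finsetSum _ fun j _ => h j

theorem integrable_mul_of_weight {a z : ℝ × ℝ → ℝ} (ha : MemLp (fun p => p.2 * a p) 2 volΩ)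
    (hz : MemLp (fun p => z p / p.2) 2 volΩ) : Integrable (fun p => a p * z p) volΩ := by
  refine (integrable_mul_of_memLp ha hz).congr ?_
  filter_upwards [ae_restrict_mem measurableSet_Omega] with p hp
  have h1 : 1 < p.2 := hp
  have h2 : p.2 ≠ 0 := by linarith
  field_simp

/-- The bounded quantity `y|V|` absorbs the weight. Products of a small flow with an `L²` gradient
can therefore be paired with fields for which only `Z/y` is square integrable. -/
theorem memLp_mul_of_weight {V g : ℝ × ℝ → ℝ} {B : ℝ} (hV : AEStronglyMeasurable V volΩ)
    (hb : ∀ p ∈ Omega, p.2 * |V p| ≤ B) (hg : MemLp g 2 volΩ) :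
    MemLp (fun p => p.2 * (V p * g p)) 2 volΩ := by
  have hm : AEStronglyMeasurable (fun p : ℝ × ℝ => p.2 * (V p * g p)) volΩ :=
    measurable_snd.aestronglyMeasurable.mul (hV.mul hg.1)
  refine (hg.const_mul B).mono hm ?_
  filter_upwards [ae_restrict_mem measurableSet_Omega] with p hp
  have h1 : 1 < p.2 := hp
  rw [Real.norm_eq_abs, Real.norm_eq_abs, abs_mul, abs_mul, abs_mul, abs_of_pos (by linarith),
    ← mul_assoc]
  exact mul_le_mul_of_nonneg_right ((hb p hp).trans (le_abs_self _)) (abs_nonneg _)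

theorem memLp_of_weight {g : ℝ × ℝ → ℝ} (hg : MemLp (fun p => p.2 * g p) 2 volΩ)
    (hm : AEStronglyMeasurable g volΩ) : MemLp g 2 volΩ := by
  refine hg.mono hm ?_
  filter_upwards [ae_restrict_mem measurableSet_Omega] with p hp
  have h1 : 1 < p.2 := hp
  rw [norm_mul]
  refine le_mul_of_one_le_left (norm_nonneg _) ?_
  rw [Real.norm_eq_abs]
  exact h1.le.trans (le_abs_self _)

namespace EnergyApprox

variable {Z : VField} {H : MField} {w : ℕ → VField}

theorem tendsto_contract (h : EnergyApprox Z H w) {T : MField}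
    (hT : ∀ i j, MemLp (fun p => T p i j) 2 volΩ) :
    Tendsto (fun n => ∫ p in Omega, contract T (grad (w n)) p) atTop
      (𝓝 (∫ p in Omega, contract T H p)) := by
  have hw := fun n i j => ((h.test n).isBump_grad i j).memLp volΩ
  rw [integral_contract hT h.memLp_grad, funext fun n => integral_contract hT (hw n)]
  exact tendsto_finsetSum _ fun i _ => tendsto_finsetSum _ fun j _ =>
    tendsto_integral_mul (hT i j) (h.memLp_grad i j) (fun n => hw n i j) (h.tendsto_grad i j)

theorem tendsto_dot (h : EnergyApprox Z H w) {A : VField}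
    (hA : ∀ j, MemLp (fun p => p.2 * A p j) 2 volΩ) :
    Tendsto (fun n => ∫ p in Omega, dot A (w n) p) atTop (𝓝 (∫ p in Omega, dot A Z p)) := by
  have hw : ∀ n j, MemLp (fun p => w n p j / p.2) 2 volΩ := fun n j =>
    ((h.test n).isBump j).memLp_div
  have e : ∀ z : VField, ∀ j, ∫ p in Omega, A p j * z p j
      = ∫ p in Omega, (p.2 * A p j) * (z p j / p.2) := fun z j => by
    refine setIntegral_congr_fun measurableSet_Omega fun p hp => ?_
    have h1 : 1 < p.2 := hp
    have h2 : p.2 ≠ 0 := by linarith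
    field_simp
  have d : ∀ z : VField, (∀ j, MemLp (fun p => z p j / p.2) 2 volΩ) → ∫ p in Omega, dot A z p
      = ∑ j, ∫ p in Omega, (p.2 * A p j) * (z p j / p.2) := fun z hz => by
    rw [integral_dot fun j => integrable_mul_of_weight (hA j) (hz j)]
    exact Finset.sum_congr rfl fun j _ => e z j
  rw [d Z h.memLp_div]
  simp_rw [fun n => d (w n) (hw n)]
  exact tendsto_finsetSum _ fun j _ =>
    tendsto_integral_mul (hA j) (h.memLp_div j) (fun n => hw n j) (h.tendsto_div j)

/-- Linear identities for test fields extend to the energy space. -/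
theorem identity (h : EnergyApprox Z H w) {T : MField} {A : VField}
    (hT : ∀ i j, MemLp (fun p => T p i j) 2 volΩ) (hA : ∀ j, MemLp (fun p => p.2 * A p j) 2 volΩ)
    (hid : ∀ z, IsTest z → (∫ p in Omega, contract T (grad z) p) + ∫ p in Omega, dot A z p = 0) :
    (∫ p in Omega, contract T H p) + ∫ p in Omega, dot A Z p = 0 := by
  have h1 := (h.tendsto_contract hT).add (h.tendsto_dot hA)
  simp_rw [fun n => hid (w n) (h.test n)] at h1
  exact (tendsto_nhds_unique h1 tendsto_const_nhds)

theorem sub {Z' : VField} {H' : MField} {w' : ℕ → VField} (h : EnergyApprox Z H w)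
    (h' : EnergyApprox Z' H' w') : EnergyApprox (Z - Z') (H - H') (fun n => w n - w' n) := by
  have key : ∀ {a b : ℕ → ℝ × ℝ → ℝ} {c d : ℝ × ℝ → ℝ},
      (∀ n, AEStronglyMeasurable (fun p => a n p - c p) volΩ) →
      (∀ n, AEStronglyMeasurable (fun p => b n p - d p) volΩ) →
      Tendsto (fun n => eLpNorm (fun p => a n p - c p) 2 volΩ) atTop (𝓝 0) →
      Tendsto (fun n => eLpNorm (fun p => b n p - d p) 2 volΩ) atTop (𝓝 0) →
      Tendsto (fun n => eLpNorm (fun p => (a n p - b n p) - (c p - d p)) 2 volΩ) atTop (𝓝 0) := by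
    intro a b c d ha hb hac hbd
    have := hac.add hbd
    rw [add_zero] at this
    refine tendsto_of_tendsto_of_tendsto_of_le_of_le tendsto_const_nhds this (fun _ => zero_le)
      fun n => ?_
    have e : (fun p => (a n p - b n p) - (c p - d p))
        = (fun p => a n p - c p) - fun p => b n p - d p := by
      ext p
      simp only [Pi.sub_apply]
      ring
    simp only
    rw [e]
    exact eLpNorm_sub_le (ha n) (hb n) (by norm_num)
  have m1 := fun n i j => (((h.test n).isBump_grad i j).memLp volΩ).1.sub (h.memLp_grad i j).1
  have m1' := fun n i j => (((h'.test n).isBump_grad i j).memLp volΩ).1.sub (h'.memLp_grad i j).1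
  have m2 := fun n j => ((h.test n).isBump j).memLp_div.1.sub (h.memLp_div j).1
  have m2' := fun n j => ((h'.test n).isBump j).memLp_div.1.sub (h'.memLp_div j).1
  refine ⟨fun n => (h.test n).sub (h'.test n), fun i j => (h.memLp_grad i j).sub (h'.memLp_grad i j),
    fun j => ?_, fun i j => ?_, fun j => ?_⟩
  · refine ((h.memLp_div j).sub (h'.memLp_div j)).ae_eq (Eventually.of_forall fun p => ?_)
    simp [sub_div]
  · simp_rw [fun n p => (h.test n).grad_sub (h'.test n) p i j]
    exact key (m1 · i j) (m1' · i j) (h.tendsto_grad i j) (h'.tendsto_grad i j)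
  · simp only [Pi.sub_apply, sub_div]
    exact key (m2 · j) (m2' · j) (h.tendsto_div j) (h'.tendsto_div j)

theorem integral_hardy (h : EnergyApprox Z H w) (j : Fin 2) :
    ∫ p in Omega, (Z p j / p.2) ^ 2 ≤ 4 * ∫ p in Omega, H p 1 j ^ 2 := by
  have h1 := ENNReal.pow_le_pow_left (n := 2) (h.hardy j)
  have h0 : 0 ≤ ∫ p in Omega, H p 1 j ^ 2 := integral_nonneg fun p => sq_nonneg _
  rw [mul_pow, eLpNorm_two_sq (h.memLp_div j), eLpNorm_two_sq (h.memLp_grad 1 j),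
    show (2 : ℝ≥0∞) ^ 2 = ENNReal.ofReal 4 by norm_num, ← ENNReal.ofReal_mul (by norm_num)] at h1
  exact (ENNReal.ofReal_le_ofReal_iff (by positivity)).1 h1

end EnergyApprox

/-! ### Testing with a small flow -/

theorem hasGrad_const (c : ℝ) : HasGrad (fun _ => c) fun _ _ => 0 :=
  ⟨fun p _ => (hasFDerivAt_const c p).congr_fderiv (by ext <;> simp [coordR]),
    fun _ => continuousOn_const⟩

/-- The momentum flux `(U + e₁) ⊗ U`. -/
def flux (U : VField) : MField := fun p i j => (U p i + e1 i) * U p j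

/-- The gradient of `|U|² / 2`. -/
def kineticGrad (U : VField) (G : MField) : VField := fun p i => ∑ j, U p j * G p i j

namespace SmallFlow

variable {M : ℝ} {U : VField} {G : MField} {Ψ : ℝ × ℝ → ℝ} {f : VField}

/-- The quadratic part is square integrable because `y|U|` is bounded and `y > 1`; the linear part
because `U` is. -/
theorem memLp_flux (h : SmallFlow M U G Ψ) (i j : Fin 2) :
    MemLp (fun p => flux U p i j) 2 volΩ := by
  have h1 := memLp_of_weight (memLp_mul_of_weight (h.memLp_U i).1 (h.bound i) (h.memLp_U j))
    ((h.memLp_U i).1.mul (h.memLp_U j).1)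
  refine (h1.add ((h.memLp_U j).const_mul (e1 i))).ae_eq (Eventually.of_forall fun p => ?_)
  simp [flux, add_mul]

theorem memLp_mul_kineticGrad (h : SmallFlow M U G Ψ) (j : Fin 2) :
    MemLp (fun p => p.2 * kineticGrad U G p j) 2 volΩ := by
  have h1 := fun i => memLp_mul_of_weight (h.memLp_U i).1 (h.bound i) (h.memLp_G j i)
  refine ((h1 0).add (h1 1)).ae_eq (Eventually.of_forall fun p => ?_)
  simp [kineticGrad, Fin.sum_univ_two, mul_add]

/-- The convective term in divergence form. -/
theorem integral_advection (h : SmallFlow M U G Ψ) {z : VField} (hz : IsTest z) :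
    ∫ p in Omega, dot (advection U G) z p = -∫ p in Omega, contract (flux U) (grad z) p := by
  have hφ := fun i j => ((h.hasGrad i).add (hasGrad_const (e1 i))).mul (h.hasGrad j)
  have cadv : ∀ j, ContinuousOn (fun p => advection U G p j) Omega := fun j =>
    continuousOn_finsetSum _ fun i _ => ((h.contU i).add continuousOn_const).mul (h.contG i j)
  have key : ∀ j, ∫ p in Omega, advection U G p j * z p j
      = -∑ i, ∫ p in Omega, flux U p i j * grad z p i j := fun j => by
    have hb := hz.isBump j
    have h1 := fun i => (hφ i j).integral_mul_pd hb i
    have h2 : ∑ i, ∫ p in Omega, flux U p i j * grad z p i j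
        = ∑ i, -∫ p in Omega, ((G p i i + 0) * U p j + (U p i + e1 i) * G p i j) * z p j := by
      refine Finset.sum_congr rfl fun i _ => ?_
      rw [← h1 i]
      simp_rw [hz.pd_eq_grad]
      rfl
    rw [h2, Finset.sum_neg_distrib, neg_neg, ← integral_finsetSum _ fun i _ =>
      (hb.integrable_mul ((hφ i j).cont i)).integrableOn]
    refine setIntegral_congr_fun measurableSet_Omega fun p hp => ?_
    have hdiv := h.div p hp
    simp only [advection, Fin.sum_univ_two]
    linear_combination (-(U p j * z p j)) * hdiv
  rw [integral_dot fun j => ((hz.isBump j).integrable_mul (cadv j)).integrableOn,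
    integral_contract h.memLp_flux fun i j => (hz.isBump_grad i j).memLp volΩ, Finset.sum_comm,
    Finset.sum_congr rfl fun j _ => key j, Finset.sum_neg_distrib]

theorem memLp_mul_source (hf : IsSmoothCompact f) (j : Fin 2) :
    MemLp (fun p => p.2 * f p j) 2 volΩ := by
  have hb := hf.isBump j
  have hc : Continuous fun p : ℝ × ℝ => p.2 * f p j :=
    continuous_snd.mul hb.smooth.continuous
  exact hc.memLp_of_hasCompactSupport hb.compact.mul_left

variable {Z : VField} {H : MField} {w : ℕ → VField}

/-- The momentum equation for a small flow, tested with a field in the energy space. -/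
theorem momentum_energy (h : SmallFlow M U G Ψ) (hf : IsSmoothCompact f)
    (hm : MomentumWeak f U G) (hZ : EnergyApprox Z H w) :
    (∫ p in Omega, contract G H p) - (∫ p in Omega, contract (flux U) H p)
      = -∫ p in Omega, dot f Z p := by
  have hT : ∀ i j, MemLp (fun p => (G - flux U) p i j) 2 volΩ := fun i j =>
    (h.memLp_G i j).sub (h.memLp_flux i j)
  have hsub : ∀ {K : MField}, (∀ i j, MemLp (fun p => K p i j) 2 volΩ) →
      ∫ p in Omega, contract (G - flux U) K p
        = (∫ p in Omega, contract G K p) - ∫ p in Omega, contract (flux U) K p := fun hK => by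
    rw [← integral_sub (integrable_contract h.memLp_G hK) (integrable_contract h.memLp_flux hK)]
    refine integral_congr_ae (Eventually.of_forall fun p => ?_)
    simp only [contract, Fin.sum_univ_two, Pi.sub_apply]
    ring
  have := hZ.identity hT (A := f) (memLp_mul_source hf) fun z hz => by
    rw [hsub fun i j => (hz.isBump_grad i j).memLp volΩ]
    have h1 := hm z hz
    rw [h.integral_advection hz] at h1
    linarith
  rw [hsub hZ.memLp_grad] at this
  linarith

/-- A gradient is orthogonal to solenoidal test fields. The orthogonality passes to the energy space
because `y ∇|U|²` is square integrable. -/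
theorem integral_kinetic (h : SmallFlow M U G Ψ) (hZ : EnergyApprox Z H w) :
    ∫ p in Omega, dot (kineticGrad U G) Z p = 0 := by
  have h0 : ∀ K : MField, ∫ p in Omega, contract (0 : MField) K p = 0 := fun K => by
    simp [contract]
  have := hZ.identity (T := 0) (A := kineticGrad U G) (fun i j => MemLp.zero')
    h.memLp_mul_kineticGrad fun z hz => by
      have hφ := ((h.hasGrad 0).mul (h.hasGrad 0)).add ((h.hasGrad 1).mul (h.hasGrad 1))
      have h1 := hφ.integral_grad_mul hz
      have h2 : ∫ p in Omega, 2 * dot (kineticGrad U G) z p = 0 := by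
        rw [← h1]
        refine integral_congr_ae (Eventually.of_forall fun p => ?_)
        simp only [dot, kineticGrad, Fin.sum_univ_two]
        ring
      rw [integral_const_mul] at h2
      rw [h0, zero_add]
      linarith
  rwa [h0, zero_add] at this

/-- For test fields `v`, integration by parts in `x` gives `∫ U·∂ₓv + ∫ ∂ₓU·v = 0`. The square
integrability of `U` and of `y ∂ₓU` extends this to `v = U`, where both terms coincide and must
vanish. -/
theorem integral_mul_grad_zero (h : SmallFlow M U G Ψ) {z : ℕ → VField} (hz : EnergyApprox U G z) :
    ∫ p in Omega, dot (fun p j => G p 0 j) U p = 0 := by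
  set T : MField := fun p i j => e1 i * U p j with hTdef
  have hT : ∀ i j, MemLp (fun p => T p i j) 2 volΩ := fun i j => (h.memLp_U j).const_mul _
  have h1 := hz.identity (T := T) (A := fun p j => G p 0 j) hT h.memLp_yG fun v hv => by
    rw [integral_contract hT fun i j => (hv.isBump_grad i j).memLp volΩ,
      integral_dot fun j => ((hv.isBump j).integrable_mul (h.contG 0 j)).integrableOn]
    have h2 := fun j => (h.hasGrad j).integral_mul_pd (hv.isBump j) 0
    simp_rw [hv.pd_eq_grad] at h2
    simp only [hTdef, e1, Fin.sum_univ_two, if_true, one_ne_zero, if_false, one_mul, zero_mul,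
      integral_zero, h2]
    ring
  have h2 : ∫ p in Omega, contract T G p = ∫ p in Omega, dot (fun p j => G p 0 j) U p := by
    refine integral_congr_ae (Eventually.of_forall fun p => ?_)
    simp [contract, dot, hTdef, e1, Fin.sum_univ_two, mul_comm]
  linarith

/-- The equation of a weak solution can be tested with a small flow. -/
theorem weak_tested (h : SmallFlow M U G Ψ) (hf : IsSmoothCompact f) (hZ : EnergyApprox Z H w)
    (hZm : ∀ j, AEStronglyMeasurable (fun p => Z p j) volΩ) (hweak : MomentumWeak f Z H) :
    (∀ i j, Integrable (fun p => Z p i * H p i j * U p j) volΩ) ∧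
    (∫ p in Omega, contract H G p) + (∫ p in Omega, dot (advection Z H) U p)
      = -∫ p in Omega, dot f U p := by
  obtain ⟨z, hz, ⟨B, hB⟩, hzp, hzL⟩ := h.exists_approx
  have hzm := fun n j => ((hz.test n).isBump j).memLp volΩ
  have hprod : ∀ i j, Integrable (fun p => |Z p i / p.2| * |H p i j|) volΩ := fun i j =>
    integrable_mul_of_memLp (hZ.memLp_div i).abs (hZ.memLp_grad i j).abs
  -- The weight is split as `y · y⁻¹` between `V` and `Z`. The majorant depends on `V` only through
  -- the constant `b`, so it serves `U` and all its approximations at once.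
  have hle : ∀ {V : VField} {b : ℝ}, (∀ j, ∀ p ∈ Omega, p.2 * |V p j| ≤ b) → ∀ i j,
      ∀ᵐ p ∂volΩ, ‖Z p i * H p i j * V p j‖ ≤ b * (|Z p i / p.2| * |H p i j|) := by
    intro V b hV i j
    filter_upwards [ae_restrict_mem measurableSet_Omega] with p hp
    have h1 : 1 < p.2 := hp
    have h2 : 0 < p.2 := by linarith
    have e : ‖Z p i * H p i j * V p j‖ = (p.2 * |V p j|) * (|Z p i / p.2| * |H p i j|) := by
      rw [Real.norm_eq_abs, abs_mul, abs_mul, abs_div, abs_of_pos h2]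
      field_simp
    rw [e]
    exact mul_le_mul_of_nonneg_right (hV j p hp) (by positivity)
  have hmeas : ∀ {V : VField}, (∀ j, AEStronglyMeasurable (fun p => V p j) volΩ) → ∀ i j,
      AEStronglyMeasurable (fun p => Z p i * H p i j * V p j) volΩ := fun hV i j =>
    ((hZm i).mul (hZ.memLp_grad i j).1).mul (hV j)
  have hint : ∀ {V : VField} {b : ℝ}, (∀ j, MemLp (fun p => V p j) 2 volΩ) →
      (∀ j, ∀ p ∈ Omega, p.2 * |V p j| ≤ b) → ∀ i j,
      Integrable (fun p => Z p i * H p i j * V p j) volΩ := fun hV hb i j =>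
    ((hprod i j).const_mul _).mono' (hmeas (fun j => (hV j).1) i j) (hle hb i j)
  have hsplit : ∀ {V : VField} {b : ℝ}, (∀ j, MemLp (fun p => V p j) 2 volΩ) →
      (∀ j, ∀ p ∈ Omega, p.2 * |V p j| ≤ b) → ∫ p in Omega, dot (advection Z H) V p
        = (∑ i, ∑ j, ∫ p in Omega, Z p i * H p i j * V p j)
          + ∑ j, ∫ p in Omega, H p 0 j * V p j := by
    intro V b hV hb
    have i1 := hint hV hb
    have i2 := fun j => integrable_mul_of_memLp (hZ.memLp_grad 0 j) (hV j)
    have e : ∀ p, dot (advection Z H) V p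
        = (∑ i, ∑ j, Z p i * H p i j * V p j) + ∑ j, H p 0 j * V p j := fun p => by
      simp [dot, advection, Fin.sum_univ_two, e1]
      ring
    simp_rw [e]
    rw [integral_add (integrable_finsetSum _ fun i _ => integrable_finsetSum _ fun j _ => i1 i j)
        (integrable_finsetSum _ fun j _ => i2 j), integral_finsetSum _ fun j _ => i2 j,
      integral_finsetSum _ fun i _ => integrable_finsetSum _ fun j _ => i1 i j]
    congr 1
    exact Finset.sum_congr rfl fun i _ => integral_finsetSum _ fun j _ => i1 i j
  refine ⟨hint h.memLp_U h.bound, ?_⟩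
  -- The product `Z H` is not known to be square integrable, so `L²` convergence of the
  -- approximations does not suffice for the cubic terms; these use pointwise convergence with the
  -- common majorant. The linear term in `∂ₓZ` does converge by `L²` convergence.
  have t1 : Tendsto (fun n => ∫ p in Omega, dot (advection Z H) (z n) p) atTop
      (𝓝 (∫ p in Omega, dot (advection Z H) U p)) := by
    simp_rw [hsplit h.memLp_U h.bound, fun n => hsplit (hzm n) (hB n)]
    refine (tendsto_finsetSum _ fun i _ => tendsto_finsetSum _ fun j _ => ?_).add
      (tendsto_finsetSum _ fun j _ => tendsto_integral_mul (hZ.memLp_grad 0 j) (h.memLp_U j)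
        (fun n => hzm n j) (hzL j))
    refine tendsto_integral_of_dominated_convergence _
      (fun n => hmeas (fun j => (hzm n j).1) i j) ((hprod i j).const_mul B)
      (fun n => hle (hB n) i j) ?_
    filter_upwards [ae_restrict_mem measurableSet_Omega] with p hp
      using tendsto_const_nhds.mul (hzp j p hp)
  have t2 := (hz.tendsto_contract hZ.memLp_grad).add t1
  have t3 := (hz.tendsto_dot (memLp_mul_source hf)).neg
  simp_rw [fun n => hweak (z n) (hz.test n)] at t2
  exact tendsto_nhds_unique t2 t3

/-- A weak solution with the energy inequality coincides with a sufficiently small flow. -/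
theorem weak_unique (h : SmallFlow M U G Ψ) (hM : 3 * M < 1) (hf : IsSmoothCompact f)
    (hm : MomentumWeak f U G) (hZ : EnergyApprox Z H w)
    (hZm : ∀ j, AEStronglyMeasurable (fun p => Z p j) volΩ) (hweak : MomentumWeak f Z H)
    (henergy : (∫ p in Omega, contract H H p) ≤ -∫ p in Omega, dot f Z p) : Z =ᵐ[volΩ] U := by
  obtain ⟨z, hz, -, -, -⟩ := h.exists_approx
  obtain ⟨hI, e2⟩ := h.weak_tested hf hZ hZm hweak
  have e3 := h.momentum_energy hf hm hZ
  have e4 := h.momentum_energy hf hm hz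
  have e5 := h.integral_kinetic hZ
  have e6 := h.integral_mul_grad_zero hz
  have hD := hZ.sub hz
  have iHH := integrable_contract hZ.memLp_grad hZ.memLp_grad
  have iHG := integrable_contract hZ.memLp_grad h.memLp_G
  have iGG := integrable_contract h.memLp_G h.memLp_G
  have iDD := integrable_contract hD.memLp_grad hD.memLp_grad
  have iFH := integrable_contract h.memLp_flux hZ.memLp_grad
  have iFG := integrable_contract h.memLp_flux h.memLp_G
  have iK : Integrable (dot (kineticGrad U G) Z) volΩ := integrable_finsetSum _ fun j _ =>
    integrable_mul_of_weight (h.memLp_mul_kineticGrad j) (hZ.memLp_div j)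
  have iG0 : Integrable (dot (fun p j => G p 0 j) U) volΩ := integrable_finsetSum _ fun j _ =>
    integrable_mul_of_memLp (h.memLp_G 0 j) (h.memLp_U j)
  have iA : Integrable (dot (advection Z H) U) volΩ := by
    refine (integrable_finsetSum Finset.univ fun j _ => (integrable_finsetSum Finset.univ
      fun i _ => (hI i j).add ((integrable_mul_of_memLp (hZ.memLp_grad i j)
        (h.memLp_U j)).const_mul (e1 i)))).congr (Eventually.of_forall fun p => ?_)
    simp [dot, advection, Fin.sum_univ_two]
    ring
  -- The integrand `((Z - U)·∇(Z - U))·U`. Expanding it produces the convective terms of the tested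
  -- equations; the two additional integrals vanish by the kinetic and `∂ₓ` identities.
  set R : ℝ × ℝ → ℝ := fun p => ∑ i, ∑ j, (Z p i - U p i) * (H p i j - G p i j) * U p j with hR
  have hRe : ∀ p, R p = dot (advection Z H) U p - contract (flux U) H p
      - dot (kineticGrad U G) Z p + contract (flux U) G p - dot (fun p j => G p 0 j) U p := by
    intro p
    simp [hR, dot, advection, contract, flux, kineticGrad, e1, Fin.sum_univ_two]
    ring
  have iR : Integrable R volΩ := by
    refine ((((iA.sub iFH).sub iK).add iFG).sub iG0).congr (Eventually.of_forall fun p => ?_)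
    rw [hRe]
    rfl
  have eR : ∫ p in Omega, R p = (∫ p in Omega, dot (advection Z H) U p)
      - (∫ p in Omega, contract (flux U) H p) + ∫ p in Omega, contract (flux U) G p := by
    have j1 : Integrable (fun p => dot (advection Z H) U p - contract (flux U) H p) volΩ :=
      iA.sub iFH
    have j2 : Integrable (fun p => dot (advection Z H) U p - contract (flux U) H p
      - dot (kineticGrad U G) Z p) volΩ := j1.sub iK
    have j3 : Integrable (fun p => dot (advection Z H) U p - contract (flux U) H p
      - dot (kineticGrad U G) Z p + contract (flux U) G p) volΩ := j2.add iFG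
    simp_rw [hRe]
    rw [integral_sub j3 iG0, integral_add j2 iFG, integral_sub j1 iK, integral_sub iA iFH, e5, e6]
    ring
  have eD : ∫ p in Omega, contract (H - G) (H - G) p = (∫ p in Omega, contract H H p)
      - 2 * (∫ p in Omega, contract H G p) + ∫ p in Omega, contract G G p := by
    have j1 : Integrable (fun p => contract H H p - 2 * contract H G p) volΩ :=
      iHH.sub (iHG.const_mul 2)
    rw [← integral_const_mul, ← integral_sub iHH (iHG.const_mul 2), ← integral_add j1 iGG]
    refine integral_congr_ae (Eventually.of_forall fun p => ?_)
    simp only [contract, Fin.sum_univ_two, Pi.sub_apply]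
    ring
  have esymm : ∫ p in Omega, contract G H p = ∫ p in Omega, contract H G p := by
    refine integral_congr_ae (Eventually.of_forall fun p => ?_)
    simp only [contract, Fin.sum_univ_two]
    ring
  -- The energy inequality bounds `∫ |H|²` by `-∫ f·Z`, which the equation of `U` tested with `Z`
  -- rewrites; the equations tested with `U` remove the remaining source terms.
  have hDR : ∫ p in Omega, contract (H - G) (H - G) p ≤ ∫ p in Omega, R p := by linarith
  have iW := fun j => (hD.memLp_div j).integrable_sq
  have iD1 := fun j => (hD.memLp_grad 1 j).integrable_sq
  have hM0 := h.nonneg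
  have hRle : ∫ p in Omega, R p ≤ ∫ p in Omega, M * ((1 / 2) * (((Z - U) p 0 / p.2) ^ 2
      + ((Z - U) p 1 / p.2) ^ 2) + contract (H - G) (H - G) p) := by
    refine setIntegral_mono_on iR (((((iW 0).add (iW 1)).const_mul _).add iDD).const_mul M)
      measurableSet_Omega fun p hp => ?_
    have h1 : 1 < p.2 := hp
    have h2 : 0 < p.2 := by linarith
    have hterm : ∀ i j, (Z p i - U p i) * (H p i j - G p i j) * U p j
        ≤ M * ((1 / 4) * ((Z - U) p i / p.2) ^ 2 + (H - G) p i j ^ 2) := by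
      intro i j
      have a1 := h.bound j p hp
      set a := (Z - U) p i / p.2 with ha
      set b := (H - G) p i j
      have a2 : Z p i - U p i = a * p.2 := by
        rw [ha, div_mul_cancel₀ _ h2.ne']
        rfl
      -- The weight `1/4` matches Hardy's constant `4`: summed over the two values of `j`, the first
      -- terms contribute at most `2S` and the second ones `S`.
      have a3 : |a * b| ≤ (1 / 4) * a ^ 2 + b ^ 2 := by
        rw [abs_le]
        constructor <;> nlinarith [sq_nonneg (a - 2 * b), sq_nonneg (a + 2 * b)]
      calc (Z p i - U p i) * (H p i j - G p i j) * U p j = (a * b) * (p.2 * U p j) := by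
            rw [a2]
            simp only [b, Pi.sub_apply]
            ring
        _ ≤ |a * b| * (p.2 * |U p j|) := by
            refine (le_abs_self _).trans (le_of_eq ?_)
            rw [abs_mul, abs_mul p.2, abs_of_pos h2]
        _ ≤ |a * b| * M := mul_le_mul_of_nonneg_left a1 (abs_nonneg _)
        _ ≤ _ := by
            rw [mul_comm]
            exact mul_le_mul_of_nonneg_left a3 hM0
    simp only [hR, contract, Fin.sum_univ_two]
    nlinarith [hterm 0 0, hterm 0 1, hterm 1 0, hterm 1 1]
  have jW : Integrable (fun p => (1 / 2) * (((Z - U) p 0 / p.2) ^ 2 + ((Z - U) p 1 / p.2) ^ 2))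
      volΩ := ((iW 0).add (iW 1)).const_mul _
  rw [integral_const_mul, integral_add jW iDD, integral_const_mul,
    integral_add (iW 0) (iW 1)] at hRle
  have hsum : (∫ p in Omega, (H - G) p 1 0 ^ 2) + (∫ p in Omega, (H - G) p 1 1 ^ 2)
      ≤ ∫ p in Omega, contract (H - G) (H - G) p := by
    rw [← integral_add (iD1 0) (iD1 1)]
    refine integral_mono ((iD1 0).add (iD1 1)) iDD fun p => ?_
    simp only [contract, Fin.sum_univ_two]
    nlinarith [sq_nonneg ((H - G) p 0 0), sq_nonneg ((H - G) p 0 1)]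
  set S := ∫ p in Omega, contract (H - G) (H - G) p
  have y0 := hD.integral_hardy 0
  have y1 := hD.integral_hardy 1
  have d0 : 0 ≤ ∫ p in Omega, (H - G) p 1 0 ^ 2 := integral_nonneg fun p => sq_nonneg _
  have d1 : 0 ≤ ∫ p in Omega, (H - G) p 1 1 ^ 2 := integral_nonneg fun p => sq_nonneg _
  have hS : S ≤ 3 * M * S := by
    refine (hDR.trans hRle).trans ?_
    have : 1 / 2 * ((∫ p in Omega, ((Z - U) p 0 / p.2) ^ 2)
      + ∫ p in Omega, ((Z - U) p 1 / p.2) ^ 2) + S ≤ 3 * S := by linarith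
    nlinarith [mul_le_mul_of_nonneg_left this hM0]
  have hS0 : S ≤ 0 := by nlinarith
  have hzero : ∀ j, ∀ᵐ p ∂volΩ, (Z - U) p j / p.2 = 0 := by
    intro j
    have hj : ∫ p in Omega, ((Z - U) p j / p.2) ^ 2 = 0 := by
      refine le_antisymm ?_ (integral_nonneg fun p => sq_nonneg _)
      fin_cases j
      · exact y0.trans (by linarith)
      · exact y1.trans (by linarith)
    have := (integral_eq_zero_iff_of_nonneg (fun p => sq_nonneg _) (iW j)).1 hj
    filter_upwards [this] with p hp
    exact pow_eq_zero_iff (two_ne_zero) |>.1 hp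
  filter_upwards [hzero 0, hzero 1, ae_restrict_mem measurableSet_Omega] with p h0 h1 hp
  have hp1 : 1 < p.2 := hp
  have hp2 : p.2 ≠ 0 := by linarith
  ext j
  have hj : (Z - U) p j / p.2 = 0 := by fin_cases j <;> assumption
  rw [div_eq_zero_iff, or_iff_left hp2] at hj
  exact sub_eq_zero.1 hj

end SmallFlow

end HalfPlaneNS

end

/-! ### Choice of the smallness threshold -/

theorem mainTheorem5 (α : ℝ) (hα : 3 < α) :
    ∃ η : ℝ, 0 < η ∧
      ∀ f : HalfPlaneNS.VField, HalfPlaneNS.IsSmoothCompact f →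
      ∀ (ω u v : ℝ → ℝ → ℂ) (ubar : HalfPlaneNS.VField),
        HalfPlaneNS.IsAlphaSolution α f ω u v ubar →
        HalfPlaneNS.uNorm α ω u v < ENNReal.ofReal η →
      ∀ utilde : HalfPlaneNS.VField, HalfPlaneNS.IsWeakSolution f utilde →
        utilde =ᵐ[MeasureTheory.volume.restrict HalfPlaneNS.Omega] ubar := by
  set I : ℝ := ∫ k, HalfPlaneNS.maj (3 / 4) k with hI
  have hI0 : 0 ≤ I := MeasureTheory.integral_nonneg fun k => HalfPlaneNS.maj_nonneg _ _
  -- With `M = 8ηI` this choice gives `3M = I/(1 + I) < 1`, and the added one avoids having to show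
  -- `I > 0`.
  have hη : 0 < 1 / (24 * (1 + I)) := by positivity
  refine ⟨1 / (24 * (1 + I)), hη, fun f hf ω u v ubar ha hs utilde hweak => ?_⟩
  have hF := HalfPlaneNS.fourierData_of_isAlphaSolution hα hη.le ha hs.le
  obtain ⟨H, hD, hw, he⟩ := hweak
  obtain ⟨w, hZ⟩ := hD.exists_energyApprox
  refine (hF.smallFlow ha.inverse).weak_unique ?_ hf (hF.momentumWeak hf ha) hZ hD.meas hw he
  rw [← hI, show 3 * (8 * (1 / (24 * (1 + I))) * I) = I / (1 + I) by field_simp; norm_num,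
    div_lt_one (by positivity)]
  linarith
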